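/- \textbf{Conventions.} A \emph{smooth space with a real structure over} $\mathbb{CP}^1$ is a complex manifold with a surjective holomorphic submersion to $\mathbb{CP}^1$ and an antiholomorphic involution covering the antipodal map; its \emph{vertical} tangent spaces are the tangent spaces of the fibres. A \emph{twistor group} $\mathcal G\to\mathbb{CP}^1$ is a group in the category of such spaces; $\operatorname{Lie}(\mathcal G)$ is the holomorphic vector bundle on $\mathbb{CP}^1$ given by the vertical tangent spaces along the identity section. A \emph{twistor subgroup} $\mathcal H\subset\mathcal G$ is a twistor group with an injective immersive homomorphism of twistor groups $\mathcal H\to\mathcal G$. A \emph{twistor space} is a smooth space $p:Z\to\mathbb{CP}^1$ with a real structure and a holomorphic $\mathcal O(2)$-valued fibrewise symplectic form $\omega$ compatible with the real structure, which has at least one twistor section; a \emph{twistor section} is a real holomorphic section whose normal bundle (the vertical tangent bundle along the section) is a direct sum of copies of $\mathcal O(1)$. (The twistor space of any hyperk\"ahler manifold is of this kind.) An action of $\mathcal G$ on $Z$ is a holomorphic, fibrewise action $\mathcal G\times_{\mathbb{CP}^1}Z\to Z$ compatible with the real structures. It is \emph{locally free} if the stabilizer in $\mathcal G_{p(z)}$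 of every $z\in Z$ is discrete. It is \emph{Hamiltonian} if it preserves $\omega$ on each fibre and has a moment map, i.e. a holomorphic map $\mu:Z\to\operatorname{Lie}(\mathcal G)^*\otimes\mathcal O(2)$ over $\mathbb{CP}^1$ which on each fibre is a moment map for $\omega$, equivariant for the coadjoint action. Given a locally free Hamiltonian action of $\mathcal G$ on $Z$ and a twistor section $s$, let $L$ be the subbundle of the normal bundle of $s$ generated by $\operatorname{Lie}(\mathcal G)$, and $L^\perp$ its $\omega$-orthogonal in the normal bundle. Then $s$ is \emph{$\mathcal G$-admissible} if $L^\perp/(L\cap L^\perp)$ is a direct sum of copies of $\mathcal O(1)$. \textbf{Proposition.} Let $\mathcal H$ be a twistor subgroup of a twistor group $\mathcal G$ such that $\operatorname{Lie}(\mathcal G)/\operatorname{Lie}(\mathcal H)$ is a direct sum of copies of $\mathcal O(1)$. Suppose that $\mathcal G$ acts on a twistor space $Z\to\mathbb{CP}^1$, and that the action is locally free and Hamiltonian with moment map $\mu$. Let $s$ be a $\mathcal G$-admissible twistor section of $Z$ such that $\mu\circ s$ is $\mathcal G$-invariant (for the coadjoint action). Then $s$ is $\mathcal H$-admissible: the action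 of $\mathcal H$ on $Z$ is locally free and Hamiltonian, and, $P$ being the subbundle of the normal bundle of $s$ generated by $\operatorname{Lie}(\mathcal H)$, one has $P\subset P^\perp$ and $P^\perp/P$ is a direct sum of copies of $\mathcal O(1)$. -/

import Mathlib

open scoped Manifold ContDiff Topology ComplexConjugate

noncomputable section

namespace TwistorQuotient

/-! ## The complex projective line -/

/-- The complex projective line `ℂP¹ = ℂ ∪ {∞}`, with affine coordinate `ζ`. -/
abbrev CP1 : Type := OnePoint ℂ

/-- The involution `ζ ↦ 1/ζ` of the projective line. -/
def cinv : CP1 → CP1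
  | OnePoint.infty => ((0 : ℂ) : CP1)
  | (z : ℂ) => if z = 0 then OnePoint.infty else ((z⁻¹ : ℂ) : CP1)

@[simp] lemma cinv_infty : cinv OnePoint.infty = ((0 : ℂ) : CP1) := rfl

lemma cinv_coe (z : ℂ) : cinv (z : CP1) = if z = 0 then OnePoint.infty else ((z⁻¹ : ℂ) : CP1) := rfl

@[simp] lemma cinv_zero : cinv ((0 : ℂ) : CP1) = OnePoint.infty := by simp [cinv_coe]

lemma cinv_coe_of_ne {z : ℂ} (hz : z ≠ 0) : cinv (z : CP1) = ((z⁻¹ : ℂ) : CP1) := by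
  simp [cinv_coe, hz]

@[simp] lemma cinv_cinv (x : CP1) : cinv (cinv x) = x := by
  induction x using OnePoint.rec with
  | infty => simp
  | coe z =>
    by_cases hz : z = 0
    · subst hz; simp
    · rw [cinv_coe_of_ne hz, cinv_coe_of_ne (inv_ne_zero hz), inv_inv]

lemma continuous_cinv : Continuous cinv := by
  rw [OnePoint.continuous_iff, Filter.coclosedCompact_eq_cocompact]
  constructor
  · have h1 : Filter.Tendsto (fun z : ℂ => ((z⁻¹ : ℂ) : CP1)) (Filter.cocompact ℂ)
        (𝓝 ((0 : ℂ) : CP1)) := by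
      refine (OnePoint.continuous_coe.tendsto _).comp ?_
      rw [← Metric.cobounded_eq_cocompact]
      exact Filter.tendsto_inv₀_cobounded
    refine h1.congr' ?_
    have : ∀ᶠ z : ℂ in Filter.cocompact ℂ, z ∈ ({0} : Set ℂ)ᶜ :=
      (isCompact_singleton (x := (0 : ℂ))).compl_mem_cocompact
    filter_upwards [this] with z hz
    exact (cinv_coe_of_ne hz).symm
  · rw [continuous_iff_continuousAt]
    intro z
    by_cases hz : z = 0
    · subst hz
      rw [continuousAt_iff_punctured_nhds]
      have h1 : Filter.Tendsto (fun z : ℂ => ((z⁻¹ : ℂ) : CP1)) (𝓝[≠] 0) (𝓝 OnePoint.infty) := by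
        have h2 : Filter.Tendsto ((↑) : ℂ → CP1) (Filter.cocompact ℂ) (𝓝 OnePoint.infty) := by
          rw [← Filter.coclosedCompact_eq_cocompact]
          exact OnePoint.tendsto_coe_infty
        refine h2.comp ?_
        rw [← Metric.cobounded_eq_cocompact]
        exact Filter.tendsto_inv₀_nhdsNE_zero
      rw [cinv_zero]
      refine h1.congr' ?_
      filter_upwards [self_mem_nhdsWithin] with w hw
      exact (cinv_coe_of_ne hw).symm
    · have h1 : ContinuousAt (fun z : ℂ => ((z⁻¹ : ℂ) : CP1)) z :=
        OnePoint.continuous_coe.continuousAt.comp (continuousAt_inv₀ hz)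
      refine h1.congr ?_
      filter_upwards [isOpen_ne.mem_nhds hz] with w hw
      exact (cinv_coe_of_ne hw).symm

/-- `ζ ↦ 1/ζ` as a homeomorphism. -/
def cinvHomeo : CP1 ≃ₜ CP1 where
  toFun := cinv
  invFun := cinv
  left_inv := cinv_cinv
  right_inv := cinv_cinv
  continuous_toFun := continuous_cinv
  continuous_invFun := continuous_cinv

/-- The affine chart `ζ` on `ℂP¹ ∖ {∞}`. -/
def chartZero : OpenPartialHomeomorph CP1 ℂ :=
  (OnePoint.isOpenEmbedding_coe.toOpenPartialHomeomorph ((↑) : ℂ → CP1)).symm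

/-- The affine chart `1/ζ` on `ℂP¹ ∖ {0}`. -/
def chartInfty : OpenPartialHomeomorph CP1 ℂ :=
  cinvHomeo.toOpenPartialHomeomorph.trans chartZero

lemma chartZero_source : chartZero.source = Set.range ((↑) : ℂ → CP1) := by
  simp [chartZero]

lemma chartZero_symm_apply (z : ℂ) : chartZero.symm z = (z : CP1) := rfl

lemma chartZero_coe (z : ℂ) : chartZero (z : CP1) = z :=
  OnePoint.isOpenEmbedding_coe.toOpenPartialHomeomorph_left_inv

lemma chartInfty_source : chartInfty.source = cinv ⁻¹' Set.range ((↑) : ℂ → CP1) := by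
  simp [chartInfty, chartZero_source, cinvHomeo]

lemma chartInfty_apply (x : CP1) : chartInfty x = chartZero (cinv x) := rfl

lemma chartInfty_symm_apply (z : ℂ) : chartInfty.symm z = cinv (z : CP1) := rfl

open Classical in
instance : ChartedSpace ℂ CP1 where
  atlas := {chartZero, chartInfty}
  chartAt x := if x = OnePoint.infty then chartInfty else chartZero
  mem_chart_source x := by
    induction x using OnePoint.rec with
    | infty => simp [chartInfty_source]
    | coe z => simp [chartZero_source]
  chart_mem_atlas x := by
    by_cases hx : x = OnePoint.infty <;> simp [hx]

instance : IsManifold 𝓘(ℂ) ω CP1 := by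
  have key : ContDiffOn ℂ ω (fun z : ℂ => z⁻¹) {0}ᶜ := fun z hz =>
    (contDiffAt_inv ℂ hz).contDiffWithinAt
  refine isManifold_of_contDiffOn _ _ _ ?_
  rintro e e' (rfl | rfl) (rfl | rfl)
  · refine contDiffOn_id.congr ?_
    intro z _
    simp [chartZero_symm_apply, chartZero_coe]
  · refine (key.congr ?_).mono ?_ (s := {0}ᶜ)
    · intro z hz
      simp [chartZero_symm_apply, chartInfty_apply, cinv_coe_of_ne hz, chartZero_coe]
    · rintro z ⟨hz, -⟩ rfl
      simp [chartInfty_source, chartZero_symm_apply] at hz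
  · refine (key.congr ?_).mono ?_ (s := {0}ᶜ)
    · intro z hz
      simp [chartInfty_symm_apply, cinv_coe_of_ne hz, chartZero_coe]
    · rintro z ⟨hz, -⟩ rfl
      simp [chartZero_source, chartInfty_symm_apply] at hz
  · refine contDiffOn_id.congr ?_
    intro z _
    simp [chartInfty_symm_apply, chartInfty_apply, chartZero_coe]

/-- The antipodal map `ζ ↦ -1/ζ̄` of the projective line. -/
def antipode : CP1 → CP1
  | OnePoint.infty => ((0 : ℂ) : CP1)
  | (z : ℂ) => if z = 0 then OnePoint.infty else ((-(conj z)⁻¹ : ℂ) : CP1)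

/-! ## The line bundles `𝒪(k)`

The fibre of `𝒪(k)` over `ζ ≠ ∞` is identified with `ℂ` by the trivialization over `ℂP¹ ∖ {∞}`, and
the fibre over `∞` by the trivialization over `ℂP¹ ∖ {0}`.  The coordinates `v` and `ṽ` of a point
over `ζ ≠ 0, ∞` in the two trivializations are related by `ṽ = ζ⁻ᵏ v`. -/

/-- The factor by which the identification of the fibre of `𝒪(k)` with `ℂ` is to be multiplied in
order to obtain the coordinate in the trivialization over `ℂP¹ ∖ {0}`
(the value at `ζ = 0` is irrelevant). -/
def transition (k : ℤ) : CP1 → ℂ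
  | OnePoint.infty => 1
  | (z : ℂ) => z ^ (-k)

/-- Let `q : M → ℂP¹` be a map.  An `𝒪(k)`-valued function `h` on `M` (assigning to `x` an element of
the fibre of `𝒪(k)` over `q x`) is holomorphic on `U`, i.e. is a holomorphic section over `U` of the
pull-back of `𝒪(k)`. -/
def IsHoloO {E : Type*} [NormedAddCommGroup E] [NormedSpace ℂ E] {M : Type*} [TopologicalSpace M]
    [ChartedSpace E M] (k : ℤ) (q : M → CP1) (h : M → ℂ) (U : Set M) : Prop :=
  ContMDiffOn 𝓘(ℂ, E) 𝓘(ℂ) ω h (U ∩ q ⁻¹' {OnePoint.infty}ᶜ) ∧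
  ContMDiffOn 𝓘(ℂ, E) 𝓘(ℂ) ω (fun x => transition k (q x) * h x) (U ∩ q ⁻¹' {((0 : ℂ) : CP1)}ᶜ)

/-- The antilinear map from the fibre of `𝒪(2)` over `ζ` to the fibre over the antipodal point which
is `v ↦ v̄ / ζ̄²` in the trivialization over `ℂP¹ ∖ {∞}`.  Up to a constant of modulus one, it is the
only real structure of `𝒪(2)` which covers the antipodal map. -/
def conjO2 : CP1 → ℂ → ℂ
  | OnePoint.infty, v => conj v
  | (z : ℂ), v => if z = 0 then conj v else conj v / conj z ^ 2

/-! ## Spaces over `ℂP¹`, and vector bundles over `ℂP¹` -/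

/-- A map is antiholomorphic if it is real-analytic with antilinear differentials. -/
def IsAntiholomorphic {E : Type*} [NormedAddCommGroup E] [NormedSpace ℂ E] {Z : Type*}
    [TopologicalSpace Z] [ChartedSpace E Z] (τ : Z → Z) : Prop :=
  ContMDiff 𝓘(ℝ, E) 𝓘(ℝ, E) ω τ ∧
  ∀ z : Z, let D : E →L[ℝ] E := mfderiv 𝓘(ℝ, E) 𝓘(ℝ, E) τ z
    ∀ v : E, D (Complex.I • v) = -(Complex.I • D v)

/-- A smooth space with a real structure over `ℂP¹`: a complex manifold `Z` with a surjective
holomorphic submersion to `ℂP¹` and an antiholomorphic involution covering the antipodal map. -/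
structure RealSpace (E : Type*) [NormedAddCommGroup E] [NormedSpace ℂ E]
    (Z : Type*) [TopologicalSpace Z] [ChartedSpace E Z] [IsManifold 𝓘(ℂ, E) ω Z] where
  /-- the projection -/
  proj : Z → CP1
  isSubmersion : Manifold.IsSubmersion 𝓘(ℂ, E) 𝓘(ℂ) ω proj
  surjective : Function.Surjective proj
  /-- the real structure -/
  τ : Z → Z
  antiholomorphic : IsAntiholomorphic (E := E) τ
  involutive : Function.Involutive τ
  proj_τ : ∀ z, proj (τ z) = antipode (proj z)

section Bundles

variable {E : Type*} [NormedAddCommGroup E] [NormedSpace ℂ E]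
  {Z : Type*} [TopologicalSpace Z] [ChartedSpace E Z] [IsManifold 𝓘(ℂ, E) ω Z]

/-- The vertical tangent space: the tangent space of the fibre through `z`. -/
def RealSpace.vert (S : RealSpace E Z) (z : Z) : Submodule ℂ (TangentSpace 𝓘(ℂ, E) z) :=
  LinearMap.ker (mfderiv 𝓘(ℂ, E) 𝓘(ℂ) S.proj z).toLinearMap

/-- A vector field `σ` of `Z` along a map `s : ℂP¹ → Z` is holomorphic on `U`, i.e. `σ` is a
holomorphic section over `U` of the pull-back of the tangent bundle of `Z`. -/
def IsHoloAlong (s : CP1 → Z) (σ : ∀ ζ, TangentSpace 𝓘(ℂ, E) (s ζ)) (U : Set CP1) : Prop :=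
  ContMDiffOn 𝓘(ℂ) 𝓘(ℂ, E).tangent ω
    (fun ζ => (⟨s ζ, σ ζ⟩ : TangentBundle 𝓘(ℂ, E) Z)) U

/-- The fibre over `ζ` of the quotient bundle `A / (A ∩ B)`, where `A` and `B` are families of
subspaces of the pull-back of the tangent bundle of `Z` by `s : ℂP¹ → Z`. -/
abbrev QuotFiber {s : CP1 → Z} (A B : ∀ ζ, Submodule ℂ (TangentSpace 𝓘(ℂ, E) (s ζ))) (ζ : CP1) :
    Type _ :=
  A ζ ⧸ (B ζ).submoduleOf (A ζ)

/-- A section of `A / (A ∩ B)` is holomorphic on `U` if near each point of `U` it lifts to a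
holomorphic section of `A`. -/
def IsHoloQuot (s : CP1 → Z) (A B : ∀ ζ, Submodule ℂ (TangentSpace 𝓘(ℂ, E) (s ζ)))
    (ρ : ∀ ζ, QuotFiber A B ζ) (U : Set CP1) : Prop :=
  ∀ ζ₀ ∈ U, ∃ V : Set CP1, IsOpen V ∧ ζ₀ ∈ V ∧ V ⊆ U ∧ ∃ σ : ∀ ζ, A ζ,
    IsHoloAlong s (fun ζ => (σ ζ : TangentSpace 𝓘(ℂ, E) (s ζ))) V ∧
    ∀ ζ ∈ V, ((B ζ).submoduleOf (A ζ)).mkQ (σ ζ) = ρ ζ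

/-- `A / (A ∩ B)` is, as a holomorphic vector bundle over `ℂP¹`, isomorphic to a direct sum
of copies of `𝒪(k)`: there are linear isomorphisms of the fibres which identify the holomorphic
sections over any open set. -/
def IsSumOfO (k : ℤ) (s : CP1 → Z) (A B : ∀ ζ, Submodule ℂ (TangentSpace 𝓘(ℂ, E) (s ζ))) : Prop :=
  ∃ (r : ℕ) (φ : ∀ ζ, QuotFiber A B ζ ≃ₗ[ℂ] (Fin r → ℂ)),
    ∀ U : Set CP1, IsOpen U → ∀ ρ : ∀ ζ, QuotFiber A B ζ,
      IsHoloQuot s A B ρ U ↔ ∀ i, IsHoloO (E := ℂ) k id (fun ζ => φ ζ (ρ ζ) i) U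

/-- A twistor section (twistor line): a real holomorphic section whose normal bundle is a
direct sum of copies of `𝒪(1)`.  The normal bundle of a section is identified, as usual, with the
restriction of the vertical tangent bundle. -/
structure RealSpace.IsTwistorSection (S : RealSpace E Z) (s : CP1 → Z) : Prop where
  holomorphic : ContMDiff 𝓘(ℂ) 𝓘(ℂ, E) ω s
  proj_section : ∀ ζ, S.proj (s ζ) = ζ
  real : ∀ ζ, S.τ (s ζ) = s (antipode ζ)
  normal : IsSumOfO 1 s (fun ζ => S.vert (s ζ)) (fun _ => ⊥)

/-- A two-form on the fibres of `Z` is closed on each fibre.  This is tested by pulling back along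
arbitrary holomorphic maps `ψ` from open sets of `ℂ³` to the fibre: with
`ω_{ij} = ω(∂_i ψ, ∂_j ψ)` one has `∂₀ω₁₂ + ∂₁ω₂₀ + ∂₂ω₀₁ = 0`. -/
def RealSpace.IsFiberClosed (S : RealSpace E Z)
    (w : ∀ z : Z, TangentSpace 𝓘(ℂ, E) z →ₗ[ℂ] TangentSpace 𝓘(ℂ, E) z →ₗ[ℂ] ℂ) : Prop :=
  ∀ (ζ : CP1) (W : Set (Fin 3 → ℂ)) (ψ : (Fin 3 → ℂ) → Z), IsOpen W →
    ContMDiffOn 𝓘(ℂ, Fin 3 → ℂ) 𝓘(ℂ, E) ω ψ W → (∀ x ∈ W, S.proj (ψ x) = ζ) →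
    let e : Fin 3 → (Fin 3 → ℂ) := fun i => Pi.single i 1
    let c : Fin 3 → Fin 3 → (Fin 3 → ℂ) → ℂ := fun i j x =>
      w (ψ x) (mfderiv 𝓘(ℂ, Fin 3 → ℂ) 𝓘(ℂ, E) ψ x (e i))
        (mfderiv 𝓘(ℂ, Fin 3 → ℂ) 𝓘(ℂ, E) ψ x (e j))
    ∀ x ∈ W, fderiv ℂ (c 1 2) x (e 0) + fderiv ℂ (c 2 0) x (e 1) + fderiv ℂ (c 0 1) x (e 2) = 0

end Bundles

/-- A twistor space (of a possibly indefinite hyperkähler manifold): a smooth space over `ℂP¹` with a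
real structure, a holomorphic `𝒪(2)`-valued symplectic form along the fibres which is
compatible with the real structure, and at least one twistor section.
The form is written as a form on the tangent spaces of `Z`, but only its values on
vertical vectors have a meaning and are used. -/
structure TwistorSpace (E : Type*) [NormedAddCommGroup E] [NormedSpace ℂ E]
    (Z : Type*) [TopologicalSpace Z] [ChartedSpace E Z] [IsManifold 𝓘(ℂ, E) ω Z] extends RealSpace E Z where
  /-- the twisted symplectic form -/
  form : ∀ z : Z, TangentSpace 𝓘(ℂ, E) z →ₗ[ℂ] TangentSpace 𝓘(ℂ, E) z →ₗ[ℂ] ℂ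
  form_self : ∀ z, ∀ v ∈ toRealSpace.vert z, form z v v = 0
  form_nondegenerate : ∀ z, ∀ v ∈ toRealSpace.vert z,
    (∀ w ∈ toRealSpace.vert z, form z v w = 0) → v = 0
  form_holomorphic : ∀ (U : Set Z) (V W : ∀ z : Z, TangentSpace 𝓘(ℂ, E) z), IsOpen U →
    (∀ z, V z ∈ toRealSpace.vert z) → (∀ z, W z ∈ toRealSpace.vert z) →
    ContMDiffOn 𝓘(ℂ, E) 𝓘(ℂ, E).tangent ω (fun z => (⟨z, V z⟩ : TangentBundle 𝓘(ℂ, E) Z)) U →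
    ContMDiffOn 𝓘(ℂ, E) 𝓘(ℂ, E).tangent ω (fun z => (⟨z, W z⟩ : TangentBundle 𝓘(ℂ, E) Z)) U →
    IsHoloO (E := E) 2 proj (fun z => form z (V z) (W z)) U
  form_closed : toRealSpace.IsFiberClosed form
  form_real : ∃ c : ℂ, ‖c‖ = 1 ∧ ∀ z, ∀ v ∈ toRealSpace.vert z, ∀ w ∈ toRealSpace.vert z,
    form (τ z) ((mfderiv 𝓘(ℝ, E) 𝓘(ℝ, E) τ z : E →L[ℝ] E) v)
      ((mfderiv 𝓘(ℝ, E) 𝓘(ℝ, E) τ z : E →L[ℝ] E) w) = c * conjO2 (proj z) (form z v w)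
  exists_twistorSection : ∃ s, toRealSpace.IsTwistorSection s

/-! ## Twistor groups

Operations which exist only fibrewise (multiplication, action) are given by functions on the whole
product, whose values outside the fibre product over `ℂP¹` are irrelevant.  A map on the
fibre product, or on a fibre, is holomorphic if it is so as a map on a subset of the ambient complex
manifold.  The derivative of a map on a fibre at a point is `mfderivWithin` with respect to the
fibre, on vertical vectors (on which it is uniquely determined since they are the vectors
tangent to the fibre). -/

/-- A twistor group: a group in the category of smooth spaces with a real structure
over `ℂP¹`. -/
structure TwistorGroup (E : Type*) [NormedAddCommGroup E] [NormedSpace ℂ E]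
    (G : Type*) [TopologicalSpace G] [ChartedSpace E G] [IsManifold 𝓘(ℂ, E) ω G] extends RealSpace E G where
  /-- fibrewise multiplication -/
  mul : G → G → G
  /-- fibrewise inverse -/
  inv : G → G
  /-- the identity section -/
  one : CP1 → G
  proj_mul : ∀ g h, proj g = proj h → proj (mul g h) = proj g
  proj_inv : ∀ g, proj (inv g) = proj g
  proj_one : ∀ ζ, proj (one ζ) = ζ
  holomorphic_mul : ContMDiffOn (𝓘(ℂ, E).prod 𝓘(ℂ, E)) 𝓘(ℂ, E) ω
    (fun q : G × G => mul q.1 q.2) {q | proj q.1 = proj q.2}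
  holomorphic_inv : ContMDiff 𝓘(ℂ, E) 𝓘(ℂ, E) ω inv
  holomorphic_one : ContMDiff 𝓘(ℂ) 𝓘(ℂ, E) ω one
  mul_assoc : ∀ g h k, proj g = proj h → proj h = proj k → mul (mul g h) k = mul g (mul h k)
  one_mul : ∀ g, mul (one (proj g)) g = g
  inv_mul : ∀ g, mul (inv g) g = one (proj g)
  τ_mul : ∀ g h, proj g = proj h → τ (mul g h) = mul (τ g) (τ h)
  τ_inv : ∀ g, τ (inv g) = inv (τ g)
  τ_one : ∀ ζ, τ (one ζ) = one (antipode ζ)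

section Groups

variable {E : Type*} [NormedAddCommGroup E] [NormedSpace ℂ E]
  {Z : Type*} [TopologicalSpace Z] [ChartedSpace E Z] [IsManifold 𝓘(ℂ, E) ω Z]
  {EG : Type*} [NormedAddCommGroup EG] [NormedSpace ℂ EG]
  {G : Type*} [TopologicalSpace G] [ChartedSpace EG G] [IsManifold 𝓘(ℂ, EG) ω G]
  {EH : Type*} [NormedAddCommGroup EH] [NormedSpace ℂ EH]
  {H : Type*} [TopologicalSpace H] [ChartedSpace EH H] [IsManifold 𝓘(ℂ, EH) ω H]

/-- The fibre of the Lie algebra `Lie(𝒢)` over `ζ`.  The bundle `Lie(𝒢)` is the normal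
bundle of the identity section, i.e. the restriction to it of the vertical tangent bundle. -/
def TwistorGroup.lie (𝒢 : TwistorGroup EG G) (ζ : CP1) :
    Submodule ℂ (TangentSpace 𝓘(ℂ, EG) (𝒢.one ζ)) :=
  𝒢.vert (𝒢.one ζ)

/-- The adjoint action of `g` on the fibre of `Lie(𝒢)`: the derivative at the identity of
`h ↦ g h g⁻¹`, as a map on the fibre of `𝒢` through `g`. -/
def TwistorGroup.ad (𝒢 : TwistorGroup EG G) (g : G) :
    TangentSpace 𝓘(ℂ, EG) (𝒢.one (𝒢.proj g)) →L[ℂ] TangentSpace 𝓘(ℂ, EG) (𝒢.one (𝒢.proj g)) :=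
  mfderivWithin 𝓘(ℂ, EG) 𝓘(ℂ, EG) (fun h => 𝒢.mul (𝒢.mul g h) (𝒢.inv g))
    (𝒢.proj ⁻¹' {𝒢.proj g}) (𝒢.one (𝒢.proj g))

/-- `ℋ` is a twistor subgroup of `𝒢` through the inclusion `ι`, an injective immersive homomorphism
of twistor groups. -/
structure IsTwistorSubgroup (ℋ : TwistorGroup EH H) (𝒢 : TwistorGroup EG G) (ι : H → G) : Prop where
  isImmersion : Manifold.IsImmersion 𝓘(ℂ, EH) 𝓘(ℂ, EG) ω ι
  injective : Function.Injective ι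
  proj_incl : ∀ h, 𝒢.proj (ι h) = ℋ.proj h
  incl_mul : ∀ h k, ℋ.proj h = ℋ.proj k → ι (ℋ.mul h k) = 𝒢.mul (ι h) (ι k)
  incl_one : ∀ ζ, ι (ℋ.one ζ) = 𝒢.one ζ
  incl_τ : ∀ h, ι (ℋ.τ h) = 𝒢.τ (ι h)

/-- The inclusion `Lie(ℋ) → Lie(𝒢)` over `ζ`: the derivative of `ι` at the identity. -/
def lieIncl (ℋ : TwistorGroup EH H) (𝒢 : TwistorGroup EG G) (ι : H → G) (ζ : CP1) :
    TangentSpace 𝓘(ℂ, EH) (ℋ.one ζ) →L[ℂ] TangentSpace 𝓘(ℂ, EG) (𝒢.one ζ) :=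
  mfderiv 𝓘(ℂ, EH) 𝓘(ℂ, EG) ι (ℋ.one ζ)

/-- The subspace `Lie(ℋ)` of `Lie(𝒢)` over `ζ`. -/
def lieImage (ℋ : TwistorGroup EH H) (𝒢 : TwistorGroup EG G) (ι : H → G) (ζ : CP1) :
    Submodule ℂ (TangentSpace 𝓘(ℂ, EG) (𝒢.one ζ)) :=
  Submodule.map (lieIncl ℋ 𝒢 ι ζ).toLinearMap (ℋ.lie ζ)

/-! ## Actions -/

/-- An action of a twistor group on a smooth space with a real structure over `ℂP¹`. -/
structure TwistorAction (𝒢 : TwistorGroup EG G) (S : RealSpace E Z) where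
  /-- the action map -/
  act : G → Z → Z
  holomorphic : ContMDiffOn (𝓘(ℂ, EG).prod 𝓘(ℂ, E)) 𝓘(ℂ, E) ω
    (fun q : G × Z => act q.1 q.2) {q | 𝒢.proj q.1 = S.proj q.2}
  proj_act : ∀ g z, 𝒢.proj g = S.proj z → S.proj (act g z) = S.proj z
  one_act : ∀ z, act (𝒢.one (S.proj z)) z = z
  mul_act : ∀ g h z, 𝒢.proj g = 𝒢.proj h → 𝒢.proj h = S.proj z →
    act (𝒢.mul g h) z = act g (act h z)
  act_τ : ∀ g z, 𝒢.proj g = S.proj z → act (𝒢.τ g) (S.τ z) = S.τ (act g z)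

/-- The action of a twistor subgroup. -/
def TwistorAction.restrict {ℋ : TwistorGroup EH H} {𝒢 : TwistorGroup EG G} {S : RealSpace E Z}
    (a : TwistorAction 𝒢 S) {ι : H → G} (hι : IsTwistorSubgroup ℋ 𝒢 ι) : TwistorAction ℋ S where
  act h z := a.act (ι h) z
  holomorphic := by
    have h1 : ContMDiffOn (𝓘(ℂ, EH).prod 𝓘(ℂ, E)) (𝓘(ℂ, EG).prod 𝓘(ℂ, E)) ω
        (fun q : H × Z => ((ι q.1, q.2) : G × Z)) {q | ℋ.proj q.1 = S.proj q.2} :=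
      ((hι.isImmersion.contMDiff.comp contMDiff_fst).prodMk contMDiff_snd).contMDiffOn
    refine a.holomorphic.comp h1 ?_
    intro q hq
    simpa [hι.proj_incl] using hq
  proj_act h z hz := a.proj_act _ _ (by rw [hι.proj_incl, hz])
  one_act z := by rw [hι.incl_one, a.one_act]
  mul_act g h z hgh hz := by
    rw [hι.incl_mul _ _ hgh, a.mul_act _ _ _ (by rw [hι.proj_incl, hι.proj_incl, hgh])
      (by rw [hι.proj_incl, hz])]
  act_τ h z hz := by
    rw [hι.incl_τ, a.act_τ _ _ (by rw [hι.proj_incl, hz])]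

/-- The action is locally free: the stabilizer of every point (in the group which acts on the fibre
through the point) is discrete. -/
def TwistorAction.LocallyFree {𝒢 : TwistorGroup EG G} {S : RealSpace E Z}
    (a : TwistorAction 𝒢 S) : Prop :=
  ∀ z, DiscreteTopology {g : G // 𝒢.proj g = S.proj z ∧ a.act g z = z}

/-- The infinitesimal action over `ζ`: an element `X` of `Lie(𝒢)` over `ζ` is mapped to the value at
`z` (a point of the fibre over `ζ`) of the vector field which it generates, i.e. to its image under
the derivative at the identity of `g ↦ g · z`. -/
def TwistorAction.infAct {𝒢 : TwistorGroup EG G} {S : RealSpace E Z} (a : TwistorAction 𝒢 S)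
    (ζ : CP1) (z : Z) : TangentSpace 𝓘(ℂ, EG) (𝒢.one ζ) →L[ℂ] TangentSpace 𝓘(ℂ, E) z :=
  mfderivWithin 𝓘(ℂ, EG) 𝓘(ℂ, E) (fun g => a.act g z) (𝒢.proj ⁻¹' {ζ}) (𝒢.one ζ)

/-- The action is symplectic on each fibre. -/
def TwistorAction.IsSymplectic {𝒢 : TwistorGroup EG G} {T : TwistorSpace E Z}
    (a : TwistorAction 𝒢 T.toRealSpace) : Prop :=
  ∀ g z, 𝒢.proj g = T.proj z → ∀ v ∈ T.vert z, ∀ w ∈ T.vert z,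
    T.form (a.act g z)
      (mfderivWithin 𝓘(ℂ, E) 𝓘(ℂ, E) (a.act g) (T.proj ⁻¹' {T.proj z}) z v)
      (mfderivWithin 𝓘(ℂ, E) 𝓘(ℂ, E) (a.act g) (T.proj ⁻¹' {T.proj z}) z w) = T.form z v w

/-- A map `μ : Z → Lie(𝒢)* ⊗ 𝒪(2)` over `ℂP¹` assigns to `z` an `𝒪(2)`-valued linear form on the
fibre of `Lie(𝒢)` over the projection of `z`.  (The form is written on the tangent space of
`𝒢`, but only its values on `Lie(𝒢)` have a meaning and are used.) -/
abbrev MomentMapData (𝒢 : TwistorGroup EG G) (S : RealSpace E Z) : Type _ :=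
  ∀ z : Z, TangentSpace 𝓘(ℂ, EG) (𝒢.one (S.proj z)) →ₗ[ℂ] ℂ

/-- `μ` is a holomorphic map `Z → Lie(𝒢)* ⊗ 𝒪(2)` which on each fibre is an (equivariant) moment map
for the action with respect to the twisted symplectic form. -/
structure TwistorAction.IsMomentMap {𝒢 : TwistorGroup EG G} {T : TwistorSpace E Z}
    (a : TwistorAction 𝒢 T.toRealSpace) (μ : MomentMapData 𝒢 T.toRealSpace) : Prop where
  /-- the contraction with any local holomorphic section of `Lie(𝒢)` is holomorphic -/
  holomorphic : ∀ (U : Set CP1) (X : ∀ ζ, TangentSpace 𝓘(ℂ, EG) (𝒢.one ζ)), IsOpen U →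
    (∀ ζ, X ζ ∈ 𝒢.lie ζ) → IsHoloAlong 𝒢.one X U →
    IsHoloO (E := E) 2 T.proj (fun z => μ z (X (T.proj z))) (T.proj ⁻¹' U)
  /-- `d⟨μ, X⟩ = ω(X, ·)` on each fibre -/
  hamiltonian : ∀ z, ∀ X ∈ 𝒢.lie (T.proj z), ∀ v ∈ T.vert z,
    (mfderivWithin 𝓘(ℂ, E) 𝓘(ℂ) (fun z' => (μ z' : EG →ₗ[ℂ] ℂ) X)
      (T.proj ⁻¹' {T.proj z}) z : E →L[ℂ] ℂ) v = T.form z (a.infAct (T.proj z) z X) v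
  /-- equivariance with respect to the coadjoint action -/
  equivariant : ∀ g z, 𝒢.proj g = T.proj z → ∀ X ∈ 𝒢.lie (T.proj z),
    (μ (a.act g z) : EG →ₗ[ℂ] ℂ) (𝒢.ad g X) = μ z X

/-- The action is Hamiltonian: it is symplectic and has a moment map. -/
def TwistorAction.IsHamiltonian {𝒢 : TwistorGroup EG G} {T : TwistorSpace E Z}
    (a : TwistorAction 𝒢 T.toRealSpace) : Prop :=
  a.IsSymplectic ∧ ∃ μ, a.IsMomentMap μ

/-- The section `μ ∘ s` of `Lie(𝒢)* ⊗ 𝒪(2)` is invariant under the coadjoint action of `𝒢`. -/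
def IsInvariantAlong {𝒢 : TwistorGroup EG G} {S : RealSpace E Z} (μ : MomentMapData 𝒢 S)
    (s : CP1 → Z) : Prop :=
  ∀ g, ∀ X ∈ 𝒢.lie (𝒢.proj g), (μ (s (𝒢.proj g)) : EG →ₗ[ℂ] ℂ) (𝒢.ad g X) =
    (μ (s (𝒢.proj g)) : EG →ₗ[ℂ] ℂ) X

/-! ## Admissible sections -/

/-- The subbundle of the normal bundle of the section `s` generated by the Lie algebra of the
twistor group. -/
def TwistorAction.generated {𝒢 : TwistorGroup EG G} {S : RealSpace E Z} (a : TwistorAction 𝒢 S)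
    (s : CP1 → Z) (ζ : CP1) : Submodule ℂ (TangentSpace 𝓘(ℂ, E) (s ζ)) :=
  Submodule.map (a.infAct ζ (s ζ)).toLinearMap (𝒢.lie ζ)

/-- The orthogonal, in the vertical tangent space, with respect to the twisted symplectic form. -/
def TwistorSpace.perp (T : TwistorSpace E Z) {z : Z} (A : Submodule ℂ (TangentSpace 𝓘(ℂ, E) z)) :
    Submodule ℂ (TangentSpace 𝓘(ℂ, E) z) where
  carrier := {v | v ∈ T.vert z ∧ ∀ w ∈ A, T.form z w v = 0}
  zero_mem' := ⟨Submodule.zero_mem _, fun _ _ => map_zero _⟩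
  add_mem' hv hw := ⟨Submodule.add_mem _ hv.1 hw.1, fun u hu => by
    rw [map_add, hv.2 u hu, hw.2 u hu, add_zero]⟩
  smul_mem' c _ hv := ⟨Submodule.smul_mem _ c hv.1, fun u hu => by
    rw [map_smul, hv.2 u hu, smul_zero]⟩

/-- Let `𝒢` act on the twistor space `T`.  The section `s` is `𝒢`-admissible: the action is
locally free and Hamiltonian, `s` is a twistor section, and `L^⊥ / (L ∩ L^⊥)` is a direct sum of
line bundles of degree one, where `L` is the bundle generated by the Lie algebra of `𝒢`. -/
structure TwistorAction.IsAdmissible {𝒢 : TwistorGroup EG G} {T : TwistorSpace E Z}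
    (a : TwistorAction 𝒢 T.toRealSpace) (s : CP1 → Z) : Prop where
  locallyFree : a.LocallyFree
  hamiltonian : a.IsHamiltonian
  twistorSection : T.IsTwistorSection s
  isSumOfO : IsSumOfO 1 s (fun ζ => T.perp (a.generated s ζ)) (a.generated s)

end Groups

end TwistorQuotient

end

/-!
Write `P ⊆ L` for the bundles along the twistor section `s` which are generated by `Lie(ℋ)` and
`Lie(𝒢)`. The proof has three ingredients.

*Local freeness.* A locally free action has an injective infinitesimal action
(`TwistorAction.LocallyFree.eq_zero_of_infAct_eq_zero`): if `X ≠ 0` is killed at `z`, then the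
orbit map is constant along the integral curve of the left invariant vector field of `X`, so that
the stabilizer of `z` is not discrete. Hence `P` and `L` are holomorphic subbundles of the normal
bundle (`TwistorAction.LocallyFree.isSubbundle_generated`), and `L / P ≅ Lie(𝒢) / Lie(ℋ)` is a
direct sum of copies of `𝒪(1)` (`IsTwistorSubgroup.isFrameO1_generated`).

*Isotropy.* Where the moment map is invariant, equivariance makes it constant on the orbit, and
`d⟨μ, X⟩ = ω(X, ·)` then says that the orbit is isotropic
(`TwistorAction.IsMomentMap.form_infAct_eq_zero`). Thus `P ⊆ L ⊆ L^⊥ ⊆ P^⊥`, and in particular `P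
⊆ P^⊥`.

*Linear algebra over `ℂP¹`.* The bundle `P^⊥ / P` is filtered with the subquotients `L / P`, `L^⊥
/ L` and `P^⊥ / L^⊥`. The first two are sums of copies of `𝒪(1)` by hypothesis. The `𝒪(2)`-valued
symplectic form makes the third one isomorphic to `(L / P)* ⊗ 𝒪(2)`, which is a sum of copies of
`𝒪(1)` as well. An extension of sums of copies of `𝒪(1)` splits because `H¹(ℂP¹, 𝒪) = 0`.

Since the normal bundle of `s` is itself a sum of copies of `𝒪(1)`, tensoring everything with
`𝒪(-1)` turns it into a trivial bundle with fibre `V = ℂᵐ` and `ω` into a holomorphic family of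
nondegenerate forms on `V` (`IsNormalFrame`, `formAlong`). The bundles in question become families
of subspaces of `V`, and being a sum of copies of `𝒪(1)` becomes the existence of a global
holomorphic frame of the quotient (`IsQuotFrame`). The vanishing of the cohomology enters as
`IsHolSection.exists_lift`: a section of `A / B` lifts to `A / C` if `B / C` is trivial. The lift
to `A` with values in a fixed complement of one fibre of `B` has finitely many poles, and these
are removed modulo `C` by subtracting their principal parts, which are rational functions. The
splittings are put together in `exists_quotFrame_orth`.
-/

noncomputable section

namespace TwistorQuotient

/-! ### Holomorphic functions on the projective line -/

/-- A function on `ℂP¹` with values in a normed space is holomorphic at a point. -/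
def HolAt {W : Type*} [NormedAddCommGroup W] [NormedSpace ℂ W] (f : CP1 → W) (p : CP1) : Prop :=
  ContMDiffAt 𝓘(ℂ) 𝓘(ℂ, W) ω f p

section HolAt

variable {W W' : Type*} [NormedAddCommGroup W] [NormedSpace ℂ W] [NormedAddCommGroup W']
  [NormedSpace ℂ W'] {f g : CP1 → W} {p : CP1}

lemma HolAt.add (hf : HolAt f p) (hg : HolAt g p) : HolAt (fun ζ => f ζ + g ζ) p :=
  ContMDiffAt.add hf hg

lemma HolAt.sub (hf : HolAt f p) (hg : HolAt g p) : HolAt (fun ζ => f ζ - g ζ) p :=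
  ContMDiffAt.sub hf hg

lemma HolAt.smul {c : CP1 → ℂ} (hc : HolAt c p) (hf : HolAt f p) : HolAt (fun ζ => c ζ • f ζ) p :=
  ContMDiffAt.smul hc hf

lemma HolAt.mul {c d : CP1 → ℂ} (hc : HolAt c p) (hd : HolAt d p) : HolAt (fun ζ => c ζ * d ζ) p :=
  ContMDiffAt.mul hc hd

lemma HolAt.inv {c : CP1 → ℂ} (hc : HolAt c p) (h0 : c p ≠ 0) : HolAt (fun ζ => (c ζ)⁻¹) p :=
  ContMDiffAt.inv₀ hc h0

lemma HolAt.div {c d : CP1 → ℂ} (hc : HolAt c p) (hd : HolAt d p) (h0 : d p ≠ 0) :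
    HolAt (fun ζ => c ζ / d ζ) p :=
  ContMDiffAt.div₀ hc hd h0

lemma HolAt.const (w : W) : HolAt (fun _ => w) p := contMDiffAt_const

lemma HolAt.sum {ι : Type*} {t : Finset ι} {f : ι → CP1 → W} (hf : ∀ i ∈ t, HolAt (f i) p) :
    HolAt (fun ζ => ∑ i ∈ t, f i ζ) p :=
  ContMDiffAt.sum hf

lemma HolAt.prod {ι : Type*} {t : Finset ι} {f : ι → CP1 → ℂ} (hf : ∀ i ∈ t, HolAt (f i) p) :
    HolAt (fun ζ => ∏ i ∈ t, f i ζ) p :=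
  ContMDiffAt.prod hf

lemma HolAt.clm (L : W →L[ℂ] W') (hf : HolAt f p) : HolAt (fun ζ => L (f ζ)) p :=
  (L.contMDiff (n := ω)).contMDiffAt.comp p hf

lemma HolAt.clm_apply {L : CP1 → W →L[ℂ] W'} (hL : HolAt L p) (hf : HolAt f p) :
    HolAt (fun ζ => L ζ (f ζ)) p :=
  ContMDiffAt.clm_apply hL hf

lemma holAt_pi {ι : Type*} [Fintype ι] {f : CP1 → ι → ℂ} :
    HolAt f p ↔ ∀ i, HolAt (fun ζ => f ζ i) p :=
  contMDiffAt_pi_space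

lemma HolAt.congr (hf : HolAt f p) (h : ∀ᶠ ζ in 𝓝 p, g ζ = f ζ) : HolAt g p :=
  ContMDiffAt.congr_of_eventuallyEq hf h

lemma HolAt.eventually (hf : HolAt f p) : ∀ᶠ ζ in 𝓝 p, HolAt f ζ :=
  (contMDiffAt_iff_contMDiffAt_nhds (by simp)).1 hf

lemma HolAt.continuousAt (hf : HolAt f p) : ContinuousAt f p :=
  ContMDiffAt.continuousAt hf

/-- Holomorphy at a point can be tested in any inverse chart around it. -/
lemma holAt_iff_of_chart [CompleteSpace W] {e : OpenPartialHomeomorph CP1 ℂ}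
    (he : e ∈ IsManifold.maximalAtlas 𝓘(ℂ) ω CP1) {z : ℂ} (hz : z ∈ e.target) :
    HolAt f (e.symm z) ↔ AnalyticAt ℂ (fun w => f (e.symm w)) z := by
  have hs : e.symm z ∈ e.source := e.map_target hz
  constructor
  · intro h
    have h1 : ContMDiffAt 𝓘(ℂ) 𝓘(ℂ) ω e.symm z := contMDiffAt_symm_of_mem_maximalAtlas he hz
    exact (contMDiffAt_iff_contDiffAt.1 (ContMDiffAt.comp z h h1)).analyticAt
  · intro h
    have h1 : ContMDiffAt 𝓘(ℂ) 𝓘(ℂ) ω e (e.symm z) := contMDiffAt_of_mem_maximalAtlas he hs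
    have h2 : ContMDiffAt 𝓘(ℂ) 𝓘(ℂ, W) ω (fun w => f (e.symm w)) (e (e.symm z)) := by
      rw [e.right_inv hz]
      exact h.contDiffAt.contMDiffAt
    refine (ContMDiffAt.comp _ h2 h1).congr_of_eventuallyEq ?_
    filter_upwards [e.open_source.mem_nhds hs] with x hx
    simp [e.left_inv hx]

lemma chartZero_mem : chartZero ∈ IsManifold.maximalAtlas 𝓘(ℂ) ω CP1 :=
  IsManifold.subset_maximalAtlas (by left; rfl)

lemma chartInfty_mem : chartInfty ∈ IsManifold.maximalAtlas 𝓘(ℂ) ω CP1 :=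
  IsManifold.subset_maximalAtlas (by right; rfl)

lemma chartZero_target : chartZero.target = Set.univ := by simp [chartZero]

lemma chartInfty_target : chartInfty.target = Set.univ := by
  simp [chartInfty, chartZero_target]

lemma holAt_coe_iff [CompleteSpace W] {z : ℂ} :
    HolAt f (z : CP1) ↔ AnalyticAt ℂ (fun w : ℂ => f w) z :=
  holAt_iff_of_chart (z := z) chartZero_mem (by simp [chartZero_target])

lemma holAt_infty_iff [CompleteSpace W] :
    HolAt f OnePoint.infty ↔ AnalyticAt ℂ (fun w : ℂ => f (cinv w)) 0 := by
  have := holAt_iff_of_chart (f := f) (z := 0) chartInfty_mem (by simp [chartInfty_target])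
  simpa [chartInfty_symm_apply] using this

lemma nhds_coe_eq (z : ℂ) : 𝓝 (z : CP1) = Filter.map ((↑) : ℂ → CP1) (𝓝 z) :=
  OnePoint.nhds_coe_eq z

/-- A holomorphic function either vanishes near a point or has no zeros in a punctured
neighbourhood. -/
lemma HolAt.eventually_eq_zero_or_ne_zero [CompleteSpace W] (hf : HolAt f p) :
    (∀ᶠ ζ in 𝓝 p, f ζ = 0) ∨ ∀ᶠ ζ in 𝓝[≠] p, f ζ ≠ 0 := by
  set e := chartAt ℂ p
  have hp : p ∈ e.source := mem_chart_source ℂ p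
  have he : e ∈ IsManifold.maximalAtlas 𝓘(ℂ) ω CP1 := IsManifold.chart_mem_maximalAtlas p
  have hf' : AnalyticAt ℂ (fun w => f (e.symm w)) (e p) := by
    rw [← holAt_iff_of_chart he (e.map_source hp), e.left_inv hp]; exact hf
  have hc : Filter.Tendsto e (𝓝 p) (𝓝 (e p)) := e.continuousAt hp
  have hs := e.open_source.mem_nhds hp
  rcases hf'.eventually_eq_zero_or_eventually_ne_zero with h | h
  · left
    filter_upwards [hc.eventually h, hs] with x hx hxs
    simpa [e.left_inv hxs] using hx
  · right
    rw [eventually_nhdsWithin_iff] at h ⊢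
    filter_upwards [hc.eventually h, hs] with x hx hxs hne
    have := hx (by
      intro h'
      exact hne (e.injOn hxs hp h'))
    simpa [e.left_inv hxs] using this

/-! ### Principal parts -/

/-- The function `1 / (ζ - p)ᵏ⁺¹` on `ℂP¹`, with value `0` at infinity, is holomorphic outside
`p`. -/
lemma exists_pole (p : ℂ) (k : ℕ) : ∃ q : CP1 → ℂ, (∀ z : ℂ, q z = ((z - p) ^ (k + 1))⁻¹) ∧
    ∀ ζ : CP1, ζ ≠ p → HolAt q ζ := by
  refine ⟨fun ζ => ζ.elim (0 : ℂ) (fun z : ℂ => ((z - p) ^ (k + 1))⁻¹), fun z => rfl, ?_⟩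
  intro ζ hζ
  induction ζ using OnePoint.rec with
  | infty =>
    rw [holAt_infty_iff]
    have h1 : AnalyticAt ℂ (fun w : ℂ => (w * (1 - p * w)⁻¹) ^ (k + 1)) 0 := by
      refine AnalyticAt.pow (AnalyticAt.mul analyticAt_id (AnalyticAt.inv (by fun_prop) (by simp))) _
    refine h1.congr ?_
    filter_upwards with w
    by_cases hw : w = 0
    · subst hw; simp
    · rw [cinv_coe_of_ne hw]
      simp only [OnePoint.elim_some]
      rw [← inv_pow]
      congr 1
      rw [← inv_inv w, ← mul_inv, inv_inv]
      congr 1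
      field_simp
  | coe z =>
    rw [holAt_coe_iff]
    have hz : z - p ≠ 0 := by
      intro h; exact hζ (by rw [sub_eq_zero.1 h])
    exact AnalyticAt.inv (by fun_prop) (pow_ne_zero _ hz)

/-- The principal part of `g / (z - p)ⁿ` at `p`, split off one term of the Taylor expansion of `g`
at a time. -/
lemma exists_principalPart_aux (p : ℂ) (n : ℕ) : ∀ g : ℂ → ℂ, AnalyticAt ℂ g p →
    ∃ q : CP1 → ℂ, (∀ ζ : CP1, ζ ≠ p → HolAt q ζ) ∧ ∃ r : ℂ → ℂ, AnalyticAt ℂ r p ∧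
      ∀ z ≠ p, g z / (z - p) ^ n = q z + r z := by
  induction n with
  | zero =>
    intro g hg
    exact ⟨fun _ => 0, fun _ _ => HolAt.const _, g, hg, fun z _ => by simp⟩
  | succ n ih =>
    intro g hg
    have h1 : AnalyticAt ℂ (dslope g p) p := by
      obtain ⟨P, hP⟩ := hg
      exact ⟨_, hP.has_fpower_series_dslope_fslope⟩
    obtain ⟨q, hq, r, hr, h⟩ := ih _ h1
    obtain ⟨q0, hq0, hq0'⟩ := exists_pole p n
    refine ⟨fun ζ => q ζ + g p • q0 ζ, fun ζ hζ => (hq ζ hζ).add ((HolAt.const _).smul (hq0' ζ hζ)),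
      r, hr, fun z hz => ?_⟩
    have hz' : z - p ≠ 0 := sub_ne_zero.2 hz
    have h2 : g z = g p + (z - p) * dslope g p z := by
      rw [dslope_of_ne _ hz, slope_def_field]
      field_simp
      ring
    have h3 := h z hz
    simp only [hq0]
    rw [add_right_comm, ← h3, smul_eq_mul, h2]
    field_simp
    ring

/-- A quotient of holomorphic functions differs near a finite point `p` by a holomorphic function
from a function which is holomorphic on `ℂP¹ ∖ {p}`. -/
lemma exists_principalPart {N δ : CP1 → ℂ} {p : ℂ} (hN : HolAt N p) (hδ : HolAt δ p)
    (h0 : ∀ᶠ ζ in 𝓝[≠] (p : CP1), δ ζ ≠ 0) :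
    ∃ q : CP1 → ℂ, (∀ ζ : CP1, ζ ≠ p → HolAt q ζ) ∧ ∃ r : CP1 → ℂ, HolAt r p ∧
      ∀ᶠ ζ in 𝓝[≠] (p : CP1), N ζ / δ ζ = q ζ + r ζ := by
  rw [holAt_coe_iff] at hN hδ
  have hne : ¬ ∀ᶠ z in 𝓝 p, δ (z : ℂ) = 0 := by
    intro h
    have h1 : ∀ᶠ ζ in 𝓝 (p : CP1), δ ζ = 0 := by rw [nhds_coe_eq]; exact h
    have := (h0.and (h1.filter_mono nhdsWithin_le_nhds)).exists
    obtain ⟨x, hx, hx'⟩ := this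
    exact hx hx'
  obtain ⟨n, g, hg, hg0, hgz⟩ := hδ.exists_eventuallyEq_pow_smul_nonzero_iff.2 hne
  obtain ⟨q, hq, r, hr, h⟩ := exists_principalPart_aux p n _ (hN.div hg hg0)
  refine ⟨q, hq, fun ζ => ζ.elim 0 r, ?_, ?_⟩
  · rw [holAt_coe_iff]; exact hr
  · rw [eventually_nhdsWithin_iff, nhds_coe_eq, Filter.eventually_map]
    filter_upwards [hgz] with z hz hzp
    have := h z (by rintro rfl; exact hzp rfl)
    rw [OnePoint.elim_some, ← this, hz, Pi.div_apply, smul_eq_mul, div_div, mul_comm]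

end HolAt

/-! ### Cramer's rule with holomorphic coefficients -/

section Cramer

variable {V : Type*} [NormedAddCommGroup V] [NormedSpace ℂ V]
  {ι : Type*} [Fintype ι] {p : CP1}

lemma mulVec_coeff (l : V →L[ℂ] (ι → ℂ)) (v : ι → V) (x : ι → ℂ) :
    (Matrix.of fun i j => l (v j) i).mulVec x = l (∑ j, x j • v j) := by
  ext i
  simp [Matrix.mulVec, dotProduct, mul_comm]

lemma eventually_linearIndependent {v : ι → CP1 → V} (hv : ∀ i, HolAt (v i) p)
    (hli : LinearIndependent ℂ fun i => v i p) :
    ∀ᶠ ζ in 𝓝 p, LinearIndependent ℂ fun i => v i ζ := by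
  have hc : ContinuousAt (fun ζ => fun i => v i ζ) p :=
    continuousAt_pi.2 fun i => (hv i).continuousAt
  exact hc.eventually (hli.eventually (𝕜 := ℂ))

/-- Linearly independent vectors are mapped to the standard basis by some linear map. -/
lemma exists_coordinates [FiniteDimensional ℂ V] {v : ι → V} (hv : LinearIndependent ℂ v) :
    ∃ l : V →L[ℂ] (ι → ℂ), ∀ x : ι → ℂ, l (∑ i, x i • v i) = x := by
  obtain ⟨g, hg⟩ := LinearMap.exists_leftInverse_of_injective (Fintype.linearCombination ℂ v)
    (by
      rw [LinearMap.ker_eq_bot]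
      exact linearIndependent_iff_injective_fintypeLinearCombination.1 hv)
  refine ⟨LinearMap.toContinuousLinearMap g, fun x => ?_⟩
  have := LinearMap.congr_fun hg x
  simpa [Fintype.linearCombination_apply] using this

variable [DecidableEq ι]

/-- The determinant of the restriction of `l` to the span of the vectors `v`. -/
def coeffDet (l : V →L[ℂ] (ι → ℂ)) (v : ι → V) : ℂ := (Matrix.of fun i j => l (v j) i).det

/-- The numerators in Cramer's rule for the combination of the vectors `v` which `l` maps to `b`. -/
def coeffNum (l : V →L[ℂ] (ι → ℂ)) (v : ι → V) (b : ι → ℂ) : ι → ℂ :=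
  (Matrix.of fun i j => l (v j) i).cramer b

lemma coeffNum_eq (l : V →L[ℂ] (ι → ℂ)) (v : ι → V) {b x : ι → ℂ}
    (h : b = l (∑ j, x j • v j)) : coeffNum l v b = coeffDet l v • x := by
  rw [coeffNum, h, ← mulVec_coeff, Matrix.cramer_eq_adjugate_mulVec, Matrix.mulVec_mulVec,
    Matrix.adjugate_mul, Matrix.smul_mulVec, Matrix.one_mulVec, coeffDet]

lemma coeffDet_ne_zero_iff (l : V →L[ℂ] (ι → ℂ)) (v : ι → V) :
    coeffDet l v ≠ 0 ↔ ∀ x : ι → ℂ, l (∑ j, x j • v j) = 0 → x = 0 := by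
  rw [coeffDet, Ne, ← Matrix.exists_mulVec_eq_zero_iff]
  simp only [mulVec_coeff]
  push Not
  exact ⟨fun h x hx => by_contra fun h0 => h x h0 hx, fun h x h0 hx => h0 (h x hx)⟩

/-- Cramer's rule. -/
lemma map_sum_coeffNum (l : V →L[ℂ] (ι → ℂ)) (v : ι → V) (b : ι → ℂ) (h0 : coeffDet l v ≠ 0) :
    l (∑ j, (coeffNum l v b j / coeffDet l v) • v j) = b := by
  have h := Matrix.mulVec_cramer (Matrix.of fun i j => l (v j) i) b
  have h1 : (∑ j, (coeffNum l v b j / coeffDet l v) • v j) =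
      (coeffDet l v)⁻¹ • ∑ j, coeffNum l v b j • v j := by
    rw [Finset.smul_sum]
    refine Finset.sum_congr rfl fun j _ => ?_
    rw [smul_smul, div_eq_inv_mul]
  rw [h1, map_smul, ← mulVec_coeff, coeffNum, h, smul_smul]
  rw [coeffDet] at h0 ⊢
  rw [inv_mul_cancel₀ h0, one_smul]

lemma HolAt.det {M : CP1 → Matrix ι ι ℂ} (h : ∀ i j, HolAt (fun ζ => M ζ i j) p) :
    HolAt (fun ζ => (M ζ).det) p := by
  simp only [Matrix.det_apply]
  refine HolAt.sum fun σ _ => ?_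
  have : HolAt (fun ζ => ∏ i, M ζ (σ i) i) p := HolAt.prod fun i _ => h _ _
  simp only [Units.smul_def, zsmul_eq_mul]
  exact (HolAt.const _).mul this

lemma HolAt.coeffDet {l : CP1 → V →L[ℂ] (ι → ℂ)} (hl : HolAt l p) {v : ι → CP1 → V}
    (hv : ∀ i, HolAt (v i) p) : HolAt (fun ζ => coeffDet (l ζ) (fun i => v i ζ)) p :=
  HolAt.det fun i j => holAt_pi.1 (hl.clm_apply (hv j)) i

lemma HolAt.coeffNum {l : CP1 → V →L[ℂ] (ι → ℂ)} (hl : HolAt l p) {v : ι → CP1 → V}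
    (hv : ∀ i, HolAt (v i) p) {b : CP1 → ι → ℂ} (hb : HolAt b p) (k : ι) :
    HolAt (fun ζ => coeffNum (l ζ) (fun i => v i ζ) (b ζ) k) p := by
  simp only [TwistorQuotient.coeffNum, Matrix.cramer_apply]
  refine HolAt.det fun i j => ?_
  by_cases hj : j = k
  · subst hj
    simpa using holAt_pi.1 hb i
  · simpa [Matrix.updateCol_ne hj] using holAt_pi.1 (hl.clm_apply (hv j)) i

/-- The coefficients of a holomorphic section with respect to a holomorphic frame are
holomorphic. -/
lemma exists_holAt_coeff [FiniteDimensional ℂ V] {v : ι → CP1 → V} (hv : ∀ i, HolAt (v i) p)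
    (hli : LinearIndependent ℂ fun i => v i p) {b : CP1 → V} (hb : HolAt b p) :
    ∃ c : ι → CP1 → ℂ, (∀ i, HolAt (c i) p) ∧
      ∀ᶠ ζ in 𝓝 p, ∀ x : ι → ℂ, b ζ = ∑ i, x i • v i ζ → ∀ i, x i = c i ζ := by
  obtain ⟨l, hl⟩ := exists_coordinates hli
  have h0 : coeffDet l (fun i => v i p) ≠ 0 := by
    rw [coeffDet_ne_zero_iff]
    intro x hx
    rw [← hx, hl]
  have hd := HolAt.coeffDet (HolAt.const l) hv
  refine ⟨fun i ζ => coeffNum l (fun i => v i ζ) (l (b ζ)) i / coeffDet l (fun i => v i ζ),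
    fun i => (HolAt.coeffNum (HolAt.const l) hv (hb.clm l) i).div hd h0, ?_⟩
  filter_upwards [hd.continuousAt.eventually_ne h0] with ζ hζ x hx i
  rw [coeffNum_eq l _ (by rw [hx]), Pi.smul_apply, smul_eq_mul, mul_div_cancel_left₀ _ hζ]

end Cramer

/-! ### Subbundles of a trivial bundle and frames of their quotients -/

section Subbundle

variable {V : Type*} [NormedAddCommGroup V] [NormedSpace ℂ V]

/-- A family of subspaces of `V` is a holomorphic subbundle of the trivial bundle over `ℂP¹`:
it has local holomorphic frames. -/
def IsSubbundle (A : CP1 → Submodule ℂ V) : Prop :=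
  ∀ p, ∃ (k : ℕ) (v : Fin k → CP1 → V), (∀ j, HolAt (v j) p) ∧
    LinearIndependent ℂ (fun j => v j p) ∧
    ∀ᶠ ζ in 𝓝 p, Submodule.span ℂ (Set.range fun j => v j ζ) = A ζ

/-- A section of `A / B`, represented by the (not necessarily continuous) function `e` with
values in `A`, is holomorphic: it lifts locally to holomorphic sections of `A`. -/
def IsHolSection (A B : CP1 → Submodule ℂ V) (e : CP1 → V) : Prop :=
  ∀ p, ∃ e' : CP1 → V, HolAt e' p ∧ ∀ᶠ ζ in 𝓝 p, e' ζ ∈ A ζ ∧ e' ζ - e ζ ∈ B ζ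

/-- The functions `e i` represent a global holomorphic frame of `A / B`. -/
structure IsQuotFrame {ι : Type*} [Fintype ι] (A B : CP1 → Submodule ℂ V) (e : ι → CP1 → V) :
    Prop where
  holomorphic : ∀ i, IsHolSection A B (e i)
  mem : ∀ i ζ, e i ζ ∈ A ζ
  indep : ∀ ζ (x : ι → ℂ), ∑ i, x i • e i ζ ∈ B ζ → x = 0
  span : ∀ ζ, ∀ v ∈ A ζ, ∃ x : ι → ℂ, v - ∑ i, x i • e i ζ ∈ B ζ

/-- The rank of a subbundle is constant. -/
lemma IsSubbundle.exists_frame {A : CP1 → Submodule ℂ V} (hA : IsSubbundle A) :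
    ∃ k : ℕ, ∀ p, ∃ v : Fin k → CP1 → V, (∀ j, HolAt (v j) p) ∧
      ∀ᶠ ζ in 𝓝 p, LinearIndependent ℂ (fun j => v j ζ) ∧
        Submodule.span ℂ (Set.range fun j => v j ζ) = A ζ := by
  have hloc : IsLocallyConstant fun ζ => Module.finrank ℂ (A ζ) := by
    rw [IsLocallyConstant.iff_eventually_eq]
    intro p
    obtain ⟨k, v, hv, hli, hs⟩ := hA p
    have h1 : ∀ᶠ ζ in 𝓝 p, Module.finrank ℂ (A ζ) = k := by
      filter_upwards [hs, eventually_linearIndependent hv hli] with ζ h1 h2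
      rw [← h1, finrank_span_eq_card h2, Fintype.card_fin]
    filter_upwards [h1] with ζ hζ
    rw [hζ, h1.self_of_nhds]
  refine ⟨Module.finrank ℂ (A OnePoint.infty), fun p => ?_⟩
  obtain ⟨k, v, hv, hli, hs⟩ := hA p
  have hk : k = Module.finrank ℂ (A OnePoint.infty) := by
    rw [hloc.apply_eq_of_preconnectedSpace OnePoint.infty p, ← hs.self_of_nhds,
      finrank_span_eq_card hli, Fintype.card_fin]
  subst hk
  exact ⟨v, hv, (eventually_linearIndependent hv hli).and hs⟩

variable {ι : Type*} [Fintype ι] {A B : CP1 → Submodule ℂ V}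

/-- A frame of `A / B` and a local frame of `B` give a local frame of `A`. -/
lemma IsQuotFrame.exists_adapted_frame {e : ι → CP1 → V} (he : IsQuotFrame A B e)
    (hB : IsSubbundle B) (p : CP1) :
    ∃ (k : ℕ) (u : ι ⊕ Fin k → CP1 → V), (∀ i, HolAt (u i) p) ∧
      LinearIndependent ℂ (fun i => u i p) ∧ ∀ᶠ ζ in 𝓝 p,
        (∀ i, u (Sum.inl i) ζ ∈ A ζ ∧ u (Sum.inl i) ζ - e i ζ ∈ B ζ) ∧
        Submodule.span ℂ (Set.range fun j => u (Sum.inr j) ζ) = B ζ := by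
  obtain ⟨k, v, hv, hli, hs⟩ := hB p
  choose e' he' hee' using fun i => he.holomorphic i p
  rw [← Filter.eventually_all] at hee'
  refine ⟨k, Sum.elim e' v, ?_, ?_, hee'.and hs⟩
  · rintro (i | j)
    · exact he' i
    · exact hv j
  rw [Fintype.linearIndependent_iff]
  intro g hg
  rw [Fintype.sum_sum_type] at hg
  simp only [Sum.elim_inl, Sum.elim_inr] at hg
  have h1 : ∑ j, g (Sum.inr j) • v j p ∈ B p := by
    rw [← hs.self_of_nhds]
    exact Submodule.sum_mem _ fun j _ => Submodule.smul_mem _ _ (Submodule.subset_span ⟨j, rfl⟩)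
  have h2 : ∑ i, g (Sum.inl i) • e i p ∈ B p := by
    have h3 : ∑ i, g (Sum.inl i) • (e' i p - e i p) ∈ B p :=
      Submodule.sum_mem _ fun i _ => Submodule.smul_mem _ _ (hee'.self_of_nhds i).2
    have h4 := Submodule.neg_mem _ (Submodule.add_mem _ h3 h1)
    simp_rw [smul_sub, Finset.sum_sub_distrib] at h4
    convert h4 using 1
    rw [eq_neg_of_add_eq_zero_left hg]
    abel
  have h5 : ∀ i, g (Sum.inl i) = 0 := fun i => congrFun (he.indep p _ h2) i
  rintro (i | j)
  · exact h5 i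
  · exact Fintype.linearIndependent_iff.1 hli _ (by simpa [h5] using hg) j

/-- The coefficients of a holomorphic section of `A` with respect to a frame of `A / B` are
holomorphic. -/
lemma IsQuotFrame.exists_holAt_coeff [FiniteDimensional ℂ V] {e : ι → CP1 → V}
    (he : IsQuotFrame A B e) (hB : IsSubbundle B) {p : CP1} {b : CP1 → V} (hb : HolAt b p)
    (hbA : ∀ᶠ ζ in 𝓝 p, b ζ ∈ A ζ) :
    ∃ c : ι → CP1 → ℂ, (∀ i, HolAt (c i) p) ∧ ∀ᶠ ζ in 𝓝 p, b ζ - ∑ i, c i ζ • e i ζ ∈ B ζ := by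
  classical
  obtain ⟨k, u, hu, huli, hue⟩ := he.exists_adapted_frame hB p
  obtain ⟨c, hc, hcc⟩ := TwistorQuotient.exists_holAt_coeff hu huli hb
  refine ⟨fun i => c (Sum.inl i), fun i => hc _, ?_⟩
  filter_upwards [hcc, hue, hbA] with ζ h1 h2 h4
  obtain ⟨x, hx⟩ := he.span ζ _ h4
  have h5 : b ζ - ∑ i, x i • u (Sum.inl i) ζ ∈ B ζ := by
    have h3 : ∑ i, x i • (u (Sum.inl i) ζ - e i ζ) ∈ B ζ :=
      Submodule.sum_mem _ fun i _ => Submodule.smul_mem _ _ (h2.1 i).2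
    simp_rw [smul_sub, Finset.sum_sub_distrib] at h3
    simpa using Submodule.sub_mem _ hx h3
  rw [← h2.2, Submodule.mem_span_range_iff_exists_fun] at h5
  obtain ⟨y, hy⟩ := h5
  have h6 := h1 (Sum.elim x y) (by simp [Fintype.sum_sum_type, hy])
  have h7 : ∀ i, c (Sum.inl i) ζ = x i := fun i => (h6 (Sum.inl i)).symm
  simpa [h7] using hx

end Subbundle

/-! ### Splitting of extensions by trivial bundles -/

section Extension

variable {V : Type*} [NormedAddCommGroup V] [NormedSpace ℂ V] [FiniteDimensional ℂ V]
  {ι κ : Type*} [Fintype ι] [Fintype κ] {A B C : CP1 → Submodule ℂ V}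

/-- A family of subsets of `ℂP¹` which is locally the zero set of a holomorphic function, and is not
everything, is finite. -/
lemma finite_of_locally_zero_set {bad : CP1 → Prop}
    (h : ∀ p, ∃ δ : CP1 → ℂ, HolAt δ p ∧ ∀ᶠ ζ in 𝓝 p, (bad ζ ↔ δ ζ = 0)) {p₀ : CP1}
    (h0 : ¬ bad p₀) : {ζ | bad ζ}.Finite ∧ ∀ p, ∀ᶠ ζ in 𝓝[≠] p, ¬ bad ζ := by
  have hdich : ∀ p, (∀ᶠ ζ in 𝓝 p, bad ζ) ∨ ∀ᶠ ζ in 𝓝[≠] p, ¬ bad ζ := by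
    intro p
    obtain ⟨δ, hδ, hbad⟩ := h p
    rcases hδ.eventually_eq_zero_or_ne_zero with h1 | h1
    · left
      filter_upwards [h1, hbad] with ζ h2 h3 using h3.2 h2
    · right
      filter_upwards [h1, hbad.filter_mono nhdsWithin_le_nhds] with ζ h2 h3 h4 using h2 (h3.1 h4)
  have hnot : ∀ p, ∀ᶠ ζ in 𝓝[≠] p, ¬ bad ζ := by
    have hopen : IsOpen {p | ∀ᶠ ζ in 𝓝 p, bad ζ} := isOpen_setOfPred_eventually_nhds
    have hclosed : IsClosed {p | ∀ᶠ ζ in 𝓝 p, bad ζ} := by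
      rw [← isOpen_compl_iff, isOpen_iff_mem_nhds]
      intro p hp
      have h1 := (hdich p).resolve_left hp
      have h2 := eventually_eventually_nhdsWithin.2 h1
      rw [eventually_nhdsWithin_iff] at h1
      filter_upwards [h1.eventually_nhds] with ζ hζ hbad
      by_cases hp' : ζ = p
      · exact hp (hp' ▸ hbad)
      · have h3 := hζ.self_of_nhds hp'
        exact h3 hbad.self_of_nhds
    rcases isClopen_iff.1 ⟨hclosed, hopen⟩ with h1 | h1
    · intro p
      refine (hdich p).resolve_left fun h2 => ?_
      have : p ∈ {p | ∀ᶠ ζ in 𝓝 p, bad ζ} := h2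
      rw [h1] at this
      exact this
    · have : p₀ ∈ {p | ∀ᶠ ζ in 𝓝 p, bad ζ} := h1 ▸ Set.mem_univ _
      exact absurd (Filter.Eventually.self_of_nhds this) h0
  refine ⟨?_, hnot⟩
  obtain ⟨t, -, ht⟩ := isCompact_univ.elim_nhds_subcover
    (fun p => {ζ | ζ ∈ ({p}ᶜ : Set CP1) → ¬ bad ζ})
    fun p _ => eventually_nhdsWithin_iff.1 (hnot p)
  refine t.finite_toSet.subset fun ζ hζ => ?_
  obtain ⟨p, hp, hζp⟩ := Set.mem_iUnion₂.1 (ht (Set.mem_univ ζ))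
  have : ζ = p := by_contra fun hne => hζp hne hζ
  exact this ▸ hp

/-- If `B / C` is trivial, then every holomorphic section of `A / B` lifts to a holomorphic section
of `A / C`.  A lift to `A` with finitely many poles is obtained by cutting down by a linear map
which is injective on a fibre of `B`; its poles are removed modulo `C` by subtracting principal
parts, which exist globally on `ℂP¹`. -/
theorem IsHolSection.exists_lift (hBA : ∀ ζ, B ζ ≤ A ζ) (hB : IsSubbundle B) (hC : IsSubbundle C)
    {f : κ → CP1 → V} (hf : IsQuotFrame B C f) {e : CP1 → V} (he : IsHolSection A B e) :
    ∃ e₁ : CP1 → V, (∀ ζ, e₁ ζ - e ζ ∈ B ζ) ∧ IsHolSection A C e₁ := by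
  classical
  obtain ⟨k, hframe⟩ := hB.exists_frame
  choose v hv hvB using hframe
  choose e' he' hee' using he
  choose f' hf' hff' using fun p i => hf.holomorphic i p
  have hff'' := fun p => Filter.eventually_all.2 (hff' p)
  obtain ⟨l, hl⟩ := exists_coordinates (hvB OnePoint.infty).self_of_nhds.1
  have hspan : ∀ ζ p, Submodule.span ℂ (Set.range fun j => v p j ζ) = B ζ → ∀ w : V,
      w ∈ B ζ ↔ ∃ y : Fin k → ℂ, ∑ j, y j • v p j ζ = w := by
    intro ζ p h w
    rw [← h, Submodule.mem_span_range_iff_exists_fun]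
  -- the points where `l`, which is injective on the fibre of `B` at infinity, fails to be injective
  let bad : CP1 → Prop := fun ζ => ∃ b ∈ B ζ, b ≠ 0 ∧ l b = 0
  let δ : CP1 → CP1 → ℂ := fun p ζ => coeffDet l (fun j => v p j ζ)
  let N : CP1 → Fin k → CP1 → ℂ := fun p j ζ => coeffNum l (fun j => v p j ζ) (l (e' p ζ)) j
  have hδ : ∀ p, HolAt (δ p) p := fun p => HolAt.coeffDet (HolAt.const l) (hv p)
  have hN : ∀ p j, HolAt (N p j) p := fun p j =>
    HolAt.coeffNum (HolAt.const l) (hv p) ((he' p).clm l) j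
  have hbad : ∀ p, ∀ᶠ ζ in 𝓝 p, (bad ζ ↔ δ p ζ = 0) := by
    intro p
    filter_upwards [hvB p] with ζ hζ
    rw [← not_iff_not, ← Ne, coeffDet_ne_zero_iff]
    constructor
    · intro h x hx
      by_contra hx0
      refine h ⟨_, (hspan ζ p hζ.2 _).2 ⟨x, rfl⟩, ?_, hx⟩
      intro h0
      exact hx0 (funext fun j => Fintype.linearIndependent_iff.1 hζ.1 x h0 j)
    · rintro h ⟨b, hb, hb0, hlb⟩
      obtain ⟨y, rfl⟩ := (hspan ζ p hζ.2 _).1 hb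
      exact hb0 (by simp [h y hlb])
  have hinfty : ¬ bad OnePoint.infty := by
    rintro ⟨b, hb, hb0, hlb⟩
    obtain ⟨y, rfl⟩ := (hspan _ OnePoint.infty (hvB _).self_of_nhds.2 _).1 hb
    rw [hl] at hlb
    exact hb0 (by simp [hlb])
  obtain ⟨hfin, hpunct⟩ := finite_of_locally_zero_set (fun p => ⟨δ p, hδ p, hbad p⟩) hinfty
  -- the meromorphic lift `u`: the representative of `e` modulo `B` in the kernel of `l`
  have hex : ∀ ζ, ∃ u, ¬ bad ζ → u - e ζ ∈ B ζ ∧ l u = 0 := by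
    intro ζ
    by_cases hζ : bad ζ
    · exact ⟨0, fun h => absurd hζ h⟩
    · have h0 : δ ζ ζ ≠ 0 := fun h => hζ ((hbad ζ).self_of_nhds.2 h)
      refine ⟨e ζ - ∑ j, (coeffNum l (fun j => v ζ j ζ) (l (e ζ)) j / δ ζ ζ) • v ζ j ζ, fun _ => ⟨?_, ?_⟩⟩
      · rw [sub_sub_cancel_left]
        exact Submodule.neg_mem _ ((hspan ζ ζ (hvB ζ).self_of_nhds.2 _).2 ⟨_, rfl⟩)
      · rw [map_sub, map_sum_coeffNum l _ _ h0, sub_self]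
  choose u hu using hex
  have hu_eq : ∀ p, ∀ᶠ ζ in 𝓝 p, ¬ bad ζ →
      u ζ = e' p ζ - ∑ j, (N p j ζ / δ p ζ) • v p j ζ := by
    intro p
    filter_upwards [hbad p, hvB p, hee' p] with ζ h1 h2 h3 h4
    have h0 : δ p ζ ≠ 0 := fun h => h4 (h1.2 h)
    by_contra hne
    refine h4 ⟨u ζ - (e' p ζ - ∑ j, (N p j ζ / δ p ζ) • v p j ζ), ?_, sub_ne_zero.2 hne, ?_⟩
    · have h5 := Submodule.sub_mem _ (hu ζ h4).1 h3.2
      have h6 : ∑ j, (N p j ζ / δ p ζ) • v p j ζ ∈ B ζ := (hspan ζ p h2.2 _).2 ⟨_, rfl⟩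
      have h7 := Submodule.add_mem _ h5 h6
      convert h7 using 1
      abel
    · rw [map_sub, map_sub, map_sum_coeffNum l _ _ h0, (hu ζ h4).2]
      simp
  -- near a bad point `p`, up to the sign, `q p` and `r p` are the principal and the regular part of
  -- the coefficients of `u - e' p` in the frame `f` of `B / C`; bad points lie in `ℂ`, since `l` is
  -- injective on the fibre at infinity
  have hpol : ∀ p, ∃ q r : κ → CP1 → ℂ, bad p → (∀ i, ∀ ζ, ζ ≠ p → HolAt (q i) ζ) ∧
      (∀ i, HolAt (r i) p) ∧
      ∀ᶠ ζ in 𝓝[≠] p, u ζ - e' p ζ + ∑ i, (q i ζ + r i ζ) • f i ζ ∈ C ζ := by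
    intro p
    by_cases hp : bad p
    swap
    · exact ⟨0, 0, fun h => absurd h hp⟩
    have hβ := fun j => hf.exists_holAt_coeff hC (hv p j) (p := p) (by
      filter_upwards [hvB p] with ζ hζ
      rw [← hζ.2]
      exact Submodule.subset_span ⟨j, rfl⟩)
    choose β hβ hβC using hβ
    have hδ0 : ∀ᶠ ζ in 𝓝[≠] p, δ p ζ ≠ 0 := by
      filter_upwards [hpunct p, (hbad p).filter_mono nhdsWithin_le_nhds] with ζ h1 h2 h3
      exact h1 (h2.2 h3)
    have hpp : ∀ i : κ, ∃ q : CP1 → ℂ, (∀ ζ : CP1, ζ ≠ p → HolAt q ζ) ∧ ∃ r : CP1 → ℂ, HolAt r p ∧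
        ∀ᶠ ζ in 𝓝[≠] p, (∑ j, N p j ζ * β j i ζ) / δ p ζ = q ζ + r ζ := by
      intro i
      have h1 : HolAt (fun ζ => ∑ j, N p j ζ * β j i ζ) p :=
        HolAt.sum fun j _ => (hN p j).mul (hβ j i)
      have h2 := hδ p
      induction p using OnePoint.rec with
      | infty => exact absurd hp hinfty
      | coe z => exact exists_principalPart h1 h2 hδ0
    choose q hq r hr hqr using hpp
    refine ⟨q, r, fun _ => ⟨hq, hr, ?_⟩⟩
    filter_upwards [Filter.eventually_all.2 hqr, hpunct p,
      (hu_eq p).filter_mono nhdsWithin_le_nhds,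
      (Filter.eventually_all.2 hβC).filter_mono nhdsWithin_le_nhds] with ζ h1 h2 h3 h4
    have h5 : u ζ - e' p ζ + ∑ i, (q i ζ + r i ζ) • f i ζ =
        -∑ j, (N p j ζ / δ p ζ) • (v p j ζ - ∑ i, β j i ζ • f i ζ) := by
      have h6 : ∑ i, (q i ζ + r i ζ) • f i ζ =
          ∑ j, (N p j ζ / δ p ζ) • ∑ i, β j i ζ • f i ζ := by
        simp_rw [← h1, Finset.smul_sum, Finset.sum_div, Finset.sum_smul]
        rw [Finset.sum_comm]
        refine Finset.sum_congr rfl fun j _ => Finset.sum_congr rfl fun i _ => ?_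
        rw [smul_smul]
        congr 1
        ring
      rw [h3 h2, h6]
      simp_rw [smul_sub, Finset.sum_sub_distrib]
      abel
    rw [h5]
    exact Submodule.neg_mem _ (Submodule.sum_mem _ fun j _ => Submodule.smul_mem _ _ (h4 j))
  choose q r hqr using hpol
  let S : Finset CP1 := hfin.toFinset
  have hS : ∀ ζ, ζ ∈ S ↔ bad ζ := fun ζ => by simp [S]
  -- adding the combination of the `f i` with coefficients `Q i` to `u` removes all the poles modulo
  -- `C`; near a bad point `p`, the result is `e' p` plus the combination with holomorphic coefficients
  -- `R p i`
  let Q : κ → CP1 → ℂ := fun i ζ => ∑ p ∈ S, q p i ζ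
  let R : CP1 → κ → CP1 → ℂ := fun p i ζ => ∑ p' ∈ S.erase p, q p' i ζ - r p i ζ
  have hQ : ∀ i p, p ∉ S → HolAt (Q i) p := fun i p hp => HolAt.sum fun p' hp' =>
    (hqr p' ((hS p').1 hp')).1 i p (fun h => hp (h ▸ hp'))
  have hR : ∀ i p, p ∈ S → HolAt (R p i) p := fun i p hp =>
    (HolAt.sum fun p' hp' => (hqr p' ((hS p').1 (Finset.mem_of_mem_erase hp'))).1 i p
      (Finset.ne_of_mem_erase hp').symm).sub ((hqr p ((hS p).1 hp)).2.1 i)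
  have hQR : ∀ i p ζ, p ∈ S → Q i ζ = R p i ζ + (q p i ζ + r p i ζ) := by
    intro i p ζ hp
    simp only [Q, R]
    rw [← Finset.sum_erase_add S _ hp]
    ring
  have hdiff : ∀ p ζ (x : κ → ℂ), (∀ i, f' p i ζ ∈ B ζ ∧ f' p i ζ - f i ζ ∈ C ζ) →
      ∑ i, x i • f' p i ζ - ∑ i, x i • f i ζ ∈ C ζ := by
    intro p ζ x h
    rw [← Finset.sum_sub_distrib]
    refine Submodule.sum_mem _ fun i _ => ?_
    rw [← smul_sub]
    exact Submodule.smul_mem _ _ (h i).2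
  refine ⟨fun ζ => if ζ ∈ S then e' ζ ζ + ∑ i, R ζ i ζ • f i ζ else u ζ + ∑ i, Q i ζ • f i ζ,
    fun ζ => ?_, fun p => ?_⟩
  · have hfB : ∀ x : κ → ℂ, ∑ i, x i • f i ζ ∈ B ζ := fun x =>
      Submodule.sum_mem _ fun i _ => Submodule.smul_mem _ _ (hf.mem i ζ)
    by_cases hζ : ζ ∈ S
    · simp only [hζ, if_true]
      rw [add_sub_right_comm]
      exact Submodule.add_mem _ (hee' ζ).self_of_nhds.2 (hfB _)
    · simp only [hζ, if_false]
      rw [add_sub_right_comm]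
      exact Submodule.add_mem _ (hu ζ fun h => hζ ((hS ζ).2 h)).1 (hfB _)
  by_cases hp : p ∈ S
  · refine ⟨fun ζ => e' p ζ + ∑ i, R p i ζ • f' p i ζ,
      (he' p).add (HolAt.sum fun i _ => (hR i p hp).smul (hf' p i)), ?_⟩
    have h1 := (hqr p ((hS p).1 hp)).2.2
    have h2 := hpunct p
    rw [eventually_nhdsWithin_iff] at h1 h2
    filter_upwards [h1, h2, hee' p, hff'' p] with ζ h1 h2 h3 h4
    refine ⟨Submodule.add_mem _ h3.1 (Submodule.sum_mem _ fun i _ =>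
      Submodule.smul_mem _ _ (hBA ζ (h4 i).1)), ?_⟩
    by_cases hζ : ζ = p
    · subst hζ
      simp only [hp, if_true]
      rw [add_sub_add_left_eq_sub]
      exact hdiff ζ ζ _ h4
    · have hζS : ζ ∉ S := fun h => h2 hζ ((hS ζ).1 h)
      simp only [hζS, if_false]
      have h5 : e' p ζ + ∑ i, R p i ζ • f' p i ζ - (u ζ + ∑ i, Q i ζ • f i ζ) =
          (∑ i, R p i ζ • f' p i ζ - ∑ i, R p i ζ • f i ζ) -
          (u ζ - e' p ζ + ∑ i, (q p i ζ + r p i ζ) • f i ζ) := by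
        simp_rw [fun i => hQR i p ζ hp, fun i => add_smul (R p i ζ) (q p i ζ + r p i ζ) (f i ζ),
          Finset.sum_add_distrib]
        abel
      rw [h5]
      exact Submodule.sub_mem _ (hdiff p ζ _ h4) (h1 hζ)
  · have hgood : ∀ᶠ ζ in 𝓝 p, ¬ bad ζ := by
      have h2 := hpunct p
      rw [eventually_nhdsWithin_iff] at h2
      filter_upwards [h2] with ζ h
      by_cases hζ : ζ = p
      · subst hζ; exact fun h => hp ((hS _).2 h)
      · exact h hζ
    have hδp : δ p p ≠ 0 := fun h => hp ((hS _).2 ((hbad p).self_of_nhds.2 h))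
    have huhol : HolAt u p := by
      refine HolAt.congr ((he' p).sub (HolAt.sum fun j (_ : j ∈ Finset.univ) =>
        ((hN p j).div (hδ p) hδp).smul (hv p j))) ?_
      filter_upwards [hgood, hu_eq p] with ζ h1 h2 using h2 h1
    refine ⟨fun ζ => u ζ + ∑ i, Q i ζ • f' p i ζ,
      huhol.add (HolAt.sum fun i _ => (hQ i p hp).smul (hf' p i)), ?_⟩
    filter_upwards [hgood, hee' p, hff'' p] with ζ h1 h3 h4
    have hζS : ζ ∉ S := fun h => h1 ((hS ζ).1 h)
    simp only [hζS, if_false]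
    constructor
    · refine Submodule.add_mem _ ?_ (Submodule.sum_mem _ fun i _ =>
        Submodule.smul_mem _ _ (hBA ζ (h4 i).1))
      have h5 := Submodule.add_mem _ h3.1 (hBA ζ (Submodule.sub_mem _ (hu ζ h1).1 h3.2))
      convert h5 using 1
      abel
    · rw [add_sub_add_left_eq_sub]
      exact hdiff p ζ _ h4

/-- An extension of trivial bundles is trivial. -/
theorem IsQuotFrame.exists_extend (hBA : ∀ ζ, B ζ ≤ A ζ) (hCB : ∀ ζ, C ζ ≤ B ζ)
    (hB : IsSubbundle B) (hC : IsSubbundle C)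
    {e : ι → CP1 → V} (he : IsQuotFrame A B e) {f : κ → CP1 → V} (hf : IsQuotFrame B C f) :
    ∃ g : ι ⊕ κ → CP1 → V, IsQuotFrame A C g := by
  choose e₁ he₁ hhol using fun i => (he.holomorphic i).exists_lift hBA hB hC hf
  have hdiff : ∀ ζ (x : ι → ℂ), ∑ i, x i • e₁ i ζ - ∑ i, x i • e i ζ ∈ B ζ := by
    intro ζ x
    rw [← Finset.sum_sub_distrib]
    refine Submodule.sum_mem _ fun i _ => ?_
    rw [← smul_sub]
    exact Submodule.smul_mem _ _ (he₁ i ζ)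
  have hfB : ∀ ζ (x : κ → ℂ), ∑ i, x i • f i ζ ∈ B ζ := fun ζ x =>
    Submodule.sum_mem _ fun i _ => Submodule.smul_mem _ _ (hf.mem i ζ)
  refine ⟨Sum.elim e₁ f, ?_, ?_, ?_, ?_⟩
  · rintro (i | j)
    · exact hhol i
    · intro p
      obtain ⟨f', hf', h⟩ := hf.holomorphic j p
      refine ⟨f', hf', ?_⟩
      filter_upwards [h] with ζ hζ using ⟨hBA ζ hζ.1, hζ.2⟩
  · rintro (i | j) ζ
    · have := Submodule.add_mem _ (hBA ζ (he₁ i ζ)) (he.mem i ζ)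
      simpa using this
    · exact hBA ζ (hf.mem j ζ)
  · intro ζ x hx
    rw [Fintype.sum_sum_type] at hx
    simp only [Sum.elim_inl, Sum.elim_inr] at hx
    have h1 : ∑ i, x (Sum.inl i) • e i ζ ∈ B ζ := by
      have h2 := Submodule.sub_mem _ (hCB ζ hx) (hfB ζ fun j => x (Sum.inr j))
      have h3 := Submodule.sub_mem _ h2 (hdiff ζ fun i => x (Sum.inl i))
      simpa using h3
    have h2 : ∀ i, x (Sum.inl i) = 0 := congrFun (he.indep ζ _ h1)
    have h3 : ∀ j, x (Sum.inr j) = 0 := congrFun (hf.indep ζ _ (by simpa [h2] using hx))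
    ext (i | j)
    · exact h2 i
    · exact h3 j
  · intro ζ w hw
    obtain ⟨x, hx⟩ := he.span ζ w hw
    obtain ⟨y, hy⟩ := hf.span ζ _ (Submodule.sub_mem _ hx (hdiff ζ x))
    refine ⟨Sum.elim x y, ?_⟩
    rw [Fintype.sum_sum_type]
    simp only [Sum.elim_inl, Sum.elim_inr]
    convert hy using 1
    abel

end Extension

/-! ### Orthogonal subbundles and symplectic reduction -/

section Symplectic

variable {V : Type*} [NormedAddCommGroup V] [NormedSpace ℂ V]
  {ι κ : Type*} [Fintype ι] [Fintype κ]

/-- A holomorphic family of surjective maps to `ℂ^ι` has a local holomorphic right inverse. -/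
lemma exists_rightInverse_frame [DecidableEq ι] {l : CP1 → V →L[ℂ] (ι → ℂ)} {p : CP1}
    (hl : HolAt l p) (hs : Function.Surjective (l p)) :
    ∃ w : ι → CP1 → V, (∀ j, HolAt (w j) p) ∧ ∀ᶠ ζ in 𝓝 p, ∀ j, l ζ (w j ζ) = Pi.single j 1 := by
  choose u hu using fun j : ι => hs (Pi.single j 1)
  have h0 : coeffDet (l p) u ≠ 0 := by
    rw [coeffDet_ne_zero_iff]
    intro x hx
    rw [← hx]
    ext i
    simp [hu, Finset.sum_apply, Pi.single_apply]
  have hd := HolAt.coeffDet hl (v := fun i _ => u i) fun i => HolAt.const _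
  refine ⟨fun j ζ => ∑ i, (coeffNum (l ζ) u (Pi.single j 1) i / coeffDet (l ζ) u) • u i, fun j =>
    HolAt.sum fun i _ => (((HolAt.coeffNum hl (fun i => HolAt.const (u i)) (HolAt.const _) i).div
      hd h0).smul (HolAt.const _)), ?_⟩
  filter_upwards [hd.continuousAt.eventually_ne h0] with ζ hζ j
  exact map_sum_coeffNum _ _ _ hζ

/-- The orthogonal of a subspace with respect to a bilinear form. -/
def orth (Ω : V →L[ℂ] V →L[ℂ] ℂ) (A : Submodule ℂ V) : Submodule ℂ V where
  carrier := {v | ∀ w ∈ A, Ω w v = 0}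
  zero_mem' := fun _ _ => map_zero _
  add_mem' hv hw := fun u hu => by rw [map_add, hv u hu, hw u hu, add_zero]
  smul_mem' c _ hv := fun u hu => by rw [map_smul, hv u hu, smul_zero]

lemma mem_orth {Ω : V →L[ℂ] V →L[ℂ] ℂ} {A : Submodule ℂ V} {v : V} :
    v ∈ orth Ω A ↔ ∀ w ∈ A, Ω w v = 0 := Iff.rfl

lemma orth_anti {Ω : V →L[ℂ] V →L[ℂ] ℂ} {A B : Submodule ℂ V} (h : A ≤ B) :
    orth Ω B ≤ orth Ω A := fun _ hv w hw => hv w (h hw)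

/-- The functionals `Ω (v i, ·)` form a holomorphic family, which is surjective where the `v i` are
linearly independent. -/
lemma exists_pairing {Ω : CP1 → V →L[ℂ] V →L[ℂ] ℂ} {p : CP1} {v : ι → CP1 → V} (hΩ : HolAt Ω p)
    (hnd : ∀ v, (∀ w, Ω p v w = 0) → v = 0) (hv : ∀ i, HolAt (v i) p)
    (hli : LinearIndependent ℂ fun i => v i p) :
    ∃ l : CP1 → V →L[ℂ] (ι → ℂ), HolAt l p ∧ Function.Surjective (l p) ∧
      ∀ ζ x i, l ζ x i = Ω ζ (v i ζ) x := by
  classical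
  refine ⟨fun ζ => ∑ i, (ContinuousLinearMap.single ℂ (fun _ : ι => ℂ) i).comp (Ω ζ (v i ζ)),
    HolAt.sum fun i _ => ?_, ?_, ?_⟩
  · exact (hΩ.clm_apply (hv i)).clm
      (ContinuousLinearMap.compL ℂ V ℂ (ι → ℂ) (ContinuousLinearMap.single ℂ (fun _ : ι => ℂ) i))
  swap
  · intro ζ x i
    simp [Finset.sum_apply, Pi.single_apply]
  set l : V →L[ℂ] (ι → ℂ) :=
    ∑ i, (ContinuousLinearMap.single ℂ (fun _ : ι => ℂ) i).comp (Ω p (v i p)) with hl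
  have hlx : ∀ x i, l x i = Ω p (v i p) x := by
    intro x i
    simp [hl, Finset.sum_apply, Pi.single_apply]
  change Function.Surjective l.toLinearMap
  rw [← LinearMap.range_eq_top]
  by_contra hne
  obtain ⟨φ, hφ0, hφ⟩ := Submodule.exists_le_ker_of_lt_top _ (lt_top_iff_ne_top.2 hne)
  have hφx : ∀ y : ι → ℂ, φ y = ∑ i, y i * φ (Pi.single i 1) := by
    intro y
    conv_lhs => rw [← Finset.univ_sum_single y]
    rw [map_sum]
    refine Finset.sum_congr rfl fun i _ => ?_
    rw [← smul_eq_mul, ← map_smul, ← Pi.single_smul]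
    simp
  have h1 : ∑ i, φ (Pi.single i 1) • v i p = 0 := by
    refine hnd _ fun w => ?_
    have h2 : φ (l w) = 0 := hφ ⟨w, rfl⟩
    rw [hφx] at h2
    rw [map_sum, sum_apply, ← h2]
    refine Finset.sum_congr rfl fun i _ => ?_
    rw [hlx, map_smul, smul_apply, smul_eq_mul, mul_comm]
  have h3 := Fintype.linearIndependent_iff.1 hli _ h1
  refine hφ0 (LinearMap.ext fun y => ?_)
  rw [hφx]
  simp [h3]

/-- The kernels of a family of maps to trivial bundles which are locally holomorphic and surjective
form a subbundle. -/
lemma isSubbundle_of_ker [FiniteDimensional ℂ V] {A : CP1 → Submodule ℂ V}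
    (h : ∀ p, ∃ (k : ℕ) (l : CP1 → V →L[ℂ] (Fin k → ℂ)), HolAt l p ∧ Function.Surjective (l p) ∧
      ∀ᶠ ζ in 𝓝 p, A ζ = LinearMap.ker (l ζ).toLinearMap) : IsSubbundle A := by
  classical
  intro p
  obtain ⟨k, l, hl, hs, hA⟩ := h p
  obtain ⟨w, hw, hlw⟩ := exists_rightInverse_frame hl hs
  let b := Module.finBasis ℂ (LinearMap.ker (l p).toLinearMap)
  let v : Fin (Module.finrank ℂ (LinearMap.ker (l p).toLinearMap)) → CP1 → V :=
    fun j ζ => b j - ∑ i, l ζ (b j) i • w i ζ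
  have hv : ∀ j, HolAt (v j) p := fun j => (HolAt.const _).sub (HolAt.sum fun i _ =>
    (holAt_pi.1 (hl.clm_apply (HolAt.const _)) i).smul (hw i))
  have hvp : ∀ j, v j p = b j := by
    intro j
    have : l p (b j) = 0 := (b j).2
    simp [v, this]
  have hli : LinearIndependent ℂ fun j => v j p := by
    simp_rw [hvp]
    exact b.linearIndependent.map' (Submodule.subtype _) (Submodule.ker_subtype _)
  have hsurj : ∀ ζ, (∀ j, l ζ (w j ζ) = Pi.single j 1) → ∀ y : Fin k → ℂ,
      l ζ (∑ i, y i • w i ζ) = y := by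
    intro ζ h y
    rw [map_sum]
    ext i
    simp [h, Finset.sum_apply, Pi.single_apply]
  have hrank : ∀ ζ, (∀ j, l ζ (w j ζ) = Pi.single j 1) →
      k + Module.finrank ℂ (LinearMap.ker (l ζ).toLinearMap) = Module.finrank ℂ V := by
    intro ζ h
    rw [← (l ζ).toLinearMap.finrank_range_add_finrank_ker, LinearMap.range_eq_top.2, finrank_top,
      Module.finrank_fin_fun]
    intro y
    exact ⟨_, hsurj ζ h y⟩
  refine ⟨_, v, hv, hli, ?_⟩
  filter_upwards [hA, hlw, eventually_linearIndependent hv hli] with ζ h1 h2 h3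
  rw [h1]
  refine Submodule.eq_of_le_of_finrank_eq ?_ ?_
  · rw [Submodule.span_le]
    rintro _ ⟨j, rfl⟩
    change l ζ (v j ζ) = 0
    simp only [v]
    rw [map_sub, hsurj ζ h2, sub_self]
  · rw [finrank_span_eq_card h3, Fintype.card_fin]
    have h4 := hrank ζ h2
    have h5 := hrank p hlw.self_of_nhds
    omega

variable {Ω : CP1 → V →L[ℂ] V →L[ℂ] ℂ} (hΩ : ∀ p, HolAt Ω p)
  (hnd : ∀ ζ v, (∀ w, Ω ζ v w = 0) → v = 0)

include hΩ hnd

lemma IsSubbundle.orth [FiniteDimensional ℂ V] {A : CP1 → Submodule ℂ V} (hA : IsSubbundle A) :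
    IsSubbundle fun ζ => orth (Ω ζ) (A ζ) := by
  refine isSubbundle_of_ker fun p => ?_
  obtain ⟨k, v, hv, hli, hs⟩ := hA p
  obtain ⟨l, hl, hsurj, hlx⟩ := exists_pairing (hΩ p) (hnd p) hv hli
  refine ⟨k, l, hl, hsurj, ?_⟩
  filter_upwards [hs] with ζ hζ
  ext x
  rw [mem_orth, ← hζ]
  change _ ↔ l ζ x = 0
  constructor
  · intro h
    ext i
    rw [hlx]
    exact h _ (Submodule.subset_span ⟨i, rfl⟩)
  · intro h w hw
    obtain ⟨y, rfl⟩ := (Submodule.mem_span_range_iff_exists_fun ℂ).1 hw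
    rw [map_sum, sum_apply]
    refine Finset.sum_eq_zero fun i _ => ?_
    rw [map_smul, smul_apply, ← hlx, h]
    simp

/-- The form identifies `P^⊥ / L^⊥` with the dual of `L / P`: the dual of a frame of `L / P` is a
frame of `P^⊥ / L^⊥`. -/
lemma IsQuotFrame.exists_dual {P L : CP1 → Submodule ℂ V} (hP : IsSubbundle P)
    {f : κ → CP1 → V} (hf : IsQuotFrame L P f) :
    ∃ d : κ → CP1 → V, IsQuotFrame (fun ζ => TwistorQuotient.orth (Ω ζ) (P ζ))
      (fun ζ => TwistorQuotient.orth (Ω ζ) (L ζ)) d := by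
  classical
  have hloc : ∀ p (i : κ), ∃ w : CP1 → V, HolAt w p ∧ ∀ᶠ ζ in 𝓝 p,
      w ζ ∈ TwistorQuotient.orth (Ω ζ) (P ζ) ∧ ∀ j, Ω ζ (f j ζ) (w ζ) = if j = i then 1 else 0 := by
    intro p i
    obtain ⟨k, u, hu, hli, hue⟩ := hf.exists_adapted_frame hP p
    obtain ⟨l, hl, hsurj, hlx⟩ := exists_pairing (hΩ p) (hnd p) hu hli
    obtain ⟨w, hw, hlw⟩ := exists_rightInverse_frame hl hsurj
    refine ⟨w (Sum.inl i), hw _, ?_⟩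
    filter_upwards [hue, hlw] with ζ h1 h2
    have h3 : ∀ j, Ω ζ (u j ζ) (w (Sum.inl i) ζ) = if j = Sum.inl i then 1 else 0 := by
      intro j
      rw [← hlx, h2, Pi.single_apply]
    have h4 : w (Sum.inl i) ζ ∈ TwistorQuotient.orth (Ω ζ) (P ζ) := by
      rw [mem_orth, ← h1.2]
      intro x hx
      obtain ⟨y, rfl⟩ := (Submodule.mem_span_range_iff_exists_fun ℂ).1 hx
      rw [map_sum, sum_apply]
      refine Finset.sum_eq_zero fun j _ => ?_
      rw [map_smul, smul_apply, h3]
      simp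
    refine ⟨h4, fun j => ?_⟩
    have h5 := h4 _ (h1.1 j).2
    rw [map_sub, sub_apply, h3, sub_eq_zero] at h5
    rw [← h5]
    simp
  choose w hw hwp using hloc
  have hd := fun ζ i => (hwp ζ i).self_of_nhds
  -- a vector which is orthogonal to `P` and to the frame of `L / P` is orthogonal to `L`
  have hmem : ∀ ζ x, x ∈ TwistorQuotient.orth (Ω ζ) (P ζ) → (∀ j, Ω ζ (f j ζ) x = 0) →
      x ∈ TwistorQuotient.orth (Ω ζ) (L ζ) := by
    intro ζ x hx hfx y hy
    obtain ⟨c, hc⟩ := hf.span ζ y hy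
    have h1 := hx _ hc
    rw [map_sub, sub_apply, sub_eq_zero] at h1
    rw [h1, map_sum, sum_apply]
    refine Finset.sum_eq_zero fun j _ => ?_
    rw [map_smul, smul_apply, hfx, smul_zero]
  have hpair : ∀ ζ (x : κ → ℂ) j, Ω ζ (f j ζ) (∑ i, x i • w ζ i ζ) = x j := by
    intro ζ x j
    rw [map_sum]
    simp [(hd ζ _).2]
  refine ⟨fun i ζ => w ζ i ζ, fun i p => ⟨w p i, hw p i, ?_⟩, fun i ζ => (hd ζ i).1, ?_, ?_⟩
  · filter_upwards [hwp p i] with ζ hζ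
    refine ⟨hζ.1, hmem ζ _ (Submodule.sub_mem _ hζ.1 (hd ζ i).1) fun j => ?_⟩
    rw [map_sub, hζ.2, (hd ζ i).2, sub_self]
  · intro ζ x hx
    ext j
    rw [← hpair ζ x j]
    exact hx _ (hf.mem j ζ)
  · intro ζ v hv
    refine ⟨fun j => Ω ζ (f j ζ) v, hmem ζ _ (Submodule.sub_mem _ hv (Submodule.sum_mem _ fun i _ =>
      Submodule.smul_mem _ _ (hd ζ i).1)) fun j => ?_⟩
    rw [map_sub, hpair, sub_self]

/-- Symplectic reduction in stages: for `P ≤ L ≤ L^⊥`, triviality of `L / P` and of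
`L^⊥ / L` implies triviality of `P^⊥ / P`. -/
theorem exists_quotFrame_orth [FiniteDimensional ℂ V] {P L : CP1 → Submodule ℂ V}
    (hP : IsSubbundle P) (hL : IsSubbundle L) (hPL : ∀ ζ, P ζ ≤ L ζ) (hLL : ∀ ζ, L ζ ≤ TwistorQuotient.orth (Ω ζ) (L ζ))
    {f : κ → CP1 → V} (hf : IsQuotFrame L P f)
    {e : ι → CP1 → V} (he : IsQuotFrame (fun ζ => TwistorQuotient.orth (Ω ζ) (L ζ)) L e) :
    ∃ g : κ ⊕ (ι ⊕ κ) → CP1 → V,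
      IsQuotFrame (fun ζ => TwistorQuotient.orth (Ω ζ) (P ζ)) P g := by
  obtain ⟨g₁, hg₁⟩ := IsQuotFrame.exists_extend hLL hPL hL hP he hf
  obtain ⟨d, hd⟩ := hf.exists_dual hΩ hnd hP
  exact IsQuotFrame.exists_extend (fun ζ => orth_anti (hPL ζ)) (fun ζ => (hPL ζ).trans (hLL ζ))
    (hL.orth hΩ hnd) hP hd hg₁

end Symplectic

/-! ### The fibres of a submersion to the projective line -/

section Fibres

universe u
variable {E : Type u} [NormedAddCommGroup E] [NormedSpace ℂ E]
  {Z : Type*} [TopologicalSpace Z] [ChartedSpace E Z] [IsManifold 𝓘(ℂ, E) ω Z]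

lemma RealSpace.contMDiff_proj (S : RealSpace E Z) : ContMDiff 𝓘(ℂ, E) 𝓘(ℂ) ω S.proj :=
  S.isSubmersion.contMDiff

/-- A holomorphic parametrization `ψ` of the fibre of `S` through `z₀`, defined near `0` in a normed
space `F`, together with a holomorphic extension `κ` of its inverse to a neighbourhood of `z₀`. -/
structure IsFibreChart (S : RealSpace E Z) (z₀ : Z) {F : Type*} [NormedAddCommGroup F]
    [NormedSpace ℂ F] (ψ : F → Z) (κ : Z → F) : Prop where
  map_zero : ψ 0 = z₀
  inv_apply : κ z₀ = 0
  contMDiffAt : ContMDiffAt 𝓘(ℂ, F) 𝓘(ℂ, E) ω ψ 0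
  contMDiffAt_inv : ContMDiffAt 𝓘(ℂ, E) 𝓘(ℂ, F) ω κ z₀
  proj_map : ∀ᶠ x in 𝓝 0, S.proj (ψ x) = S.proj z₀
  left_inv : ∀ᶠ x in 𝓝 0, κ (ψ x) = x
  right_inv : ∀ᶠ z in 𝓝 z₀, S.proj z = S.proj z₀ → ψ (κ z) = z
  vert_le : ∀ v ∈ S.vert z₀, ∃ x : F, (mfderiv 𝓘(ℂ, F) 𝓘(ℂ, E) ψ 0 : F →L[ℂ] E) x = v

/-- In suitable charts the projection is a linear projection `ℂ × F → ℂ`, so that its differentials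
are surjective and its fibres are slices. -/
lemma exists_fibreChart_aux (S : RealSpace E Z) (z₀ : Z) :
    (∃ v : TangentSpace 𝓘(ℂ, E) z₀, mfderiv 𝓘(ℂ, E) 𝓘(ℂ) S.proj z₀ v ≠ 0) ∧
    ∃ (F : Type u) (_ : NormedAddCommGroup F) (_ : NormedSpace ℂ F) (_ : E ≃L[ℂ] ℂ × F)
      (ψ : F → Z) (κ : Z → F), IsFibreChart S z₀ ψ κ := by
  have h := S.isSubmersion.isSubmersionAt z₀
  set e := h.domChart with he
  set c := h.codChart with hc
  set L := h.equiv with hL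
  have hez : z₀ ∈ e.source := h.mem_domChart_source
  have hcz : S.proj z₀ ∈ c.source := h.mem_codChart_source
  have hsub : ∀ z ∈ e.source, S.proj z ∈ c.source := h.source_subset_preimage_source
  have hw : ∀ z ∈ e.source, c (S.proj z) = (L (e z)).1 := by
    intro z hz
    have hz' : e z ∈ (h.domChart.extend 𝓘(ℂ, E)).target := by
      simpa using e.map_source hz
    have h1 := h.writtenInCharts hz'
    simpa [← he, ← hc, ← hL, e.left_inv hz] using h1
  have hcon : ContMDiffAt 𝓘(ℂ, E) 𝓘(ℂ, E) ω e z₀ :=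
    contMDiffAt_of_mem_maximalAtlas h.domChart_mem_maximalAtlas hez
  have hcons : ContMDiffAt 𝓘(ℂ, E) 𝓘(ℂ, E) ω e.symm (e z₀) :=
    contMDiffAt_symm_of_mem_maximalAtlas h.domChart_mem_maximalAtlas (e.map_source hez)
  have hcc : ContMDiffAt 𝓘(ℂ) 𝓘(ℂ) ω c (S.proj z₀) :=
    contMDiffAt_of_mem_maximalAtlas h.codChart_mem_maximalAtlas hcz
  have hsrc := e.open_source.mem_nhds hez
  -- the differential of `proj` in the charts
  have hder : ∀ v : TangentSpace 𝓘(ℂ, E) z₀,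
      (mfderiv 𝓘(ℂ) 𝓘(ℂ) c (S.proj z₀) (mfderiv 𝓘(ℂ, E) 𝓘(ℂ) S.proj z₀ v) : ℂ) =
      (L (mfderiv 𝓘(ℂ, E) 𝓘(ℂ, E) e z₀ v : E)).1 := by
    intro v
    have h1 : HasMFDerivAt 𝓘(ℂ, E) 𝓘(ℂ) (c ∘ S.proj) z₀ _ :=
      (hcc.mdifferentiableAt (by simp)).hasMFDerivAt.comp z₀
        ((S.contMDiff_proj.contMDiffAt.mdifferentiableAt (by simp)).hasMFDerivAt)
    let M : E →L[ℂ] ℂ := (ContinuousLinearMap.fst ℂ ℂ h.complement).comp (L : E →L[ℂ] ℂ × h.complement)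
    have h2 : HasMFDerivAt 𝓘(ℂ, E) 𝓘(ℂ) (M ∘ e) z₀ _ :=
      M.hasMFDerivAt.comp z₀ (hcon.mdifferentiableAt (by simp)).hasMFDerivAt
    have h3 : HasMFDerivAt 𝓘(ℂ, E) 𝓘(ℂ) (M ∘ e) z₀ _ := h1.congr_of_eventuallyEq (by
      filter_upwards [hsrc] with z hz using (hw z hz).symm)
    exact DFunLike.congr_fun (hasMFDerivAt_unique h3 h2) v
  have hinv1 : ∀ w : E, (mfderiv 𝓘(ℂ, E) 𝓘(ℂ, E) e z₀
      (mfderiv 𝓘(ℂ, E) 𝓘(ℂ, E) e.symm (e z₀) w : E) : E) = w := by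
    intro w
    have h1 : HasMFDerivAt 𝓘(ℂ, E) 𝓘(ℂ, E) (e ∘ e.symm) (e z₀) _ :=
      HasMFDerivAt.comp (e z₀)
        (by rw [e.left_inv hez]; exact (hcon.mdifferentiableAt (by simp)).hasMFDerivAt)
        (hcons.mdifferentiableAt (by simp)).hasMFDerivAt
    have h2 : HasMFDerivAt 𝓘(ℂ, E) 𝓘(ℂ, E) (e ∘ e.symm) (e z₀)
        (ContinuousLinearMap.id ℂ (TangentSpace 𝓘(ℂ, E) (e z₀))) :=
      (hasMFDerivAt_id (e z₀)).congr_of_eventuallyEq (by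
        filter_upwards [e.open_target.mem_nhds (e.map_source hez)] with y hy using e.right_inv hy)
    exact DFunLike.congr_fun (hasMFDerivAt_unique h1 h2) w
  have hinv2 : ∀ v : TangentSpace 𝓘(ℂ, E) z₀, (mfderiv 𝓘(ℂ, E) 𝓘(ℂ, E) e.symm (e z₀)
      (mfderiv 𝓘(ℂ, E) 𝓘(ℂ, E) e z₀ v : E) : E) = v := by
    intro v
    have h1 : HasMFDerivAt 𝓘(ℂ, E) 𝓘(ℂ, E) (e.symm ∘ e) z₀ _ :=
      HasMFDerivAt.comp z₀ (hcons.mdifferentiableAt (by simp)).hasMFDerivAt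
        (hcon.mdifferentiableAt (by simp)).hasMFDerivAt
    have h2 : HasMFDerivAt 𝓘(ℂ, E) 𝓘(ℂ, E) (e.symm ∘ e) z₀
        (ContinuousLinearMap.id ℂ (TangentSpace 𝓘(ℂ, E) z₀)) :=
      (hasMFDerivAt_id z₀).congr_of_eventuallyEq (by
        filter_upwards [hsrc] with y hy using e.left_inv hy)
    exact DFunLike.congr_fun (hasMFDerivAt_unique h1 h2) v
  refine ⟨⟨(mfderiv 𝓘(ℂ, E) 𝓘(ℂ, E) e.symm (e z₀) (L.symm (1, 0)) : E), fun h0 => ?_⟩,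
    h.complement, inferInstance, inferInstance, L, ?_⟩
  · have h1 := hder (mfderiv 𝓘(ℂ, E) 𝓘(ℂ, E) e.symm (e z₀) (L.symm (1, 0)) : E)
    erw [h0, hinv1, map_zero] at h1
    rw [L.apply_symm_apply] at h1
    exact zero_ne_one (α := ℂ) h1
  let g : h.complement → E := fun x => L.symm ((L (e z₀)).1, (L (e z₀)).2 + x)
  have hg0 : g 0 = e z₀ := by simp [g]
  have hgc : ContDiff ℂ ω g := by fun_prop
  have hgt : ∀ᶠ x in 𝓝 (0 : h.complement), g x ∈ e.target :=
    hgc.continuous.continuousAt.eventually (by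
      rw [hg0]; exact e.open_target.mem_nhds (e.map_source hez))
  have hψ : ContMDiffAt 𝓘(ℂ, h.complement) 𝓘(ℂ, E) ω (fun x => e.symm (g x)) 0 :=
    ContMDiffAt.comp 0 (by rw [hg0]; exact hcons) hgc.contDiffAt.contMDiffAt
  refine ⟨fun x => e.symm (g x), fun z => (L (e z)).2 - (L (e z₀)).2, ?_, by simp, hψ, ?_,
    ?_, ?_, ?_, ?_⟩
  · simp only [hg0, e.left_inv hez]
  · have h1 : ContDiff ℂ ω fun y : E => (L y).2 - (L (e z₀)).2 := by fun_prop
    exact ContMDiffAt.comp z₀ h1.contDiffAt.contMDiffAt hcon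
  · filter_upwards [hgt] with x hx
    have h1 := e.map_target hx
    refine c.injOn (hsub _ h1) hcz ?_
    rw [hw _ h1, hw _ hez, e.right_inv hx]
    simp [g]
  · filter_upwards [hgt] with x hx
    simp [e.right_inv hx, g]
  · filter_upwards [hsrc] with z hz hpz
    have h1 : (L (e z₀)).1 = (L (e z)).1 := by rw [← hw z hz, ← hw z₀ hez, hpz]
    have h2 : g ((L (e z)).2 - (L (e z₀)).2) = e z := by
      simp only [g, add_sub_cancel]
      rw [h1]
      simp
    rw [h2, e.left_inv hz]
  · intro v hv
    have hv0 : mfderiv 𝓘(ℂ, E) 𝓘(ℂ) S.proj z₀ v = 0 := hv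
    have h1 := hder v
    erw [hv0, map_zero] at h1
    refine ⟨(L (mfderiv 𝓘(ℂ, E) 𝓘(ℂ, E) e z₀ v : E)).2, ?_⟩
    have h2 : HasMFDerivAt 𝓘(ℂ, h.complement) 𝓘(ℂ, E) g 0
        ((L.symm : ℂ × h.complement →L[ℂ] E).comp (ContinuousLinearMap.inr ℂ ℂ h.complement)) := by
      refine HasFDerivAt.hasMFDerivAt ?_
      refine L.symm.hasFDerivAt.comp (0 : h.complement) ?_
      exact (hasFDerivAt_const _ _).prodMk ((hasFDerivAt_id _).const_add _)
    have h3 : HasMFDerivAt 𝓘(ℂ, h.complement) 𝓘(ℂ, E) (e.symm ∘ g) 0 _ :=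
      HasMFDerivAt.comp 0 (by rw [hg0]; exact (hcons.mdifferentiableAt (by simp)).hasMFDerivAt) h2
    let w : E := mfderiv 𝓘(ℂ, E) 𝓘(ℂ, E) e z₀ v
    let D : E →L[ℂ] E := mfderiv 𝓘(ℂ, E) 𝓘(ℂ, E) e.symm (e z₀)
    have h4 : L.symm ((0 : ℂ), (L w).2) = w := by
      rw [L.symm_apply_eq]
      exact Prod.ext h1 rfl
    have h5 : D (L.symm ((0 : ℂ), (L w).2)) = v := (congrArg D h4).trans (hinv2 v)
    exact (DFunLike.congr_fun h3.mfderiv (L w).2).trans h5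

/-- The projection has surjective differentials. -/
lemma RealSpace.exists_mfderiv_proj_ne_zero (S : RealSpace E Z) (z₀ : Z) :
    ∃ v : TangentSpace 𝓘(ℂ, E) z₀, mfderiv 𝓘(ℂ, E) 𝓘(ℂ) S.proj z₀ v ≠ 0 :=
  (exists_fibreChart_aux S z₀).1

lemma exists_fibreChart [FiniteDimensional ℂ E] (S : RealSpace E Z) (z₀ : Z) :
    ∃ (F : Type u) (_ : NormedAddCommGroup F) (_ : NormedSpace ℂ F) (_ : FiniteDimensional ℂ F)
      (ψ : F → Z) (κ : Z → F), IsFibreChart S z₀ ψ κ := by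
  obtain ⟨-, F, i1, i2, L, ψ, κ, h⟩ := exists_fibreChart_aux S z₀
  have : FiniteDimensional ℂ (ℂ × F) := L.toLinearEquiv.finiteDimensional
  exact ⟨F, i1, i2, Module.Finite.of_surjective (LinearMap.snd ℂ ℂ F) Prod.snd_surjective, ψ, κ, h⟩

/-- The fibres of the vertical tangent bundle have constant dimension. -/
lemma RealSpace.finrank_vert [FiniteDimensional ℂ E] (S : RealSpace E Z) (z : Z) :
    1 + Module.finrank ℂ (S.vert z) = Module.finrank ℂ E := by
  have : FiniteDimensional ℂ (TangentSpace 𝓘(ℂ, E) z) := inferInstanceAs (FiniteDimensional ℂ E)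
  let D : E →ₗ[ℂ] ℂ := (mfderiv 𝓘(ℂ, E) 𝓘(ℂ) S.proj z : E →L[ℂ] ℂ).toLinearMap
  have h1 := D.finrank_range_add_finrank_ker
  obtain ⟨v, hv⟩ := S.exists_mfderiv_proj_ne_zero z
  have h2 : LinearMap.range D = ⊤ := by
    rw [LinearMap.range_eq_top]
    exact LinearMap.surjective (f := D) fun h0 => hv (DFunLike.congr_fun h0 (v : E))
  rw [h2, finrank_top, Module.finrank_self] at h1
  exact h1

section Chain

variable {E' : Type*} [NormedAddCommGroup E'] [NormedSpace ℂ E']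
  {Z' : Type*} [TopologicalSpace Z'] [ChartedSpace E' Z'] [IsManifold 𝓘(ℂ, E') ω Z']
  {E'' : Type*} [NormedAddCommGroup E''] [NormedSpace ℂ E'']
  {M : Type*} [TopologicalSpace M] [ChartedSpace E'' M]

/-- The derivative of a map on a fibre is uniquely determined on vertical vectors. -/
lemma eq_on_vert_of_hasMFDerivWithinAt (S : RealSpace E Z) {z₀ : Z} {f : Z → M}
    {f₁ f₂ : TangentSpace 𝓘(ℂ, E) z₀ →L[ℂ] TangentSpace 𝓘(ℂ, E'') (f z₀)}
    (h₁ : HasMFDerivWithinAt 𝓘(ℂ, E) 𝓘(ℂ, E'') f (S.proj ⁻¹' {S.proj z₀}) z₀ f₁)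
    (h₂ : HasMFDerivWithinAt 𝓘(ℂ, E) 𝓘(ℂ, E'') f (S.proj ⁻¹' {S.proj z₀}) z₀ f₂)
    {v : TangentSpace 𝓘(ℂ, E) z₀} (hv : v ∈ S.vert z₀) : f₁ v = f₂ v := by
  obtain ⟨-, F, i1, i2, L, ψ, κ, h⟩ := exists_fibreChart_aux S z₀
  obtain ⟨x, rfl⟩ := h.vert_le v hv
  have hψ := (h.contMDiffAt.mdifferentiableAt (by simp)).hasMFDerivAt
  have h0 := h.map_zero
  have hpr := h.proj_map
  clear hv h
  subst h0
  have key : ∀ f', HasMFDerivWithinAt 𝓘(ℂ, E) 𝓘(ℂ, E'') f (S.proj ⁻¹' {S.proj (ψ 0)}) (ψ 0) f' →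
      HasMFDerivAt 𝓘(ℂ, F) 𝓘(ℂ, E'') (f ∘ ψ) 0
        (f'.comp (mfderiv 𝓘(ℂ, F) 𝓘(ℂ, E) ψ 0)) := fun f' hf' =>
    (hf'.comp 0 (hψ.hasMFDerivWithinAt (s := ψ ⁻¹' (S.proj ⁻¹' {S.proj (ψ 0)})))
      subset_rfl).hasMFDerivAt hpr
  exact DFunLike.congr_fun (hasMFDerivAt_unique (key f₁ h₁) (key f₂ h₂)) x

variable {S : RealSpace E Z} {S' : RealSpace E' Z'} {ζ ζ' : CP1} {g : Z' → Z} {z' : Z'}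

/-- The derivative of a map of fibres maps vertical vectors to vertical vectors. -/
lemma mfderivWithin_mem_vert (hz : S'.proj z' = ζ')
    (hg : MDifferentiableWithinAt 𝓘(ℂ, E') 𝓘(ℂ, E) g (S'.proj ⁻¹' {ζ'}) z')
    (hm : ∀ x, S'.proj x = ζ' → S.proj (g x) = ζ) {v : TangentSpace 𝓘(ℂ, E') z'}
    (hv : v ∈ S'.vert z') :
    mfderivWithin 𝓘(ℂ, E') 𝓘(ℂ, E) g (S'.proj ⁻¹' {ζ'}) z' v ∈ S.vert (g z') := by
  subst hz
  have h1 : HasMFDerivWithinAt 𝓘(ℂ, E') 𝓘(ℂ) (S.proj ∘ g) (S'.proj ⁻¹' {S'.proj z'}) z' _ :=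
    HasMFDerivAt.comp_hasMFDerivWithinAt z'
      (S.contMDiff_proj.contMDiffAt.mdifferentiableAt (by simp)).hasMFDerivAt hg.hasMFDerivWithinAt
  have h2 : HasMFDerivWithinAt 𝓘(ℂ, E') 𝓘(ℂ) (S.proj ∘ g) (S'.proj ⁻¹' {S'.proj z'}) z' 0 :=
    (hasMFDerivWithinAt_const ζ _ z').congr_mono (fun x hx => hm x hx) (hm z' rfl) subset_rfl
  exact eq_on_vert_of_hasMFDerivWithinAt S' h1 h2 hv

/-- The chain rule for derivatives of maps of fibres. -/
lemma mfderivWithin_comp_vert {f : Z → M} (hz : S'.proj z' = ζ')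
    (hf : MDifferentiableWithinAt 𝓘(ℂ, E) 𝓘(ℂ, E'') f (S.proj ⁻¹' {ζ}) (g z'))
    (hg : MDifferentiableWithinAt 𝓘(ℂ, E') 𝓘(ℂ, E) g (S'.proj ⁻¹' {ζ'}) z')
    (hm : ∀ x, S'.proj x = ζ' → S.proj (g x) = ζ) {v : TangentSpace 𝓘(ℂ, E') z'}
    (hv : v ∈ S'.vert z') :
    mfderivWithin 𝓘(ℂ, E') 𝓘(ℂ, E'') (fun x => f (g x)) (S'.proj ⁻¹' {ζ'}) z' v =
      mfderivWithin 𝓘(ℂ, E) 𝓘(ℂ, E'') f (S.proj ⁻¹' {ζ}) (g z')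
        (mfderivWithin 𝓘(ℂ, E') 𝓘(ℂ, E) g (S'.proj ⁻¹' {ζ'}) z' v) := by
  subst hz
  have h1 : HasMFDerivWithinAt 𝓘(ℂ, E') 𝓘(ℂ, E'') (f ∘ g) (S'.proj ⁻¹' {S'.proj z'}) z' _ :=
    hf.hasMFDerivWithinAt.comp z' hg.hasMFDerivWithinAt fun x hx => hm x hx
  exact eq_on_vert_of_hasMFDerivWithinAt S' h1.mdifferentiableWithinAt.hasMFDerivWithinAt h1 hv

end Chain

/-- Every vertical vector extends to a local holomorphic vertical vector field. -/
lemma exists_vertical_extension (S : RealSpace E Z) {z₀ : Z} {v₀ : TangentSpace 𝓘(ℂ, E) z₀}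
    (hv₀ : v₀ ∈ S.vert z₀) :
    ∃ (U : Set Z) (V : ∀ z : Z, TangentSpace 𝓘(ℂ, E) z), IsOpen U ∧ z₀ ∈ U ∧
      (∀ z, V z ∈ S.vert z) ∧ V z₀ = v₀ ∧
      ContMDiffOn 𝓘(ℂ, E) 𝓘(ℂ, E).tangent ω
        (fun z => (⟨z, V z⟩ : TangentBundle 𝓘(ℂ, E) Z)) U := by
  classical
  obtain ⟨v₁, hv₁⟩ := S.exists_mfderiv_proj_ne_zero z₀
  let W₀ : ∀ z : Z, TangentSpace 𝓘(ℂ, E) z := FiberBundle.extend E v₀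
  let W₁ : ∀ z : Z, TangentSpace 𝓘(ℂ, E) z := FiberBundle.extend E v₁
  have hW₀ : ContMDiffAt 𝓘(ℂ, E) 𝓘(ℂ, E).tangent ω
      (fun z => (⟨z, W₀ z⟩ : TangentBundle 𝓘(ℂ, E) Z)) z₀ :=
    FiberBundle.contMDiffAt_extend 𝓘(ℂ, E) E v₀
  have hW₁ : ContMDiffAt 𝓘(ℂ, E) 𝓘(ℂ, E).tangent ω
      (fun z => (⟨z, W₁ z⟩ : TangentBundle 𝓘(ℂ, E) Z)) z₀ :=
    FiberBundle.contMDiffAt_extend 𝓘(ℂ, E) E v₁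
  let t := trivializationAt ℂ (TangentSpace 𝓘(ℂ) : CP1 → Type) (S.proj z₀)
  let d : ∀ z : Z, TangentSpace 𝓘(ℂ, E) z → ℂ := fun z v =>
    t.continuousLinearMapAt ℂ (S.proj z) (mfderiv 𝓘(ℂ, E) 𝓘(ℂ) S.proj z v)
  have hbase : ∀ᶠ z in 𝓝 z₀, S.proj z ∈ t.baseSet :=
    S.contMDiff_proj.continuous.continuousAt.eventually
      (t.open_baseSet.mem_nhds (FiberBundle.mem_baseSet_trivializationAt' _))
  have hd : ∀ W : ∀ z : Z, TangentSpace 𝓘(ℂ, E) z, ContMDiffAt 𝓘(ℂ, E) 𝓘(ℂ, E).tangent ω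
      (fun z => (⟨z, W z⟩ : TangentBundle 𝓘(ℂ, E) Z)) z₀ →
      ContMDiffAt 𝓘(ℂ, E) 𝓘(ℂ) ω (fun z => d z (W z)) z₀ := by
    intro W hW
    have h1 : ContMDiff 𝓘(ℂ, E).tangent 𝓘(ℂ).tangent ω (tangentMap 𝓘(ℂ, E) 𝓘(ℂ) S.proj) :=
      S.contMDiff_proj.contMDiff_tangentMap le_rfl
    have h2 := h1.contMDiffAt.comp z₀ hW
    have h3 := (Bundle.contMDiffAt_totalSpace.1 h2).2
    refine h3.congr_of_eventuallyEq ?_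
    filter_upwards [hbase] with z hz
    simp only [d]
    rw [Bundle.Trivialization.continuousLinearMapAt_apply,
      Bundle.Trivialization.coe_linearMapAt_of_mem _ hz]
    rfl
  have hd0 : ∀ z, S.proj z ∈ t.baseSet → ∀ v, d z v = 0 → v ∈ S.vert z := by
    intro z hz v hv
    have h1 := t.symmL_continuousLinearMapAt (R := ℂ) hz (mfderiv 𝓘(ℂ, E) 𝓘(ℂ) S.proj z v)
    change t.symmL ℂ (S.proj z) (d z v) = _ at h1
    rw [hv, map_zero] at h1
    exact h1.symm
  have ha := hd W₀ hW₀
  have hb := hd W₁ hW₁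
  have ha0 : d z₀ (W₀ z₀) = 0 := by
    have h1 : mfderiv 𝓘(ℂ, E) 𝓘(ℂ) S.proj z₀ v₀ = 0 := hv₀
    simp only [d, W₀, FiberBundle.extend_apply_self, h1, map_zero]
  have hb0 : d z₀ (W₁ z₀) ≠ 0 := by
    intro h
    have h1 := hd0 z₀ hbase.self_of_nhds _ h
    simp only [W₁, FiberBundle.extend_apply_self] at h1
    exact hv₁ h1
  -- subtracting a multiple of a field which is transverse to the fibres makes the extension vertical
  let V₀ : ∀ z : Z, TangentSpace 𝓘(ℂ, E) z := fun z => W₀ z - (d z (W₀ z) / d z (W₁ z)) • W₁ z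
  have hV₀ : ContMDiffAt 𝓘(ℂ, E) 𝓘(ℂ, E).tangent ω
      (fun z => (⟨z, V₀ z⟩ : TangentBundle 𝓘(ℂ, E) Z)) z₀ :=
    hW₀.sub_section ((ha.div₀ hb hb0).smul_section hW₁)
  have hgood : ∀ᶠ z in 𝓝 z₀, V₀ z ∈ S.vert z ∧ ContMDiffAt 𝓘(ℂ, E) 𝓘(ℂ, E).tangent ω
      (fun z => (⟨z, V₀ z⟩ : TangentBundle 𝓘(ℂ, E) Z)) z := by
    filter_upwards [hbase, hb.continuousAt.eventually_ne hb0,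
      (contMDiffAt_iff_contMDiffAt_nhds (by simp)).1 hV₀] with z h1 h2 h3
    refine ⟨hd0 z h1 _ ?_, h3⟩
    simp only [d, V₀] at h2 ⊢
    rw [map_sub, map_smul, map_sub, map_smul, smul_eq_mul, div_mul_cancel₀ _ h2, sub_self]
  obtain ⟨U, hU, hUo, hzU⟩ := eventually_nhds_iff.1 hgood
  refine ⟨U, fun z => if z ∈ U then V₀ z else 0, hUo, hzU, fun z => ?_, ?_, fun z hz => ?_⟩
  · by_cases hz : z ∈ U
    · simpa [hz] using (hU z hz).1
    · simp [hz]
  · simp only [hzU, if_true, V₀, ha0, zero_div, zero_smul, sub_zero]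
    exact FiberBundle.extend_apply_self E v₀
  · refine ((hU z hz).2.congr_of_eventuallyEq ?_).contMDiffWithinAt
    filter_upwards [hUo.mem_nhds hz] with y hy
    simp [hy]

end Fibres

/-! ### Twistor groups and their actions on fibres -/

/-- The derivatives of a map at equal points agree.  As the tangent spaces at these points are
different types, the derivatives are compared as maps of the model spaces. -/
lemma mfderivWithin_congr_point {E E' Z M' : Type*} [NormedAddCommGroup E]
    [NormedSpace ℂ E] [TopologicalSpace Z] [ChartedSpace E Z] [NormedAddCommGroup E']
    [NormedSpace ℂ E'] [TopologicalSpace M'] [ChartedSpace E' M'] (f : Z → M') (s : Set Z)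
    {x y : Z} (h : x = y) :
    (mfderivWithin 𝓘(ℂ, E) 𝓘(ℂ, E') f s x : E →L[ℂ] E') =
      mfderivWithin 𝓘(ℂ, E) 𝓘(ℂ, E') f s y := by
  subst h; rfl

section Groups

variable {E : Type*} [NormedAddCommGroup E] [NormedSpace ℂ E]
  {Z : Type*} [TopologicalSpace Z] [ChartedSpace E Z] [IsManifold 𝓘(ℂ, E) ω Z]
  {EG : Type*} [NormedAddCommGroup EG] [NormedSpace ℂ EG]
  {G : Type*} [TopologicalSpace G] [ChartedSpace EG G] [IsManifold 𝓘(ℂ, EG) ω G]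
  {EH : Type*} [NormedAddCommGroup EH] [NormedSpace ℂ EH]
  {H : Type*} [TopologicalSpace H] [ChartedSpace EH H] [IsManifold 𝓘(ℂ, EH) ω H]

/-- The fibres of a twistor group are groups. -/
abbrev TwistorGroup.fibreGroup (𝒢 : TwistorGroup EG G) (ζ : CP1) :
    Group {g : G // 𝒢.proj g = ζ} :=
  letI : Mul {g : G // 𝒢.proj g = ζ} :=
    ⟨fun g h => ⟨𝒢.mul g h, by rw [𝒢.proj_mul _ _ (g.2.trans h.2.symm), g.2]⟩⟩
  letI : Inv {g : G // 𝒢.proj g = ζ} := ⟨fun g => ⟨𝒢.inv g, by rw [𝒢.proj_inv, g.2]⟩⟩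
  letI : One {g : G // 𝒢.proj g = ζ} := ⟨⟨𝒢.one ζ, 𝒢.proj_one ζ⟩⟩
  Group.ofLeftAxioms
    (fun g h k => Subtype.ext (𝒢.mul_assoc g h k (g.2.trans h.2.symm) (h.2.trans k.2.symm)))
    (fun g => Subtype.ext (by
      have h1 := 𝒢.one_mul g.1
      rw [g.2] at h1
      exact h1))
    (fun g => Subtype.ext (by
      have h1 := 𝒢.inv_mul g.1
      rw [g.2] at h1
      exact h1))

lemma TwistorGroup.mul_one (𝒢 : TwistorGroup EG G) (g : G) : 𝒢.mul g (𝒢.one (𝒢.proj g)) = g := by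
  let := 𝒢.fibreGroup (𝒢.proj g)
  exact congrArg Subtype.val (_root_.mul_one (⟨g, rfl⟩ : {h : G // 𝒢.proj h = 𝒢.proj g}))

lemma TwistorGroup.mul_inv (𝒢 : TwistorGroup EG G) (g : G) :
    𝒢.mul g (𝒢.inv g) = 𝒢.one (𝒢.proj g) := by
  let := 𝒢.fibreGroup (𝒢.proj g)
  exact congrArg Subtype.val (mul_inv_cancel (⟨g, rfl⟩ : {h : G // 𝒢.proj h = 𝒢.proj g}))

/-- Conjugation by `g` on the fibre through `g`. -/
def TwistorGroup.conj (𝒢 : TwistorGroup EG G) (g h : G) : G := 𝒢.mul (𝒢.mul g h) (𝒢.inv g)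

lemma TwistorGroup.proj_conj (𝒢 : TwistorGroup EG G) {g h : G} (hh : 𝒢.proj h = 𝒢.proj g) :
    𝒢.proj (𝒢.conj g h) = 𝒢.proj g := by
  have h1 := 𝒢.proj_mul g h hh.symm
  rw [TwistorGroup.conj, 𝒢.proj_mul _ _ (by rw [h1, 𝒢.proj_inv]), h1]

lemma TwistorGroup.conj_one (𝒢 : TwistorGroup EG G) (g : G) :
    𝒢.conj g (𝒢.one (𝒢.proj g)) = 𝒢.one (𝒢.proj g) := by
  rw [TwistorGroup.conj, 𝒢.mul_one, 𝒢.mul_inv]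

lemma TwistorGroup.conj_conj_inv (𝒢 : TwistorGroup EG G) {g h : G} (hh : 𝒢.proj h = 𝒢.proj g) :
    𝒢.conj g (𝒢.conj (𝒢.inv g) h) = h := by
  let := 𝒢.fibreGroup (𝒢.proj g)
  have h1 : ∀ a b : {k : G // 𝒢.proj k = 𝒢.proj g}, a * (a⁻¹ * b * a⁻¹⁻¹) * a⁻¹ = b := by
    intro a b; group
  exact congrArg Subtype.val (h1 ⟨g, rfl⟩ ⟨h, hh⟩)

lemma TwistorGroup.contMDiffOn_conj (𝒢 : TwistorGroup EG G) (g : G) {ζ : CP1} (hζ : 𝒢.proj g = ζ) :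
    ContMDiffOn 𝓘(ℂ, EG) 𝓘(ℂ, EG) ω (𝒢.conj g) (𝒢.proj ⁻¹' {ζ}) := by
  subst hζ
  have h1 : ContMDiffOn 𝓘(ℂ, EG) 𝓘(ℂ, EG) ω (fun h => 𝒢.mul g h) (𝒢.proj ⁻¹' {𝒢.proj g}) :=
    𝒢.holomorphic_mul.comp (t := {q : G × G | 𝒢.proj q.1 = 𝒢.proj q.2})
      (contMDiffOn_const.prodMk contMDiffOn_id) fun h hh => Eq.symm hh
  exact 𝒢.holomorphic_mul.comp (t := {q : G × G | 𝒢.proj q.1 = 𝒢.proj q.2})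
    (h1.prodMk contMDiffOn_const) fun h hh => by
      have hh' : 𝒢.proj h = 𝒢.proj g := hh
      change 𝒢.proj (𝒢.mul g h) = 𝒢.proj (𝒢.inv g)
      rw [𝒢.proj_mul _ _ hh'.symm, 𝒢.proj_inv]

variable {𝒢 : TwistorGroup EG G} {ℋ : TwistorGroup EH H} {S : RealSpace E Z}

lemma TwistorAction.contMDiffOn_act_left (a : TwistorAction 𝒢 S) {z : Z} {ζ : CP1}
    (hz : S.proj z = ζ) :
    ContMDiffOn 𝓘(ℂ, EG) 𝓘(ℂ, E) ω (fun g => a.act g z) (𝒢.proj ⁻¹' {ζ}) := by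
  subst hz
  exact a.holomorphic.comp (t := {q : G × Z | 𝒢.proj q.1 = S.proj q.2})
    (contMDiffOn_id.prodMk contMDiffOn_const) fun h hh => hh

lemma RealSpace.mem_vert_congr (S : RealSpace E Z) {x y : Z} (h : x = y) {v : E}
    (hv : v ∈ (S.vert x : Submodule ℂ E)) : v ∈ (S.vert y : Submodule ℂ E) := by
  subst h; exact hv

lemma TwistorAction.infAct_mem_vert (a : TwistorAction 𝒢 S) {z : Z} {ζ : CP1} (hz : S.proj z = ζ)
    {X : TangentSpace 𝓘(ℂ, EG) (𝒢.one ζ)} (hX : X ∈ 𝒢.lie ζ) : a.infAct ζ z X ∈ S.vert z := by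
  have h1 := mfderivWithin_mem_vert (S := S) (S' := 𝒢.toRealSpace) (ζ := ζ) (𝒢.proj_one ζ)
    ((a.contMDiffOn_act_left hz _ (𝒢.proj_one ζ)).mdifferentiableWithinAt (by simp))
    (fun g hg => by rw [a.proj_act _ _ (by rw [hg, hz]), hz]) hX
  exact S.mem_vert_congr (by rw [← hz, a.one_act]) h1

lemma TwistorGroup.ad_mem (𝒢 : TwistorGroup EG G) (g : G)
    {X : TangentSpace 𝓘(ℂ, EG) (𝒢.one (𝒢.proj g))} (hX : X ∈ 𝒢.lie (𝒢.proj g)) :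
    𝒢.ad g X ∈ 𝒢.lie (𝒢.proj g) := by
  have h1 := mfderivWithin_mem_vert (S := 𝒢.toRealSpace) (S' := 𝒢.toRealSpace) (ζ := 𝒢.proj g)
    (𝒢.proj_one (𝒢.proj g))
    ((𝒢.contMDiffOn_conj g rfl _ (𝒢.proj_one _)).mdifferentiableWithinAt (by simp))
    (fun h hh => 𝒢.proj_conj hh) hX
  exact 𝒢.mem_vert_congr (𝒢.conj_one g) h1

/-- The adjoint action is invertible on the Lie algebra. -/
lemma TwistorGroup.exists_ad_eq (𝒢 : TwistorGroup EG G) (g : G)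
    {X : TangentSpace 𝓘(ℂ, EG) (𝒢.one (𝒢.proj g))} (hX : X ∈ 𝒢.lie (𝒢.proj g)) :
    ∃ Y ∈ 𝒢.lie (𝒢.proj g), 𝒢.ad g Y = X := by
  have hinv : 𝒢.proj (𝒢.inv g) = 𝒢.proj g := 𝒢.proj_inv g
  have hone : 𝒢.conj (𝒢.inv g) (𝒢.one (𝒢.proj g)) = 𝒢.one (𝒢.proj g) := by
    have := 𝒢.conj_one (𝒢.inv g)
    rwa [hinv] at this
  have hpr : ∀ h, 𝒢.proj h = 𝒢.proj g → 𝒢.proj (𝒢.conj (𝒢.inv g) h) = 𝒢.proj g := fun h hh => by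
    rw [𝒢.proj_conj (by rw [hinv, hh]), hinv]
  have hd : MDifferentiableWithinAt 𝓘(ℂ, EG) 𝓘(ℂ, EG) (𝒢.conj (𝒢.inv g)) (𝒢.proj ⁻¹' {𝒢.proj g})
      (𝒢.one (𝒢.proj g)) :=
    (𝒢.contMDiffOn_conj (𝒢.inv g) hinv _ (𝒢.proj_one _)).mdifferentiableWithinAt (by simp)
  have hd' : MDifferentiableWithinAt 𝓘(ℂ, EG) 𝓘(ℂ, EG) (𝒢.conj g) (𝒢.proj ⁻¹' {𝒢.proj g})
      (𝒢.one (𝒢.proj g)) :=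
    (𝒢.contMDiffOn_conj g rfl _ (𝒢.proj_one _)).mdifferentiableWithinAt (by simp)
  have hmem := mfderivWithin_mem_vert (S := 𝒢.toRealSpace) (S' := 𝒢.toRealSpace) (ζ := 𝒢.proj g)
    (𝒢.proj_one (𝒢.proj g)) hd hpr hX
  refine ⟨_, 𝒢.mem_vert_congr hone hmem, ?_⟩
  have h1 := mfderivWithin_comp_vert (S := 𝒢.toRealSpace) (S' := 𝒢.toRealSpace) (f := 𝒢.conj g)
    (𝒢.proj_one (𝒢.proj g)) (by rw [hone]; exact hd') hd hpr hX
  have h2 := mfderivWithin_congr_point (E' := EG) (E := EG) (𝒢.conj g) (𝒢.proj ⁻¹' {𝒢.proj g}) hone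
  have h3 : HasMFDerivWithinAt 𝓘(ℂ, EG) 𝓘(ℂ, EG) (fun h => 𝒢.conj g (𝒢.conj (𝒢.inv g) h))
      (𝒢.proj ⁻¹' {𝒢.proj (𝒢.one (𝒢.proj g))}) (𝒢.one (𝒢.proj g))
      (ContinuousLinearMap.id ℂ (TangentSpace 𝓘(ℂ, EG) (𝒢.one (𝒢.proj g)))) := by
    rw [𝒢.proj_one]
    exact (hasMFDerivWithinAt_id _ _).congr_mono (fun h hh => 𝒢.conj_conj_inv hh)
      (𝒢.conj_conj_inv (𝒢.proj_one _)) subset_rfl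
  have h4 := eq_on_vert_of_hasMFDerivWithinAt 𝒢.toRealSpace
    h3.mdifferentiableWithinAt.hasMFDerivWithinAt h3 hX
  rw [𝒢.proj_one] at h4
  refine Eq.trans ?_ (h1.symm.trans h4)
  exact (DFunLike.congr_fun h2 _).symm

section Subgroup

variable {ι : H → G} (hι : IsTwistorSubgroup ℋ 𝒢 ι)
include hι

lemma IsTwistorSubgroup.contMDiff : ContMDiff 𝓘(ℂ, EH) 𝓘(ℂ, EG) ω ι := hι.isImmersion.contMDiff

lemma IsTwistorSubgroup.mfderivWithin_eq {ζ : CP1} {X : TangentSpace 𝓘(ℂ, EH) (ℋ.one ζ)}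
    (hX : X ∈ ℋ.lie ζ) :
    (mfderivWithin 𝓘(ℂ, EH) 𝓘(ℂ, EG) ι (ℋ.proj ⁻¹' {ζ}) (ℋ.one ζ) X : EG) =
      lieIncl ℋ 𝒢 ι ζ X := by
  have h1 := (hι.contMDiff.contMDiffAt (x := ℋ.one ζ)).mdifferentiableAt (by simp)
  have h2 := eq_on_vert_of_hasMFDerivWithinAt ℋ.toRealSpace
    (h1.mdifferentiableWithinAt (s := ℋ.proj ⁻¹' {ℋ.proj (ℋ.one ζ)})).hasMFDerivWithinAt
    h1.hasMFDerivAt.hasMFDerivWithinAt hX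
  rw [ℋ.proj_one] at h2
  exact h2

lemma IsTwistorSubgroup.lieIncl_mem {ζ : CP1} {X : TangentSpace 𝓘(ℂ, EH) (ℋ.one ζ)}
    (hX : X ∈ ℋ.lie ζ) : lieIncl ℋ 𝒢 ι ζ X ∈ 𝒢.lie ζ := by
  have h1 := mfderivWithin_mem_vert (S := 𝒢.toRealSpace) (S' := ℋ.toRealSpace) (g := ι) (ζ := ζ)
    (ℋ.proj_one ζ) ((hι.contMDiff.contMDiffAt.mdifferentiableAt (by simp)).mdifferentiableWithinAt)
    (fun h hh => by rw [hι.proj_incl, hh]) hX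
  have h2 := 𝒢.mem_vert_congr (hι.incl_one ζ) h1
  rw [hι.mfderivWithin_eq hX] at h2
  exact h2

lemma IsTwistorSubgroup.infAct_restrict (a : TwistorAction 𝒢 S) {z : Z} {ζ : CP1}
    (hz : S.proj z = ζ) {X : TangentSpace 𝓘(ℂ, EH) (ℋ.one ζ)} (hX : X ∈ ℋ.lie ζ) :
    (a.restrict hι).infAct ζ z X = a.infAct ζ z (lieIncl ℋ 𝒢 ι ζ X) := by
  have h1 := mfderivWithin_comp_vert (S := 𝒢.toRealSpace) (S' := ℋ.toRealSpace) (g := ι) (ζ := ζ)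
    (f := fun g => a.act g z) (ℋ.proj_one ζ)
    ((a.contMDiffOn_act_left hz _ (by rw [hι.incl_one]; exact 𝒢.proj_one ζ)).mdifferentiableWithinAt
      (by simp))
    ((hι.contMDiff.contMDiffAt.mdifferentiableAt (by simp)).mdifferentiableWithinAt)
    (fun h hh => by rw [hι.proj_incl, hh]) hX
  have h2 := mfderivWithin_congr_point (E' := E) (E := EG) (fun g => a.act g z) (𝒢.proj ⁻¹' {ζ})
    (hι.incl_one ζ)
  refine h1.trans ((DFunLike.congr_fun h2 _).trans ?_)
  exact congrArg (a.infAct ζ z : EG →L[ℂ] E) (hι.mfderivWithin_eq hX)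

lemma IsTwistorSubgroup.incl_inv (h : H) : ι (ℋ.inv h) = 𝒢.inv (ι h) := by
  let := 𝒢.fibreGroup (ℋ.proj h)
  have h1 : 𝒢.mul (ι (ℋ.inv h)) (ι h) = 𝒢.one (ℋ.proj h) := by
    rw [← hι.incl_mul _ _ (ℋ.proj_inv h), ℋ.inv_mul, hι.incl_one]
  let g : {g : G // 𝒢.proj g = ℋ.proj h} := ⟨ι h, hι.proj_incl h⟩
  let g' : {g : G // 𝒢.proj g = ℋ.proj h} := ⟨ι (ℋ.inv h), by rw [hι.proj_incl, ℋ.proj_inv]⟩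
  have h2 : g' * g = 1 := Subtype.ext h1
  exact congrArg Subtype.val (eq_inv_of_mul_eq_one_left h2)

lemma IsTwistorSubgroup.incl_conj {h k : H} (hk : ℋ.proj k = ℋ.proj h) :
    ι (ℋ.conj h k) = 𝒢.conj (ι h) (ι k) := by
  rw [TwistorGroup.conj, TwistorGroup.conj, hι.incl_mul _ _ (by
    rw [ℋ.proj_mul _ _ hk.symm, ℋ.proj_inv]), hι.incl_mul _ _ hk.symm, hι.incl_inv]

/-- The inclusion of Lie algebras is equivariant for the adjoint actions. -/
lemma IsTwistorSubgroup.ad_lieIncl (h : H) {X : TangentSpace 𝓘(ℂ, EH) (ℋ.one (ℋ.proj h))}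
    (hX : X ∈ ℋ.lie (ℋ.proj h)) :
    (𝒢.ad (ι h) : EG →L[ℂ] EG) (lieIncl ℋ 𝒢 ι (ℋ.proj h) X) =
      lieIncl ℋ 𝒢 ι (ℋ.proj h) (ℋ.ad h X) := by
  have hιd : ∀ k, MDifferentiableWithinAt 𝓘(ℂ, EH) 𝓘(ℂ, EG) ι (ℋ.proj ⁻¹' {ℋ.proj h}) k := fun k =>
    (hι.contMDiff.contMDiffAt.mdifferentiableAt (by simp)).mdifferentiableWithinAt
  have hιm : ∀ k, ℋ.proj k = ℋ.proj h → 𝒢.proj (ι k) = ℋ.proj h := fun k hk => by rw [hι.proj_incl, hk]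
  have hGd : MDifferentiableWithinAt 𝓘(ℂ, EG) 𝓘(ℂ, EG) (𝒢.conj (ι h)) (𝒢.proj ⁻¹' {ℋ.proj h})
      (ι (ℋ.one (ℋ.proj h))) := (𝒢.contMDiffOn_conj (ι h) (hι.proj_incl h) _ (by
        rw [hι.incl_one]; exact 𝒢.proj_one (ℋ.proj h))).mdifferentiableWithinAt (by simp)
  have hHd : MDifferentiableWithinAt 𝓘(ℂ, EH) 𝓘(ℂ, EH) (ℋ.conj h) (ℋ.proj ⁻¹' {ℋ.proj h})
      (ℋ.one (ℋ.proj h)) :=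
    (ℋ.contMDiffOn_conj h rfl _ (ℋ.proj_one (ℋ.proj h))).mdifferentiableWithinAt (by simp)
  have h1 := mfderivWithin_comp_vert (S := 𝒢.toRealSpace) (S' := ℋ.toRealSpace) (g := ι) (ζ := ℋ.proj h)
    (f := 𝒢.conj (ι h)) (ℋ.proj_one (ℋ.proj h)) hGd (hιd _) hιm hX
  have h2 := mfderivWithin_comp_vert (S := ℋ.toRealSpace) (S' := ℋ.toRealSpace) (g := ℋ.conj h)
    (ζ := ℋ.proj h) (f := ι) (ℋ.proj_one (ℋ.proj h)) (hιd _) hHd (fun k hk => ℋ.proj_conj hk) hX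
  have h3 : (mfderivWithin 𝓘(ℂ, EH) 𝓘(ℂ, EG) (fun k => 𝒢.conj (ι h) (ι k)) (ℋ.proj ⁻¹' {ℋ.proj h})
      (ℋ.one (ℋ.proj h)) : EH →L[ℂ] EG) = mfderivWithin 𝓘(ℂ, EH) 𝓘(ℂ, EG) (fun k => ι (ℋ.conj h k))
      (ℋ.proj ⁻¹' {ℋ.proj h}) (ℋ.one (ℋ.proj h)) :=
    mfderivWithin_congr (fun k hk => (hι.incl_conj hk).symm) (hι.incl_conj (ℋ.proj_one (ℋ.proj h))).symm
  have h4 := mfderivWithin_congr_point (E' := EG) (E := EG) (𝒢.conj (ι h)) (𝒢.proj ⁻¹' {ℋ.proj h})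
    (hι.incl_one (ℋ.proj h))
  have h5 := mfderivWithin_congr_point (E' := EG) (E := EH) ι (ℋ.proj ⁻¹' {ℋ.proj h}) (ℋ.conj_one h)
  have h6 : (𝒢.ad (ι h) : EG →L[ℂ] EG) =
      mfderivWithin 𝓘(ℂ, EG) 𝓘(ℂ, EG) (𝒢.conj (ι h)) (𝒢.proj ⁻¹' {ℋ.proj h}) (𝒢.one (ℋ.proj h)) := by
    have h7 : 𝒢.proj (ι h) = ℋ.proj h := hι.proj_incl h
    have h8 : ∀ ξ, 𝒢.proj (ι h) = ξ → (𝒢.ad (ι h) : EG →L[ℂ] EG) =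
      mfderivWithin 𝓘(ℂ, EG) 𝓘(ℂ, EG) (𝒢.conj (ι h)) (𝒢.proj ⁻¹' {ξ}) (𝒢.one ξ) := by
      rintro ξ rfl; rfl
    exact h8 _ h7
  have e1 : (mfderivWithin 𝓘(ℂ, EH) 𝓘(ℂ, EG) ι (ℋ.proj ⁻¹' {ℋ.proj h}) (ℋ.one (ℋ.proj h)) X : EG) =
      lieIncl ℋ 𝒢 ι (ℋ.proj h) X := hι.mfderivWithin_eq hX
  have e2 : (mfderivWithin 𝓘(ℂ, EH) 𝓘(ℂ, EG) ι (ℋ.proj ⁻¹' {ℋ.proj h}) (ℋ.one (ℋ.proj h))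
      (ℋ.ad h X) : EG) = lieIncl ℋ 𝒢 ι (ℋ.proj h) (ℋ.ad h X) := hι.mfderivWithin_eq (ℋ.ad_mem h hX)
  let D : EG →L[ℂ] EG := mfderivWithin 𝓘(ℂ, EG) 𝓘(ℂ, EG) (𝒢.conj (ι h)) (𝒢.proj ⁻¹' {ℋ.proj h})
    (ι (ℋ.one (ℋ.proj h)))
  have e3 := DFunLike.congr_fun (h6.trans h4.symm) (lieIncl ℋ 𝒢 ι (ℋ.proj h) X : EG)
  exact (e3.trans (congrArg D e1.symm)).trans
    (h1.symm.trans ((DFunLike.congr_fun h3 X).trans (h2.trans ((DFunLike.congr_fun h5 _).trans e2))))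

/-- The action of a twistor subgroup is locally free if the action of the group is. -/
lemma IsTwistorSubgroup.locallyFree {a : TwistorAction 𝒢 S} (ha : a.LocallyFree) :
    (a.restrict hι).LocallyFree := by
  intro z
  have := ha z
  let j : {h : H // ℋ.proj h = S.proj z ∧ (a.restrict hι).act h z = z} →
      {g : G // 𝒢.proj g = S.proj z ∧ a.act g z = z} :=
    fun h => ⟨ι h, by rw [hι.proj_incl, h.2.1], h.2.2⟩
  have hj : Continuous j :=
    (hι.contMDiff.continuous.comp continuous_subtype_val).subtype_mk _
  exact DiscreteTopology.of_continuous_injective hj fun x y hxy =>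
    Subtype.ext (hι.injective (congrArg Subtype.val hxy))

end Subgroup

end Groups

/-! ### Locally free actions have no infinitesimal stabilizers -/

/-- Let `m` be a local group law on `F` and `b` a local action of it, and let `f` be the orbit map
of a point.  If the differential of `f` at the unit kills `X ≠ 0`, then the point has stabilizers
arbitrarily close to the unit: `f` is constant along the integral curve through `0` of the left
invariant vector field generated by `X`. -/
lemma frequently_eq_of_fderiv_eq_zero {F F' : Type*} [NormedAddCommGroup F] [NormedSpace ℂ F]
    [CompleteSpace F] [NormedAddCommGroup F'] [NormedSpace ℂ F'] {m : F × F → F} {f : F → F'}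
    {b : F × F' → F'} (hm : ContDiffAt ℂ ω m (0, 0)) (hf : ContDiffAt ℂ ω f 0)
    (hb : ContDiffAt ℂ ω b (0, f 0)) (hm₁ : ∀ᶠ x in 𝓝 0, m (x, 0) = x)
    (hm₂ : ∀ᶠ y in 𝓝 0, m (0, y) = y)
    (h : ∀ᶠ q : F × F in 𝓝 (0, 0), f (m q) = b (q.1, f q.2)) {X : F} (hX : X ≠ 0)
    (hfX : fderiv ℂ f 0 X = 0) : ∃ᶠ x in 𝓝[≠] 0, f x = f 0 := by
  -- the left invariant vector field generated by `X`
  let ξ : F → F := fun x => fderiv ℂ m (x, 0) (0, X)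
  have hξ : ContDiffAt ℂ ω ξ 0 := by
    have h1 : ContDiffAt ℂ ω (fderiv ℂ m) (0, 0) := hm.fderiv_right (m := ω) (by simp)
    exact (h1.comp (0 : F) (f := fun x : F => (x, (0 : F)))
      (contDiffAt_id.prodMk contDiffAt_const)).clm_apply contDiffAt_const
  have hder : ∀ x y : F, DifferentiableAt ℂ m (x, y) →
      HasFDerivAt (fun y => m (x, y)) ((fderiv ℂ m (x, y)).comp (ContinuousLinearMap.inr ℂ F F)) y :=
    fun x y hxy => hxy.hasFDerivAt.comp y (hasFDerivAt_prodMk_right x y)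
  have hξ0 : ξ 0 = X := by
    have h1 := hder 0 0 (hm.differentiableAt (by simp))
    have h2 := h1.unique ((hasFDerivAt_id (0 : F)).congr_of_eventuallyEq hm₂)
    exact DFunLike.congr_fun h2 X
  have hne : (ω : WithTop ℕ∞) ≠ ∞ := by simp
  have hcont : Filter.Tendsto (fun x : F => (x, (0 : F))) (𝓝 0) (𝓝 (0, 0)) :=
    (continuous_id.prodMk continuous_const).tendsto (0 : F)
  have hcont' : Filter.Tendsto (fun x : F => (x, f 0)) (𝓝 0) (𝓝 (0, f 0)) :=
    (continuous_id.prodMk continuous_const).tendsto (0 : F)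
  -- differentiating `f (m (x, y)) = b (x, f y)` at `y = 0` in the direction of `X`
  have hker : ∀ᶠ x in 𝓝 0, fderiv ℂ f x (ξ x) = 0 := by
    filter_upwards [hm₁, hcont.eventually (hm.eventually hne), hf.eventually hne,
      hcont'.eventually (hb.eventually hne), hcont.eventually h.eventually_nhds] with x h1 h2 h3 h4 h5
    have h6 := hder x 0 (h2.differentiableAt (by simp))
    have h7 : HasFDerivAt (fun y => f (m (x, y))) _ 0 :=
      HasFDerivAt.comp (0 : F) (g := f) (f := fun y => m (x, y))
        (by rw [h1]; exact (h3.differentiableAt (by simp)).hasFDerivAt) h6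
    have h8 : HasFDerivAt (fun y => b (x, f y)) _ 0 :=
      HasFDerivAt.comp (0 : F) (g := fun w => b (x, w)) (f := f)
        ((h4.differentiableAt (by simp)).hasFDerivAt.comp (f 0) (hasFDerivAt_prodMk_right x (f 0)))
        (hf.differentiableAt (by simp)).hasFDerivAt
    have h9 : (fun y => f (m (x, y))) =ᶠ[𝓝 0] fun y => b (x, f y) :=
      (Continuous.tendsto (f := fun y : F => (x, y)) (by fun_prop) 0).eventually h5
    have h10 := DFunLike.congr_fun (h7.unique (h8.congr_of_eventuallyEq h9)) X
    simpa [hfX, ξ, Prod.mk_zero_zero] using h10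
  obtain ⟨α, hα0, ε, hε, hα⟩ :=
    ((hξ.restrict_scalars ℝ).of_le
      le_top).exists_forall_mem_closedBall_exists_eq_forall_mem_Ioo_hasDerivAt₀ 0
  have hα' : ∀ᶠ t in 𝓝 (0 : ℝ), HasDerivAt α (ξ (α t)) t := by
    filter_upwards [Ioo_mem_nhds (by linarith : 0 - ε < 0) (by linarith : (0 : ℝ) < 0 + ε)] using hα
  have hαc : Filter.Tendsto α (𝓝 0) (𝓝 0) := by
    have := hα'.self_of_nhds.continuousAt.tendsto
    rwa [hα0] at this
  have hconst : ∀ᶠ t in 𝓝 (0 : ℝ), HasDerivAt (f ∘ α) 0 t := by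
    filter_upwards [hα', hαc.eventually hker, hαc.eventually (hf.eventually hne)] with t h1 h2 h3
    have h4 := ((h3.differentiableAt (by simp)).hasFDerivAt.restrictScalars ℝ).comp_hasDerivAt t h1
    simpa [h2] using h4
  obtain ⟨δ, hδ, hball⟩ := Metric.eventually_nhds_iff_ball.1 hconst
  have heq : ∀ᶠ t in 𝓝 (0 : ℝ), f (α t) = f 0 := by
    filter_upwards [Metric.ball_mem_nhds 0 hδ] with t ht
    have h1 := Metric.isOpen_ball.is_const_of_deriv_eq_zero
      (convex_ball (0 : ℝ) δ).isPreconnected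
      (fun s hs => (hball s hs).differentiableAt.differentiableWithinAt)
      (fun s hs => (hball s hs).deriv) ht (Metric.mem_ball_self hδ)
    simpa [hα0] using h1
  have hneq : ∀ᶠ t in 𝓝[≠] (0 : ℝ), α t ≠ 0 := by
    have h1 := hα'.self_of_nhds
    rw [hα0, hξ0] at h1
    have h2 := h1.eventually_ne hX (c := 0)
    exact h2
  have hlim : Filter.Tendsto α (𝓝[≠] 0) (𝓝[≠] 0) :=
    tendsto_nhdsWithin_iff.2 ⟨hαc.mono_left nhdsWithin_le_nhds, hneq⟩
  exact hlim.frequently (heq.filter_mono nhdsWithin_le_nhds).frequently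

lemma ContMDiffWithinAt.comp_contMDiffAt {E M E' M' E'' M'' : Type*} [NormedAddCommGroup E]
    [NormedSpace ℂ E] {H : Type*} [TopologicalSpace H] {I : ModelWithCorners ℂ E H}
    [TopologicalSpace M] [ChartedSpace H M] [NormedAddCommGroup E'] [NormedSpace ℂ E']
    {H' : Type*} [TopologicalSpace H'] {I' : ModelWithCorners ℂ E' H'}
    [TopologicalSpace M'] [ChartedSpace H' M'] [NormedAddCommGroup E''] [NormedSpace ℂ E'']
    {H'' : Type*} [TopologicalSpace H''] {I'' : ModelWithCorners ℂ E'' H''}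
    [TopologicalSpace M''] [ChartedSpace H'' M''] {g : M' → M''} {f : M → M'} {t : Set M'} {x : M}
    (hg : ContMDiffWithinAt I' I'' ω g t (f x)) (hf : ContMDiffAt I I' ω f x)
    (h : ∀ᶠ y in 𝓝 x, f y ∈ t) : ContMDiffAt I I'' ω (fun y => g (f y)) x :=
  (hg.comp x (hf.contMDiffWithinAt (s := f ⁻¹' t)) fun _ hy => hy).contMDiffAt h

section

variable {E : Type*} [NormedAddCommGroup E] [NormedSpace ℂ E]
  {Z : Type*} [TopologicalSpace Z] [ChartedSpace E Z] [IsManifold 𝓘(ℂ, E) ω Z]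
  {EG : Type*} [NormedAddCommGroup EG] [NormedSpace ℂ EG]
  {G : Type*} [TopologicalSpace G] [ChartedSpace EG G] [IsManifold 𝓘(ℂ, EG) ω G]
  {F : Type*} [NormedAddCommGroup F] [NormedSpace ℂ F]
  {𝒢 : TwistorGroup EG G} {S : RealSpace E Z} {ψ : F → Z} {κ : Z → F} {z : Z} {ζ : CP1}

/-- The derivative of a map on a fibre can be computed in a parametrization of the fibre. -/
lemma IsFibreChart.hasMFDerivAt_comp {E'' M : Type*} [NormedAddCommGroup E''] [NormedSpace ℂ E'']
    [TopologicalSpace M] [ChartedSpace E'' M] (h : IsFibreChart S z ψ κ) (hz : S.proj z = ζ)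
    {f : Z → M} (hf : MDifferentiableWithinAt 𝓘(ℂ, E) 𝓘(ℂ, E'') f (S.proj ⁻¹' {ζ}) z) :
    ∃ D : F →L[ℂ] E'', HasMFDerivAt 𝓘(ℂ, F) 𝓘(ℂ, E'') (f ∘ ψ) 0 D ∧
      ∀ x, D x = (mfderivWithin 𝓘(ℂ, E) 𝓘(ℂ, E'') f (S.proj ⁻¹' {ζ}) z : E →L[ℂ] E'')
        ((mfderiv 𝓘(ℂ, F) 𝓘(ℂ, E) ψ 0 : F →L[ℂ] E) x) := by
  have h0 := h.map_zero
  have h1 := h.contMDiffAt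
  have h2 := h.proj_map
  clear h
  subst h0 hz
  exact ⟨_, (hf.hasMFDerivWithinAt.comp 0
    (h1.mdifferentiableAt (by simp)).hasMFDerivAt.hasMFDerivWithinAt subset_rfl).hasMFDerivAt h2,
    fun x => rfl⟩

/-- If the action is locally free, then the infinitesimal action is injective. -/
lemma TwistorAction.LocallyFree.eq_zero_of_infAct_eq_zero [FiniteDimensional ℂ EG]
    {a : TwistorAction 𝒢 S} (ha : a.LocallyFree) (hz : S.proj z = ζ)
    {X : TangentSpace 𝓘(ℂ, EG) (𝒢.one ζ)} (hX : X ∈ 𝒢.lie ζ) (hX0 : a.infAct ζ z X = 0) :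
    X = 0 := by
  by_contra hne
  obtain ⟨F, _, _, _, ψ, κ, h⟩ := exists_fibreChart 𝒢.toRealSpace (𝒢.one ζ)
  obtain ⟨-, F', _, _, -, χ, l, h'⟩ := exists_fibreChart_aux S z
  have : CompleteSpace F := FiniteDimensional.complete ℂ F
  obtain ⟨x₀, hx₀⟩ := h.vert_le X hX
  have hone : 𝒢.proj (𝒢.one ζ) = ζ := 𝒢.proj_one ζ
  have hact1 : a.act (𝒢.one ζ) z = z := by rw [← hz, a.one_act]
  have hψp : ∀ᶠ x in 𝓝 0, 𝒢.proj (ψ x) = ζ := by rw [← hone]; simpa [hone] using h.proj_map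
  have hχp : ∀ᶠ x in 𝓝 0, S.proj (χ x) = ζ := by rw [← hz]; exact h'.proj_map
  have hfst : Filter.Tendsto (Prod.fst : F × F → F) (𝓝 (0, 0)) (𝓝 0) := continuous_fst.tendsto _
  have hsnd : Filter.Tendsto (Prod.snd : F × F → F) (𝓝 (0, 0)) (𝓝 0) := continuous_snd.tendsto _
  have hψ1 : ContMDiffAt 𝓘(ℂ, F × F) 𝓘(ℂ, EG) ω (fun q : F × F => ψ q.1) (0, 0) :=
    ContMDiffAt.comp (0, 0) (g := ψ) h.contMDiffAt contDiffAt_fst.contMDiffAt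
  have hψ2 : ContMDiffAt 𝓘(ℂ, F × F) 𝓘(ℂ, EG) ω (fun q : F × F => ψ q.2) (0, 0) :=
    ContMDiffAt.comp (0, 0) (g := ψ) h.contMDiffAt contDiffAt_snd.contMDiffAt
  have hmulone : 𝒢.mul (𝒢.one ζ) (𝒢.one ζ) = 𝒢.one ζ := by
    have := 𝒢.one_mul (𝒢.one ζ)
    rwa [hone] at this
  -- the group law, the orbit map and the action in the fibre charts
  have hmul : ContMDiffAt 𝓘(ℂ, F × F) 𝓘(ℂ, EG) ω (fun q : F × F => 𝒢.mul (ψ q.1) (ψ q.2)) (0, 0) :=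
    ContMDiffWithinAt.comp_contMDiffAt (g := fun q : G × G => 𝒢.mul q.1 q.2)
      (f := fun q : F × F => (ψ q.1, ψ q.2)) (𝒢.holomorphic_mul _ (by simp)) (hψ1.prodMk hψ2) (by
        filter_upwards [hfst.eventually hψp, hsnd.eventually hψp] with q h1 h2 using h1.trans h2.symm)
  have horb : ContMDiffAt 𝓘(ℂ, F) 𝓘(ℂ, E) ω (fun x => a.act (ψ x) z) 0 :=
    ContMDiffWithinAt.comp_contMDiffAt (g := fun g => a.act g z)
      (a.contMDiffOn_act_left hz _ (by rw [h.map_zero]; exact hone)) h.contMDiffAt hψp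
  have horb0 : a.act (ψ 0) z = z := by rw [h.map_zero, hact1]
  have hact : ContMDiffAt 𝓘(ℂ, F × F') 𝓘(ℂ, E) ω (fun q : F × F' => a.act (ψ q.1) (χ q.2)) (0, 0) := by
    refine ContMDiffWithinAt.comp_contMDiffAt (g := fun q : G × Z => a.act q.1 q.2)
      (f := fun q : F × F' => (ψ q.1, χ q.2)) (a.holomorphic _ ?_) (ContMDiffAt.prodMk ?_ ?_) ?_
    · simp [h.map_zero, h'.map_zero, hz, hone]
    · exact ContMDiffAt.comp (0, 0) (g := ψ) h.contMDiffAt contDiffAt_fst.contMDiffAt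
    · exact ContMDiffAt.comp (0, 0) (g := χ) h'.contMDiffAt contDiffAt_snd.contMDiffAt
    · filter_upwards [(continuous_fst.tendsto ((0, 0) : F × F')).eventually hψp,
        (continuous_snd.tendsto ((0, 0) : F × F')).eventually hχp] with q h1 h2 using h1.trans h2.symm
  let m : F × F → F := fun q => κ (𝒢.mul (ψ q.1) (ψ q.2))
  let f : F → F' := fun x => l (a.act (ψ x) z)
  let b : F × F' → F' := fun q => l (a.act (ψ q.1) (χ q.2))
  have hf0 : f 0 = 0 := by simp only [f, horb0, h'.inv_apply]
  have hm : ContDiffAt ℂ ω m (0, 0) := contMDiffAt_iff_contDiffAt.1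
    (ContMDiffAt.comp (0, 0) (g := κ) (by rw [h.map_zero, hmulone]; exact h.contMDiffAt_inv) hmul)
  have hf : ContDiffAt ℂ ω f 0 := contMDiffAt_iff_contDiffAt.1
    (ContMDiffAt.comp 0 (g := l) (by rw [horb0]; exact h'.contMDiffAt_inv) horb)
  have hb : ContDiffAt ℂ ω b (0, f 0) := by
    rw [hf0]
    exact contMDiffAt_iff_contDiffAt.1 (ContMDiffAt.comp (0, 0) (g := l)
      (by rw [h'.map_zero, horb0]; exact h'.contMDiffAt_inv) hact)
  have hm₁ : ∀ᶠ x in 𝓝 0, m (x, 0) = x := by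
    filter_upwards [hψp, h.left_inv] with x h1 h2
    have h3 := 𝒢.mul_one (ψ x)
    rw [h1] at h3
    simp only [m, h.map_zero, h3, h2]
  have hm₂ : ∀ᶠ x in 𝓝 0, m (0, x) = x := by
    filter_upwards [hψp, h.left_inv] with x h1 h2
    have h3 := 𝒢.one_mul (ψ x)
    rw [h1] at h3
    simp only [m, h.map_zero, h3, h2]
  have hact_nhds : Filter.Tendsto (fun x => a.act (ψ x) z) (𝓝 0) (𝓝 z) := by
    have := horb.continuousAt.tendsto
    rwa [horb0] at this
  have hχl : ∀ᶠ x in 𝓝 0, χ (l (a.act (ψ x) z)) = a.act (ψ x) z := by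
    filter_upwards [hact_nhds.eventually h'.right_inv, hψp] with x h1 h2
    exact h1 (a.proj_act _ _ (by rw [h2, hz]))
  have hcomp : ∀ᶠ q : F × F in 𝓝 (0, 0), f (m q) = b (q.1, f q.2) := by
    have h1 : Filter.Tendsto (fun q : F × F => 𝒢.mul (ψ q.1) (ψ q.2)) (𝓝 (0, 0)) (𝓝 (𝒢.one ζ)) := by
      have := hmul.continuousAt.tendsto
      rwa [h.map_zero, hmulone] at this
    filter_upwards [hfst.eventually hψp, hsnd.eventually hψp, h1.eventually h.right_inv,
      hsnd.eventually hχl] with q h2 h3 h4 h5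
    have h6 := h4 (by rw [𝒢.proj_mul _ _ (h2.trans h3.symm), h2, hone])
    simp only [f, m, b, h6, h5]
    rw [a.mul_act _ _ _ (h2.trans h3.symm) (h3.trans hz.symm)]
  have hx₀ne : x₀ ≠ 0 := by
    rintro rfl
    exact hne (hx₀.symm.trans (map_zero _))
  obtain ⟨D, hD, hDx⟩ := h.hasMFDerivAt_comp hone (f := fun g => a.act g z)
    ((a.contMDiffOn_act_left hz _ hone).mdifferentiableWithinAt (by simp))
  have hD0 : D x₀ = 0 := (hDx x₀).trans ((congrArg (a.infAct ζ z : EG →L[ℂ] E) hx₀).trans hX0)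
  have hfx₀ : fderiv ℂ f 0 x₀ = 0 := by
    have h1 : MDifferentiableAt 𝓘(ℂ, E) 𝓘(ℂ, F') l (((fun g => a.act g z) ∘ ψ) 0) := by
      have h2 : ((fun g => a.act g z) ∘ ψ) 0 = z := horb0
      rw [h2]
      exact h'.contMDiffAt_inv.mdifferentiableAt (by simp)
    let Dl : E →L[ℂ] F' := mfderiv 𝓘(ℂ, E) 𝓘(ℂ, F') l (((fun g => a.act g z) ∘ ψ) 0)
    have h3 : HasFDerivAt f (Dl.comp D) 0 := (h1.hasMFDerivAt.comp 0 hD).hasFDerivAt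
    rw [h3.fderiv]
    exact (congrArg Dl hD0).trans (map_zero _)
  have hfreq := frequently_eq_of_fderiv_eq_zero hm hf hb hm₁ hm₂ hcomp hx₀ne hfx₀
  -- elements of the stabilizer which accumulate at the unit
  have hdisc := discreteTopology_subtype_iff.1 (ha z) (𝒢.one ζ) ⟨hone.trans hz.symm, hact1⟩
  have hψt : Filter.Tendsto ψ (𝓝 0) (𝓝 (𝒢.one ζ)) := by
    have := h.contMDiffAt.continuousAt.tendsto
    rwa [h.map_zero] at this
  have hψt' : Filter.Tendsto ψ (𝓝[≠] 0) (𝓝[≠] (𝒢.one ζ)) := by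
    refine tendsto_nhdsWithin_iff.2 ⟨hψt.mono_left nhdsWithin_le_nhds, ?_⟩
    filter_upwards [h.left_inv.filter_mono nhdsWithin_le_nhds, self_mem_nhdsWithin] with x h1 h2 h3
    refine h2 ?_
    rw [← h1, show ψ x = 𝒢.one ζ from h3, h.inv_apply]
    rfl
  have hev : ∀ᶠ g in 𝓝[≠] (𝒢.one ζ), ¬ (𝒢.proj g = S.proj z ∧ a.act g z = z) := by
    exact Filter.disjoint_principal_right.1 (disjoint_iff.2 hdisc)
  refine hfreq ?_
  filter_upwards [hψt'.eventually hev, hψp.filter_mono nhdsWithin_le_nhds,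
    hχl.filter_mono nhdsWithin_le_nhds] with x h1 h2 h3 h4
  refine h1 ⟨h2.trans hz.symm, ?_⟩
  have h5 : l (a.act (ψ x) z) = 0 := h4.trans hf0
  rw [← h3, h5, h'.map_zero]

end

/-! ### Moment maps: restriction to subgroups, and isotropy of invariant orbits -/

section

variable {E : Type*} [NormedAddCommGroup E] [NormedSpace ℂ E]
  {Z : Type*} [TopologicalSpace Z] [ChartedSpace E Z] [IsManifold 𝓘(ℂ, E) ω Z]
  {EG : Type*} [NormedAddCommGroup EG] [NormedSpace ℂ EG]
  {G : Type*} [TopologicalSpace G] [ChartedSpace EG G] [IsManifold 𝓘(ℂ, EG) ω G]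
  {EH : Type*} [NormedAddCommGroup EH] [NormedSpace ℂ EH]
  {H : Type*} [TopologicalSpace H] [ChartedSpace EH H] [IsManifold 𝓘(ℂ, EH) ω H]
  {𝒢 : TwistorGroup EG G} {ℋ : TwistorGroup EH H} {T : TwistorSpace E Z} {ι : H → G}
  {a : TwistorAction 𝒢 T.toRealSpace} {μ : MomentMapData 𝒢 T.toRealSpace}

omit [IsManifold 𝓘(ℂ, E) ω Z] in
lemma tangentBundle_mk_congr {x y : Z} (h : x = y) (v : E) :
    (⟨x, v⟩ : TangentBundle 𝓘(ℂ, E) Z) = ⟨y, v⟩ := by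
  subst h; rfl

lemma lieIncl_congr (ℋ : TwistorGroup EH H) (𝒢 : TwistorGroup EG G) (ι : H → G) {ζ ζ' : CP1}
    (h : ζ = ζ') : (lieIncl ℋ 𝒢 ι ζ : EH →L[ℂ] EG) = lieIncl ℋ 𝒢 ι ζ' := by
  subst h; rfl

lemma IsTwistorSubgroup.isHoloAlong_lieIncl (hι : IsTwistorSubgroup ℋ 𝒢 ι)
    {X : ∀ ζ, TangentSpace 𝓘(ℂ, EH) (ℋ.one ζ)} {U : Set CP1} (hX : IsHoloAlong ℋ.one X U) :
    IsHoloAlong 𝒢.one (fun ζ => lieIncl ℋ 𝒢 ι ζ (X ζ)) U := by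
  have h1 : ContMDiff 𝓘(ℂ, EH).tangent 𝓘(ℂ, EG).tangent ω (tangentMap 𝓘(ℂ, EH) 𝓘(ℂ, EG) ι) :=
    hι.contMDiff.contMDiff_tangentMap le_rfl
  refine (h1.comp_contMDiffOn hX).congr fun ζ _ => ?_
  exact (tangentBundle_mk_congr (hι.incl_one ζ) _).symm

/-- The moment map of a twistor subgroup. -/
def MomentMapData.restrict (μ : MomentMapData 𝒢 T.toRealSpace) (ℋ : TwistorGroup EH H) (ι : H → G) :
    MomentMapData ℋ T.toRealSpace :=
  fun z => (μ z).comp (lieIncl ℋ 𝒢 ι (T.proj z)).toLinearMap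

lemma TwistorAction.IsMomentMap.restrict (hμ : a.IsMomentMap μ) (hι : IsTwistorSubgroup ℋ 𝒢 ι) :
    (a.restrict hι).IsMomentMap (μ.restrict ℋ ι) where
  holomorphic U X hU hX hXU := hμ.holomorphic U (fun ζ => lieIncl ℋ 𝒢 ι ζ (X ζ)) hU
    (fun ζ => hι.lieIncl_mem (hX ζ)) (hι.isHoloAlong_lieIncl hXU)
  hamiltonian z X hX v hv := by
    have h1 := hμ.hamiltonian z _ (hι.lieIncl_mem hX) v hv
    have h2 : (mfderivWithin 𝓘(ℂ, E) 𝓘(ℂ) (fun z' => (μ.restrict ℋ ι z' : EH →ₗ[ℂ] ℂ) X)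
        (T.proj ⁻¹' {T.proj z}) z : E →L[ℂ] ℂ) =
        mfderivWithin 𝓘(ℂ, E) 𝓘(ℂ) (fun z' => (μ z' : EG →ₗ[ℂ] ℂ) (lieIncl ℋ 𝒢 ι (T.proj z) X))
          (T.proj ⁻¹' {T.proj z}) z :=
      mfderivWithin_congr (fun z' hz' => by
        have h3 := lieIncl_congr ℋ 𝒢 ι (show T.proj z' = T.proj z from hz')
        exact congrArg (μ z' : EG →ₗ[ℂ] ℂ) (DFunLike.congr_fun h3 X)) rfl
    rw [hι.infAct_restrict a rfl hX]
    exact (DFunLike.congr_fun h2 v).trans h1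
  equivariant h z hz X hX := by
    have hz' : T.proj (a.act (ι h) z) = ℋ.proj h := by
      rw [a.proj_act _ _ (by rw [hι.proj_incl, hz]), hz]
    have h1 := hμ.equivariant (ι h) z (by rw [hι.proj_incl, hz]) _ (hι.lieIncl_mem hX)
    have hX' : (X : EH) ∈ (ℋ.lie (ℋ.proj h) : Submodule ℂ EH) := by rw [hz]; exact hX
    have h2 := hι.ad_lieIncl h hX'
    have h3' := lieIncl_congr ℋ 𝒢 ι hz
    have h3 := DFunLike.congr_fun h3' X
    have h4' := lieIncl_congr ℋ 𝒢 ι hz'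
    have h4 := DFunLike.congr_fun h4' (ℋ.ad h X)
    refine Eq.trans ?_ h1
    refine congrArg (μ (a.act (ι h) z) : EG →ₗ[ℂ] ℂ) (h4.trans (h2.symm.trans ?_))
    exact congrArg (𝒢.ad (ι h) : EG →L[ℂ] EG) h3

lemma TwistorAction.IsSymplectic.restrict (ha : a.IsSymplectic) (hι : IsTwistorSubgroup ℋ 𝒢 ι) :
    (a.restrict hι).IsSymplectic :=
  fun h z hz v hv w hw => ha (ι h) z (by rw [hι.proj_incl, hz]) v hv w hw

/-- Where the moment map is invariant, it is constant on the orbit by equivariance, so that the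
tangent space of the orbit is isotropic. -/
lemma TwistorAction.IsMomentMap.form_infAct_eq_zero (hμ : a.IsMomentMap μ) {z : Z}
    (hinv : ∀ g, 𝒢.proj g = T.proj z → ∀ X ∈ 𝒢.lie (𝒢.proj g),
      (μ z : EG →ₗ[ℂ] ℂ) (𝒢.ad g X) = (μ z : EG →ₗ[ℂ] ℂ) X)
    {X Y : TangentSpace 𝓘(ℂ, EG) (𝒢.one (T.proj z))} (hX : X ∈ 𝒢.lie (T.proj z))
    (hY : Y ∈ 𝒢.lie (T.proj z)) :
    T.form z (a.infAct (T.proj z) z X) (a.infAct (T.proj z) z Y) = 0 := by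
  have hconst : ∀ g, 𝒢.proj g = T.proj z → (μ (a.act g z) : EG →ₗ[ℂ] ℂ) X = μ z X := by
    intro g hg
    have hX' : (X : EG) ∈ (𝒢.lie (𝒢.proj g) : Submodule ℂ EG) := by rw [hg]; exact hX
    obtain ⟨W, hW, hWX⟩ := 𝒢.exists_ad_eq g hX'
    have hW' : (W : EG) ∈ (𝒢.lie (T.proj z) : Submodule ℂ EG) := by rw [← hg]; exact hW
    have h1 := hμ.equivariant g z hg W hW'
    have h2 := hinv g hg W hW
    have h3 : (μ (a.act g z) : EG →ₗ[ℂ] ℂ) (𝒢.ad g W) = (μ (a.act g z) : EG →ₗ[ℂ] ℂ) X :=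
      congrArg (μ (a.act g z) : EG →ₗ[ℂ] ℂ) hWX
    have h4 : (μ z : EG →ₗ[ℂ] ℂ) (𝒢.ad g W) = (μ z : EG →ₗ[ℂ] ℂ) X :=
      congrArg (μ z : EG →ₗ[ℂ] ℂ) hWX
    exact h3.symm.trans (h1.trans (h2.symm.trans h4))
  have hone : 𝒢.proj (𝒢.one (T.proj z)) = T.proj z := 𝒢.proj_one _
  have hvert := a.infAct_mem_vert rfl hY
  rw [← hμ.hamiltonian z X hX _ hvert]
  -- if `⟨μ, X⟩` had no derivative on the fibre, then `mfderivWithin`, and with it the left-hand side,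
  -- would be zero by convention, so the differentiability need not be established
  by_cases hd : MDifferentiableWithinAt 𝓘(ℂ, E) 𝓘(ℂ) (fun z' => (μ z' : EG →ₗ[ℂ] ℂ) X)
      (T.proj ⁻¹' {T.proj z}) z
  · have h1 := mfderivWithin_comp_vert (S := T.toRealSpace) (S' := 𝒢.toRealSpace)
      (f := fun z' => (μ z' : EG →ₗ[ℂ] ℂ) X) (g := fun g => a.act g z) hone
      (by rw [a.one_act]; exact hd)
      ((a.contMDiffOn_act_left rfl _ hone).mdifferentiableWithinAt (by simp))
      (fun g hg => a.proj_act _ _ hg) hY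
    have h2 := mfderivWithin_congr_point (E := E) (E' := ℂ) (fun z' => (μ z' : EG →ₗ[ℂ] ℂ) X)
      (T.proj ⁻¹' {T.proj z}) (a.one_act z)
    have h3 : (mfderivWithin 𝓘(ℂ, EG) 𝓘(ℂ) (fun g => (μ (a.act g z) : EG →ₗ[ℂ] ℂ) X)
        (𝒢.proj ⁻¹' {T.proj z}) (𝒢.one (T.proj z)) : EG →L[ℂ] ℂ) = 0 := by
      have h4 : mfderivWithin 𝓘(ℂ, EG) 𝓘(ℂ) (fun g => (μ (a.act g z) : EG →ₗ[ℂ] ℂ) X)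
        (𝒢.proj ⁻¹' {T.proj z}) (𝒢.one (T.proj z)) =
        mfderivWithin 𝓘(ℂ, EG) 𝓘(ℂ) (fun _ => (μ z : EG →ₗ[ℂ] ℂ) X)
        (𝒢.proj ⁻¹' {T.proj z}) (𝒢.one (T.proj z)) :=
        mfderivWithin_congr (fun g hg => hconst g hg) (hconst _ hone)
      exact h4.trans mfderivWithin_const
    exact (DFunLike.congr_fun h2 _).symm.trans (h1.symm.trans (DFunLike.congr_fun h3 Y))
  · rw [mfderivWithin_zero_of_not_mdifferentiableWithinAt hd]
    rfl

end

/-! ### Functions with values in `𝒪(1)` -/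

/-- The factor which converts the coordinate of a point in the fibre of `𝒪(1)` over `ζ` into its
coordinate in a trivialization of `𝒪(1)` defined near `p`. -/
def twist (p ζ : CP1) : ℂ :=
  open Classical in if p = OnePoint.infty then transition 1 ζ else 1

lemma twist_infty : twist OnePoint.infty = transition 1 := by
  funext ζ; simp [twist]

lemma twist_of_ne {p : CP1} (hp : p ≠ OnePoint.infty) : twist p = fun _ => 1 := by
  funext ζ; simp [twist, hp]

lemma twist_self (p : CP1) : twist p p = 1 := by
  by_cases hp : p = OnePoint.infty
  · subst hp; rw [twist_infty]; rfl
  · rw [twist_of_ne hp]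

lemma transition_ne_zero {ζ : CP1} (k : ℤ) (h : ζ ≠ ((0 : ℂ) : CP1)) : transition k ζ ≠ 0 := by
  induction ζ using OnePoint.rec with
  | infty => exact one_ne_zero
  | coe z => exact zpow_ne_zero _ fun hz => h (by rw [hz])

lemma transition_two (ζ : CP1) : transition 2 ζ = transition 1 ζ ^ 2 := by
  induction ζ using OnePoint.rec with
  | infty => simp [transition]
  | coe z => simp [transition, zpow_neg]

lemma isOpen_ne_infty : IsOpen ({OnePoint.infty}ᶜ : Set CP1) := isOpen_compl_singleton

lemma isOpen_ne_zero : IsOpen ({((0 : ℂ) : CP1)}ᶜ : Set CP1) := isOpen_compl_singleton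

lemma eventually_twist_ne_zero (p : CP1) : ∀ᶠ ζ in 𝓝 p, twist p ζ ≠ 0 := by
  by_cases hp : p = OnePoint.infty
  · subst hp
    filter_upwards [isOpen_ne_zero.mem_nhds (OnePoint.infty_ne_coe (0 : ℂ))] with ζ hζ
    rw [twist_infty]
    exact transition_ne_zero 1 hζ
  · simp [twist_of_ne hp]

/-- The transition function is holomorphic away from the points `0` and `∞`.  At `∞` it is not even
continuous, since the fibre of `𝒪(1)` over `∞` is identified with `ℂ` by another trivialization. -/
lemma holAt_transition {p : CP1} (h0 : p ≠ ((0 : ℂ) : CP1)) (h1 : p ≠ OnePoint.infty) :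
    HolAt (transition 1) p := by
  induction p using OnePoint.rec with
  | infty => exact absurd rfl h1
  | coe z =>
    have hz : z ≠ 0 := fun hz => h0 (by rw [hz])
    rw [holAt_coe_iff]
    have : (fun w : ℂ => transition 1 (w : CP1)) = fun w => w⁻¹ := by
      funext w; simp only [transition]; exact zpow_neg_one w
    rw [this]
    exact analyticAt_inv hz

section

variable {W : Type*} [NormedAddCommGroup W] [NormedSpace ℂ W]

/-- A `W ⊗ 𝒪(1)`-valued function on `ℂP¹` is holomorphic at a point. -/
def HolAtO1 (f : CP1 → W) (p : CP1) : Prop := HolAt (fun ζ => twist p ζ • f ζ) p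

lemma holAtO1_of_ne {f : CP1 → W} {p : CP1} (hp : p ≠ OnePoint.infty) :
    HolAtO1 f p ↔ HolAt f p := by
  simp [HolAtO1, twist_of_ne hp]

lemma HolAtO1.eventually {f : CP1 → W} {p : CP1} (hf : HolAtO1 f p) :
    ∀ᶠ ζ in 𝓝 p, HolAtO1 f ζ := by
  by_cases hp : p = OnePoint.infty
  · subst hp
    have h1 := HolAt.eventually hf
    filter_upwards [h1, isOpen_ne_zero.mem_nhds (OnePoint.infty_ne_coe (0 : ℂ))] with ζ h2 h3
    by_cases hζ : ζ = OnePoint.infty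
    · subst hζ; exact hf
    · rw [holAtO1_of_ne hζ]
      rw [twist_infty] at h2
      refine (((holAt_transition h3 hζ).inv (transition_ne_zero 1 h3)).smul h2).congr ?_
      filter_upwards [isOpen_ne_zero.mem_nhds h3] with ξ hξ
      rw [smul_smul, inv_mul_cancel₀ (transition_ne_zero 1 hξ), one_smul]
  · rw [holAtO1_of_ne hp] at hf
    filter_upwards [hf.eventually, isOpen_ne_infty.mem_nhds hp] with ζ h1 h2
    exact (holAtO1_of_ne h2).2 h1

lemma isHoloO_one_iff {h : CP1 → ℂ} {U : Set CP1} (hU : IsOpen U) :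
    IsHoloO (E := ℂ) 1 id h U ↔ ∀ p ∈ U, HolAtO1 h p := by
  constructor
  · rintro ⟨h1, h2⟩ p hp
    by_cases hp' : p = OnePoint.infty
    · subst hp'
      rw [HolAtO1, twist_infty]
      exact h2.contMDiffAt ((hU.inter isOpen_ne_zero).mem_nhds ⟨hp, OnePoint.infty_ne_coe (0 : ℂ)⟩)
    · rw [holAtO1_of_ne hp']
      exact h1.contMDiffAt ((hU.inter isOpen_ne_infty).mem_nhds ⟨hp, hp'⟩)
  · refine fun h1 => ⟨fun p hp => ?_, fun p hp => ?_⟩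
    · exact ((holAtO1_of_ne hp.2).1 (h1 p hp.1)).contMDiffWithinAt
    · by_cases hp' : p = OnePoint.infty
      · subst hp'
        have h2 := h1 _ hp.1
        rw [HolAtO1, twist_infty] at h2
        exact h2.contMDiffWithinAt
      · have h2 : HolAt (fun ζ => transition 1 ζ * h ζ) p :=
          (holAt_transition hp.2 hp').mul ((holAtO1_of_ne hp').1 (h1 p hp.1))
        exact h2.contMDiffWithinAt

/-- The pull-back of a holomorphic `𝒪(2)`-valued function by a section. -/
lemma IsHoloO.holAt_comp {E : Type*} [NormedAddCommGroup E] [NormedSpace ℂ E] {M : Type*}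
    [TopologicalSpace M] [ChartedSpace E M] {q : M → CP1} {h : M → ℂ} {U : Set M} (hU : IsOpen U)
    (hq : Continuous q) (hh : IsHoloO (E := E) 2 q h U) {s : CP1 → M} {p : CP1}
    (hs : ContMDiffAt 𝓘(ℂ) 𝓘(ℂ, E) ω s p) (hqs : ∀ ζ, q (s ζ) = ζ) (hp : s p ∈ U) :
    HolAt (fun ζ => twist p ζ ^ 2 * h (s ζ)) p := by
  by_cases hp' : p = OnePoint.infty
  · subst hp'
    have h1 := hh.2.contMDiffAt ((hU.inter (isOpen_ne_zero.preimage hq)).mem_nhds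
      ⟨hp, by simp [hqs]⟩)
    have h2 : HolAt (fun ζ => transition 2 (q (s ζ)) * h (s ζ)) _ := h1.comp _ hs
    rw [twist_infty]
    simpa only [hqs, transition_two] using h2
  · have h1 := hh.1.contMDiffAt ((hU.inter (isOpen_ne_infty.preimage hq)).mem_nhds
      ⟨hp, by simpa [hqs] using hp'⟩)
    have h2 : HolAt (fun ζ => h (s ζ)) p := h1.comp _ hs
    rw [twist_of_ne hp']
    simpa using h2

end

/-! ### Frames along a section -/

section

variable {E : Type*} [NormedAddCommGroup E] [NormedSpace ℂ E]
  {Z : Type*} [TopologicalSpace Z] [ChartedSpace E Z] [IsManifold 𝓘(ℂ, E) ω Z]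

/-- A vector field along `s` is holomorphic at a point, as a map to the tangent bundle. -/
abbrev HolAlongAt (s : CP1 → Z) (σ : ∀ ζ, TangentSpace 𝓘(ℂ, E) (s ζ)) (p : CP1) : Prop :=
  ContMDiffAt 𝓘(ℂ) 𝓘(ℂ, E).tangent ω (fun ζ => (⟨s ζ, σ ζ⟩ : TangentBundle 𝓘(ℂ, E) Z)) p

lemma HolAlongAt.eventually {s : CP1 → Z} {σ : ∀ ζ, TangentSpace 𝓘(ℂ, E) (s ζ)} {p : CP1}
    (h : HolAlongAt s σ p) : ∀ᶠ ζ in 𝓝 p, HolAlongAt s σ ζ :=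
  (contMDiffAt_iff_contMDiffAt_nhds (by simp)).1 h

lemma isHoloAlong_iff {s : CP1 → Z} {σ : ∀ ζ, TangentSpace 𝓘(ℂ, E) (s ζ)} {U : Set CP1}
    (hU : IsOpen U) : IsHoloAlong s σ U ↔ ∀ p ∈ U, HolAlongAt s σ p :=
  ⟨fun h _ hp => h.contMDiffAt (hU.mem_nhds hp), fun h p hp => (h p hp).contMDiffWithinAt⟩

/-- The linear maps `Ψ ζ` identify `ℂᵐ ⊗ 𝒪(1)` with the normal bundle of the section `s`, as
holomorphic vector bundles. -/
structure IsNormalFrame (S : RealSpace E Z) (s : CP1 → Z) {m : ℕ}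
    (Ψ : ∀ ζ, (Fin m → ℂ) →ₗ[ℂ] TangentSpace 𝓘(ℂ, E) (s ζ)) : Prop where
  injective : ∀ ζ, Function.Injective (Ψ ζ)
  range_eq : ∀ ζ, LinearMap.range (Ψ ζ) = S.vert (s ζ)
  holAlongAt_iff : ∀ (f : CP1 → Fin m → ℂ) (p : CP1),
    HolAlongAt s (fun ζ => Ψ ζ (f ζ)) p ↔ HolAtO1 f p

lemma holAtO1_pi {m : ℕ} {f : CP1 → Fin m → ℂ} {p : CP1} :
    HolAtO1 f p ↔ ∀ i, HolAtO1 (fun ζ => f ζ i) p :=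
  holAt_pi

/-- The normal bundle of a twistor section is the quotient of the vertical tangent bundle by zero, so
that a holomorphic section of it has only one lift. -/
lemma RealSpace.IsTwistorSection.exists_normalFrame {S : RealSpace E Z} {s : CP1 → Z}
    (hs : S.IsTwistorSection s) :
    ∃ (m : ℕ) (Ψ : ∀ ζ, (Fin m → ℂ) →ₗ[ℂ] TangentSpace 𝓘(ℂ, E) (s ζ)), IsNormalFrame S s Ψ := by
  obtain ⟨m, φ, hφ⟩ := hs.normal
  let A : ∀ ζ, Submodule ℂ (TangentSpace 𝓘(ℂ, E) (s ζ)) := fun ζ => S.vert (s ζ)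
  let B : ∀ ζ, Submodule ℂ (TangentSpace 𝓘(ℂ, E) (s ζ)) := fun _ => ⊥
  let q : ∀ ζ, A ζ →ₗ[ℂ] QuotFiber A B ζ := fun ζ => ((B ζ).submoduleOf (A ζ)).mkQ
  have hq : ∀ ζ, Function.Bijective (q ζ) := fun ζ => by
    refine ⟨?_, Submodule.mkQ_surjective _⟩
    rw [← LinearMap.ker_eq_bot, Submodule.ker_mkQ]
    exact (Submodule.eq_bot_iff _).2 fun x hx => Subtype.ext hx
  let Φ : ∀ ζ, A ζ ≃ₗ[ℂ] (Fin m → ℂ) := fun ζ => (LinearEquiv.ofBijective (q ζ) (hq ζ)).trans (φ ζ)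
  have hΦ : ∀ ζ x, φ ζ (q ζ ((Φ ζ).symm x)) = x := fun ζ x => (Φ ζ).apply_symm_apply x
  have hU : ∀ (f : CP1 → Fin m → ℂ) (U : Set CP1), IsOpen U →
      ((∀ p ∈ U, HolAlongAt s (fun ζ => ((Φ ζ).symm (f ζ) : TangentSpace 𝓘(ℂ, E) (s ζ))) p) ↔
        ∀ p ∈ U, HolAtO1 f p) := by
    intro f U hU
    have h1 := hφ U hU fun ζ => q ζ ((Φ ζ).symm (f ζ))
    have h2 : (∀ i, IsHoloO (E := ℂ) 1 id (fun ζ => φ ζ (q ζ ((Φ ζ).symm (f ζ))) i) U) ↔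
        ∀ p ∈ U, HolAtO1 f p := by
      simp only [hΦ, isHoloO_one_iff hU, holAtO1_pi]
      exact ⟨fun h p hp i => h i p hp, fun h i p hp => h p hp i⟩
    rw [← h2, ← h1]
    constructor
    · exact fun h p hp => ⟨U, hU, hp, subset_rfl, fun ζ => (Φ ζ).symm (f ζ),
        (isHoloAlong_iff hU).2 h, fun ζ _ => rfl⟩
    · intro h p hp
      obtain ⟨V, hV, hpV, -, σ, hσ, hσq⟩ := h p hp
      refine ((isHoloAlong_iff hV).1 hσ p hpV).congr_of_eventuallyEq ?_
      filter_upwards [hV.mem_nhds hpV] with ζ hζ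
      rw [(hq ζ).1 (hσq ζ hζ)]
  refine ⟨m, fun ζ => (A ζ).subtype ∘ₗ (Φ ζ).symm.toLinearMap, fun ζ => ?_, fun ζ => ?_,
    fun f p => ⟨fun h => ?_, fun h => ?_⟩⟩
  · exact Subtype.val_injective.comp (Φ ζ).symm.injective
  · rw [LinearMap.range_comp, LinearEquiv.range, Submodule.map_top, Submodule.range_subtype]
  · obtain ⟨U, hU1, hU2, hU3⟩ := eventually_nhds_iff.1 (HolAlongAt.eventually h)
    exact (hU f U hU2).1 hU1 p hU3
  · obtain ⟨U, hU1, hU2, hU3⟩ := eventually_nhds_iff.1 h.eventually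
    exact (hU f U hU2).2 hU1 p hU3

/-- The vector fields `e i` along `s`, with values in `A`, represent a global holomorphic frame of
the bundle `(A / B) ⊗ 𝒪(-1)`. -/
structure IsFrameO1 {ι : Type*} [Fintype ι] (s : CP1 → Z)
    (A B : ∀ ζ, Submodule ℂ (TangentSpace 𝓘(ℂ, E) (s ζ)))
    (e : ι → ∀ ζ, TangentSpace 𝓘(ℂ, E) (s ζ)) : Prop where
  holomorphic : ∀ i p, ∃ σ : ∀ ζ, TangentSpace 𝓘(ℂ, E) (s ζ), (∀ ζ, σ ζ ∈ A ζ) ∧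
    HolAlongAt s σ p ∧ ∀ᶠ ζ in 𝓝 p, twist p ζ • σ ζ - e i ζ ∈ B ζ
  mem : ∀ i ζ, e i ζ ∈ A ζ
  indep : ∀ ζ (x : ι → ℂ), ∑ i, x i • e i ζ ∈ B ζ → x = 0
  span : ∀ ζ, ∀ v ∈ A ζ, ∃ x : ι → ℂ, v - ∑ i, x i • e i ζ ∈ B ζ

/-- The preimages of the standard basis vectors represent a frame. -/
lemma IsSumOfO.exists_frame {s : CP1 → Z} {A B : ∀ ζ, Submodule ℂ (TangentSpace 𝓘(ℂ, E) (s ζ))}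
    (h : IsSumOfO 1 s A B) :
    ∃ (r : ℕ) (e : Fin r → ∀ ζ, TangentSpace 𝓘(ℂ, E) (s ζ)), IsFrameO1 s A B e := by
  obtain ⟨r, φ, hφ⟩ := h
  let q : ∀ ζ, A ζ →ₗ[ℂ] QuotFiber A B ζ := fun ζ => ((B ζ).submoduleOf (A ζ)).mkQ
  have hq : ∀ ζ (x : A ζ), q ζ x = 0 ↔ (x : TangentSpace 𝓘(ℂ, E) (s ζ)) ∈ B ζ := fun ζ x =>
    Submodule.Quotient.mk_eq_zero _
  have hqs : ∀ ζ, Function.Surjective (q ζ) := fun ζ => Submodule.mkQ_surjective _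
  choose e he using fun (i : Fin r) ζ => hqs ζ ((φ ζ).symm (Pi.single i 1))
  have hsum : ∀ ζ (x : Fin r → ℂ), q ζ (∑ i, x i • e i ζ) = (φ ζ).symm x := by
    intro ζ x
    rw [map_sum]
    simp only [map_smul, he]
    have hx : x = ∑ i, x i • (Pi.single i 1 : Fin r → ℂ) := by
      funext j
      simp [Finset.sum_apply, Pi.single_apply]
    conv_rhs => rw [hx, map_sum]
    simp only [map_smul]
  refine ⟨r, fun i ζ => e i ζ, fun i p => ?_, fun i ζ => (e i ζ).2, fun ζ x hx => ?_,
    fun ζ v hv => ?_⟩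
  -- the section `(twist p)⁻¹` of `𝒪(1)` has the coordinate `1` near `p`
  · have h1 : HolAtO1 (fun ζ => (twist p ζ)⁻¹ • (Pi.single i 1 : Fin r → ℂ)) p := by
      refine HolAt.congr (HolAt.const (Pi.single i 1 : Fin r → ℂ)) ?_
      filter_upwards [eventually_twist_ne_zero p] with ζ hζ
      rw [smul_smul, mul_inv_cancel₀ hζ, one_smul]
    obtain ⟨U, hU1, hU2, hU3⟩ := eventually_nhds_iff.1 h1.eventually
    obtain ⟨V, hV, hpV, -, σ, hσ, hσq⟩ := (hφ U hU2 fun ζ =>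
      (φ ζ).symm ((twist p ζ)⁻¹ • (Pi.single i 1 : Fin r → ℂ))).2 (fun j => by
        rw [isHoloO_one_iff hU2]
        intro ζ hζ
        simp only [LinearEquiv.apply_symm_apply]
        exact holAtO1_pi.1 (hU1 ζ hζ) j) p hU3
    refine ⟨fun ζ => σ ζ, fun ζ => (σ ζ).2, (isHoloAlong_iff hV).1 hσ p hpV, ?_⟩
    filter_upwards [hV.mem_nhds hpV, eventually_twist_ne_zero p] with ζ hζ h2
    have h3 : q ζ (twist p ζ • σ ζ - e i ζ) = 0 := by
      have h4 : q ζ (σ ζ) = (φ ζ).symm ((twist p ζ)⁻¹ • (Pi.single i 1 : Fin r → ℂ)) := hσq ζ hζ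
      rw [map_sub, map_smul, he, h4, map_smul, smul_smul, mul_inv_cancel₀ h2, one_smul, sub_self]
    exact (hq ζ _).1 h3
  · have h1 : q ζ (∑ i, x i • e i ζ) = 0 := (hq ζ _).2 (by simpa using hx)
    rw [hsum] at h1
    simpa using h1
  · refine ⟨φ ζ (q ζ ⟨v, hv⟩), ?_⟩
    have h1 : q ζ (⟨v, hv⟩ - ∑ i, φ ζ (q ζ ⟨v, hv⟩) i • e i ζ) = 0 := by
      rw [map_sub, hsum, LinearEquiv.symm_apply_apply, sub_self]
    simpa using (hq ζ _).1 h1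

variable {S : RealSpace E Z} {s : CP1 → Z} {m : ℕ}
  {Ψ : ∀ ζ, (Fin m → ℂ) →ₗ[ℂ] TangentSpace 𝓘(ℂ, E) (s ζ)}
  {A B : ∀ ζ, Submodule ℂ (TangentSpace 𝓘(ℂ, E) (s ζ))}

lemma IsNormalFrame.exists_eq (hΨ : IsNormalFrame S s Ψ) {σ : ∀ ζ, TangentSpace 𝓘(ℂ, E) (s ζ)}
    (hσ : ∀ ζ, σ ζ ∈ S.vert (s ζ)) : ∃ f : CP1 → Fin m → ℂ, ∀ ζ, Ψ ζ (f ζ) = σ ζ := by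
  choose f hf using fun ζ => LinearMap.mem_range.1 ((hΨ.range_eq ζ).symm ▸ hσ ζ)
  exact ⟨f, hf⟩

/-- The twists by `𝒪(-1)` in a frame of `(A / B) ⊗ 𝒪(-1)` and by `𝒪(1)` in a frame of the normal
bundle cancel. -/
lemma IsFrameO1.exists_isQuotFrame {ι : Type*} [Fintype ι]
    {e : ι → ∀ ζ, TangentSpace 𝓘(ℂ, E) (s ζ)} (he : IsFrameO1 s A B e) (hΨ : IsNormalFrame S s Ψ)
    (hA : ∀ ζ, A ζ ≤ S.vert (s ζ)) :
    ∃ f : ι → CP1 → Fin m → ℂ, IsQuotFrame (fun ζ => (A ζ).comap (Ψ ζ))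
      (fun ζ => (B ζ).comap (Ψ ζ)) f := by
  choose f hf using fun i => hΨ.exists_eq fun ζ => hA ζ (he.mem i ζ)
  have hsum : ∀ ζ (x : ι → ℂ), Ψ ζ (∑ i, x i • f i ζ) = ∑ i, x i • e i ζ := fun ζ x => by
    simp only [map_sum, map_smul, hf]
  refine ⟨f, fun i p => ?_, fun i ζ => ?_, fun ζ x hx => ?_, fun ζ v hv => ?_⟩
  · obtain ⟨σ, hσA, hσ, hσe⟩ := he.holomorphic i p
    obtain ⟨g, hg⟩ := hΨ.exists_eq fun ζ => hA ζ (hσA ζ)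
    refine ⟨fun ζ => twist p ζ • g ζ, (hΨ.holAlongAt_iff g p).1 (by simpa only [hg] using hσ), ?_⟩
    filter_upwards [hσe] with ζ hζ
    simp only [Submodule.mem_comap, map_sub, map_smul, hg, hf]
    exact ⟨Submodule.smul_mem _ _ (hσA ζ), hζ⟩
  · simpa only [Submodule.mem_comap, hf] using he.mem i ζ
  · exact he.indep ζ x (by simpa only [Submodule.mem_comap, hsum] using hx)
  · obtain ⟨x, hx⟩ := he.span ζ _ hv
    exact ⟨x, by simpa only [Submodule.mem_comap, map_sub, hsum] using hx⟩

/-- A frame of `A / B`, in terms of a frame of the normal bundle, exhibits `A / B` as a direct sum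
of copies of `𝒪(1)`. -/
lemma IsQuotFrame.isSumOfO {κ : Type*} [Fintype κ] {g : κ → CP1 → Fin m → ℂ}
    (hg : IsQuotFrame (fun ζ => (A ζ).comap (Ψ ζ)) (fun ζ => (B ζ).comap (Ψ ζ)) g)
    (hΨ : IsNormalFrame S s Ψ) (hA : ∀ ζ, A ζ ≤ S.vert (s ζ))
    (hB : IsSubbundle fun ζ => (B ζ).comap (Ψ ζ)) : IsSumOfO 1 s A B := by
  classical
  let ε := Fintype.equivFin κ
  let q : ∀ ζ, A ζ →ₗ[ℂ] QuotFiber A B ζ := fun ζ => ((B ζ).submoduleOf (A ζ)).mkQ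
  have hq : ∀ ζ (x : A ζ), q ζ x = 0 ↔ (x : TangentSpace 𝓘(ℂ, E) (s ζ)) ∈ B ζ := fun ζ x =>
    Submodule.Quotient.mk_eq_zero _
  let u : ∀ (i : κ) ζ, A ζ := fun i ζ => ⟨Ψ ζ (g i ζ), hg.mem i ζ⟩
  -- the combinations of the frame; `θ ζ` is the inverse of the required isomorphism
  let θ : ∀ ζ, (Fin (Fintype.card κ) → ℂ) →ₗ[ℂ] QuotFiber A B ζ := fun ζ =>
    (q ζ).comp (Fintype.linearCombination ℂ fun j => u (ε.symm j) ζ)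
  have hcomb : ∀ ζ (x : Fin (Fintype.card κ) → ℂ),
      ((Fintype.linearCombination ℂ (fun j => u (ε.symm j) ζ) x : A ζ) :
        TangentSpace 𝓘(ℂ, E) (s ζ)) = Ψ ζ (∑ i, x (ε i) • g i ζ) := by
    intro ζ x
    rw [Fintype.linearCombination_apply, map_sum, Submodule.coe_sum,
      ← Equiv.sum_comp ε]
    simp [u]
  have hθ : ∀ ζ, Function.Bijective (θ ζ) := by
    refine fun ζ => ⟨(injective_iff_map_eq_zero _).2 fun x hx => ?_, fun y => ?_⟩
    · have h1 := (hq ζ _).1 hx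
      rw [hcomb] at h1
      have h2 := hg.indep ζ _ h1
      funext j
      simpa using congrFun h2 (ε.symm j)
    · obtain ⟨⟨v, hv⟩, rfl⟩ := Submodule.mkQ_surjective _ y
      obtain ⟨w, rfl⟩ := LinearMap.mem_range.1 ((hΨ.range_eq ζ).symm ▸ hA ζ hv)
      obtain ⟨x, hx⟩ := hg.span ζ w hv
      refine ⟨fun j => x (ε.symm j), ?_⟩
      rw [← sub_eq_zero, ← neg_eq_zero, neg_sub]
      change q ζ _ - q ζ _ = 0
      rw [← map_sub, hq, Submodule.coe_sub, hcomb, ← map_sub]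
      simpa using hx
  let φ : ∀ ζ, QuotFiber A B ζ ≃ₗ[ℂ] (Fin (Fintype.card κ) → ℂ) := fun ζ =>
    (LinearEquiv.ofBijective (θ ζ) (hθ ζ)).symm
  have hφ : ∀ ζ (v : A ζ) (f : Fin m → ℂ), Ψ ζ f = v →
      f - ∑ i, φ ζ (q ζ v) (ε i) • g i ζ ∈ (B ζ).comap (Ψ ζ) := by
    intro ζ v f hf
    have h1 : θ ζ (φ ζ (q ζ v)) = q ζ v :=
      (LinearEquiv.ofBijective (θ ζ) (hθ ζ)).apply_symm_apply _
    have h2 : q ζ (v - Fintype.linearCombination ℂ (fun j => u (ε.symm j) ζ) (φ ζ (q ζ v))) = 0 := by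
      rw [map_sub, sub_eq_zero]
      exact h1.symm
    rw [hq, Submodule.coe_sub, hcomb, ← hf, ← map_sub] at h2
    exact h2
  refine ⟨Fintype.card κ, φ, fun U hU ρ => ⟨fun h => ?_, fun h p hp => ?_⟩⟩
  · intro j
    rw [isHoloO_one_iff hU]
    intro p hp
    obtain ⟨V, hV, hpV, -, σ, hσ, hσq⟩ := h p hp
    obtain ⟨f, hf⟩ := hΨ.exists_eq fun ζ => hA ζ (σ ζ).2
    have h1 : HolAtO1 f p := (hΨ.holAlongAt_iff f p).1 (by
      simpa only [hf] using (isHoloAlong_iff hV).1 hσ p hpV)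
    obtain ⟨c, hc, hcB⟩ := hg.exists_holAt_coeff hB h1 (Filter.Eventually.of_forall fun ζ => by
      rw [Submodule.mem_comap, map_smul, hf]
      exact Submodule.smul_mem _ _ (σ ζ).2)
    refine (hc (ε.symm j)).congr ?_
    filter_upwards [hcB, hV.mem_nhds hpV] with ζ h2 h3
    have h4 := Submodule.smul_mem _ (twist p ζ) (hφ ζ (σ ζ) (f ζ) (hf ζ))
    have h5 := hg.indep ζ (fun i => c i ζ - twist p ζ * φ ζ (ρ ζ) (ε i)) (by
      have h6 := Submodule.sub_mem _ h4 h2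
      have h7 : q ζ (σ ζ) = ρ ζ := hσq ζ h3
      rw [h7] at h6
      convert h6 using 1
      simp only [sub_smul, Finset.sum_sub_distrib, smul_sub, Finset.smul_sum, mul_smul]
      abel)
    have h6 := congrFun h5 (ε.symm j)
    simp only [Equiv.apply_symm_apply, Pi.zero_apply, sub_eq_zero] at h6
    rw [smul_eq_mul, h6]
  · choose g' hg' hgm using fun i => hg.holomorphic i p
    have hx : ∀ i, HolAtO1 (fun ζ => φ ζ (ρ ζ) (ε i)) p := fun i =>
      (isHoloO_one_iff hU).1 (h (ε i)) p hp
    let f₀ : CP1 → Fin m → ℂ := fun ζ => ∑ i, φ ζ (ρ ζ) (ε i) • g' i ζ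
    have hf₀ : HolAtO1 f₀ p := by
      have h1 : HolAt (fun ζ => ∑ i, (twist p ζ * φ ζ (ρ ζ) (ε i)) • g' i ζ) p :=
        HolAt.sum fun i _ => (hx i).smul (hg' i)
      refine h1.congr (Filter.Eventually.of_forall fun ζ => ?_)
      simp only [f₀, Finset.smul_sum, mul_smul]
    have hev : ∀ᶠ ζ in 𝓝 p, (∀ i, g' i ζ ∈ (A ζ).comap (Ψ ζ) ∧
        g' i ζ - g i ζ ∈ (B ζ).comap (Ψ ζ)) ∧ HolAtO1 f₀ ζ ∧ ζ ∈ U :=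
      (Filter.eventually_all.2 hgm).and (hf₀.eventually.and (hU.mem_nhds hp))
    obtain ⟨V, hV1, hV, hpV⟩ := eventually_nhds_iff.1 hev
    -- away from `V`, where `f₀` need not take values in `A`, the lift is irrelevant and set to zero
    let σ : ∀ ζ, A ζ := fun ζ => if hζ : ζ ∈ V then ⟨Ψ ζ (f₀ ζ), by
      rw [map_sum]
      exact Submodule.sum_mem _ fun i _ => by
        rw [map_smul]
        exact Submodule.smul_mem _ _ ((hV1 ζ hζ).1 i).1⟩ else 0
    have hσ : ∀ ζ ∈ V, (σ ζ : TangentSpace 𝓘(ℂ, E) (s ζ)) = Ψ ζ (f₀ ζ) := fun ζ hζ => by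
      simp only [σ, hζ, dif_pos]
    refine ⟨V, hV, hpV, fun ζ hζ => (hV1 ζ hζ).2.2, σ, (isHoloAlong_iff hV).2 fun ζ hζ => ?_,
      fun ζ hζ => ?_⟩
    · refine ((hΨ.holAlongAt_iff f₀ ζ).2 (hV1 ζ hζ).2.1).congr_of_eventuallyEq ?_
      filter_upwards [hV.mem_nhds hζ] with ξ hξ
      rw [hσ ξ hξ]
    · have h1 : θ ζ (φ ζ (ρ ζ)) = ρ ζ :=
        (LinearEquiv.ofBijective (θ ζ) (hθ ζ)).apply_symm_apply _
      rw [← h1, ← sub_eq_zero]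
      change q ζ _ - q ζ _ = 0
      rw [← map_sub, hq, Submodule.coe_sub, hcomb, hσ ζ hζ, ← map_sub, ← Finset.sum_sub_distrib,
        map_sum]
      refine Submodule.sum_mem _ fun i _ => ?_
      rw [← smul_sub, map_smul]
      exact Submodule.smul_mem _ _ ((hV1 ζ hζ).1 i).2

end

/-! ### The bundles generated by twistor groups, and the symplectic form, along a section -/

section

variable {E : Type*} [NormedAddCommGroup E] [NormedSpace ℂ E]
  {Z : Type*} [TopologicalSpace Z] [ChartedSpace E Z] [IsManifold 𝓘(ℂ, E) ω Z]
  {EG : Type*} [NormedAddCommGroup EG] [NormedSpace ℂ EG]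
  {G : Type*} [TopologicalSpace G] [ChartedSpace EG G] [IsManifold 𝓘(ℂ, EG) ω G]
  {EH : Type*} [NormedAddCommGroup EH] [NormedSpace ℂ EH]
  {H : Type*} [TopologicalSpace H] [ChartedSpace EH H] [IsManifold 𝓘(ℂ, EH) ω H]
  {𝒢 : TwistorGroup EG G} {ℋ : TwistorGroup EH H} {S : RealSpace E Z} {ι : H → G}
  {a : TwistorAction 𝒢 S} {s : CP1 → Z} {m : ℕ}
  {Ψ : ∀ ζ, (Fin m → ℂ) →ₗ[ℂ] TangentSpace 𝓘(ℂ, E) (s ζ)}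

/-- The map `g ↦ g · s(p(g))` on the whole group, whose vertical differential along the unit section
is the infinitesimal action. -/
lemma TwistorAction.contMDiff_orbit (a : TwistorAction 𝒢 S) (hs : ContMDiff 𝓘(ℂ) 𝓘(ℂ, E) ω s)
    (hps : ∀ ζ, S.proj (s ζ) = ζ) :
    ContMDiff 𝓘(ℂ, EG) 𝓘(ℂ, E) ω fun g => a.act g (s (𝒢.proj g)) := by
  rw [← contMDiffOn_univ]
  refine a.holomorphic.comp (t := {q : G × Z | 𝒢.proj q.1 = S.proj q.2})
    (f := fun g => (g, s (𝒢.proj g)))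
    (contMDiff_id.prodMk (hs.comp 𝒢.contMDiff_proj)).contMDiffOn fun g _ => ?_
  simp [hps]

lemma TwistorAction.holAlongAt_infAct (a : TwistorAction 𝒢 S)
    (hs : ContMDiff 𝓘(ℂ) 𝓘(ℂ, E) ω s) (hps : ∀ ζ, S.proj (s ζ) = ζ)
    {X : ∀ ζ, TangentSpace 𝓘(ℂ, EG) (𝒢.one ζ)} (hX : ∀ ζ, X ζ ∈ 𝒢.lie ζ) {p : CP1}
    (hXp : HolAlongAt 𝒢.one X p) : HolAlongAt s (fun ζ => a.infAct ζ (s ζ) (X ζ)) p := by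
  let f : G → Z := fun g => a.act g (s (𝒢.proj g))
  have hf : ContMDiff 𝓘(ℂ, EG) 𝓘(ℂ, E) ω f := a.contMDiff_orbit hs hps
  have h1 : ContMDiff 𝓘(ℂ, EG).tangent 𝓘(ℂ, E).tangent ω (tangentMap 𝓘(ℂ, EG) 𝓘(ℂ, E) f) :=
    hf.contMDiff_tangentMap le_rfl
  have h2 := h1.contMDiffAt.comp p hXp
  refine h2.congr_of_eventuallyEq (Filter.Eventually.of_forall fun ζ => ?_)
  have hone : 𝒢.proj (𝒢.one ζ) = ζ := 𝒢.proj_one ζ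
  have hbase : f (𝒢.one ζ) = s ζ := by
    have := a.one_act (s ζ)
    rw [hps] at this
    simp only [f, hone, this]
  have hder : (mfderiv 𝓘(ℂ, EG) 𝓘(ℂ, E) f (𝒢.one ζ) (X ζ) : E) = a.infAct ζ (s ζ) (X ζ) := by
    have h3 := (hf.contMDiffAt (x := 𝒢.one ζ)).mdifferentiableAt (by simp)
    have h4 := eq_on_vert_of_hasMFDerivWithinAt 𝒢.toRealSpace
      (h3.mdifferentiableWithinAt (s := 𝒢.proj ⁻¹' {𝒢.proj (𝒢.one ζ)})).hasMFDerivWithinAt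
      h3.hasMFDerivAt.hasMFDerivWithinAt (hX ζ)
    rw [hone] at h4
    have h5 : (mfderivWithin 𝓘(ℂ, EG) 𝓘(ℂ, E) f (𝒢.proj ⁻¹' {ζ}) (𝒢.one ζ) : EG →L[ℂ] E) =
        a.infAct ζ (s ζ) :=
      mfderivWithin_congr (fun g hg => by
        have hg' : 𝒢.proj g = ζ := hg
        simp only [f, hg']) (by simp only [f, hone])
    exact h4.symm.trans (DFunLike.congr_fun h5 (X ζ))
  exact (tangentBundle_mk_congr hbase _).trans (by rw [hder]) |>.symm

lemma TwistorAction.generated_le_vert (a : TwistorAction 𝒢 S) (hps : ∀ ζ, S.proj (s ζ) = ζ)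
    (ζ : CP1) : a.generated s ζ ≤ S.vert (s ζ) := by
  rintro _ ⟨X, hX, rfl⟩
  exact a.infAct_mem_vert (hps ζ) hX

/-- A locally free action generates a holomorphic subbundle of the normal bundle. -/
lemma TwistorAction.LocallyFree.isSubbundle_generated [FiniteDimensional ℂ EG]
    (ha : a.LocallyFree) (hs : ContMDiff 𝓘(ℂ) 𝓘(ℂ, E) ω s) (hps : ∀ ζ, S.proj (s ζ) = ζ)
    (hΨ : IsNormalFrame S s Ψ) : IsSubbundle fun ζ => (a.generated s ζ).comap (Ψ ζ) := by
  have hfin : ∀ ζ, FiniteDimensional ℂ (𝒢.lie ζ) := fun ζ => by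
    have : FiniteDimensional ℂ (TangentSpace 𝓘(ℂ, EG) (𝒢.one ζ)) :=
      inferInstanceAs (FiniteDimensional ℂ EG)
    infer_instance
  intro p
  -- a local frame of `Lie(𝒢)` is mapped to a local frame; it spans since the ranks agree
  let b := Module.finBasis ℂ (𝒢.lie p)
  choose U V hUo hpU hV hVp hVU using fun j => exists_vertical_extension 𝒢.toRealSpace (b j).2
  have hone : ContMDiff 𝓘(ℂ) 𝓘(ℂ, EG) ω 𝒢.one := 𝒢.holomorphic_one
  have hX : ∀ j, HolAlongAt 𝒢.one (fun ζ => V j (𝒢.one ζ)) p := fun j =>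
    ((hVU j).contMDiffAt ((hUo j).mem_nhds (hpU j))).comp p hone.contMDiffAt
  choose f hf using fun j => hΨ.exists_eq fun ζ =>
    a.infAct_mem_vert (hps ζ) (X := V j (𝒢.one ζ)) (hV j (𝒢.one ζ))
  have hfO : ∀ j, HolAtO1 (f j) p := fun j => (hΨ.holAlongAt_iff (f j) p).1 (by
    simpa only [hf] using a.holAlongAt_infAct hs hps (fun ζ => hV j (𝒢.one ζ)) (hX j))
  have hli : LinearIndependent ℂ fun j => twist p p • f j p := by
    have h1 : LinearIndependent ℂ fun j => a.infAct p (s p) (b j) := by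
      have h2 := b.linearIndependent.map' ((a.infAct p (s p)).toLinearMap ∘ₗ (𝒢.lie p).subtype) (by
        rw [LinearMap.ker_eq_bot']
        exact fun x hx => Subtype.ext (ha.eq_zero_of_infAct_eq_zero (hps p) x.2 hx))
      exact h2
    refine LinearIndependent.of_comp (Ψ p) ?_
    convert h1 using 2 with j
    simp only [Function.comp, twist_self, one_smul, hf, hVp]
  refine ⟨_, fun j ζ => twist p ζ • f j ζ, hfO, hli, ?_⟩
  filter_upwards [eventually_linearIndependent hfO hli] with ζ hζ
  refine Submodule.eq_of_le_of_finrank_le (Submodule.span_le.2 ?_) ?_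
  · rintro _ ⟨j, rfl⟩
    change Ψ ζ (twist p ζ • f j ζ) ∈ a.generated s ζ
    rw [map_smul, hf]
    exact Submodule.smul_mem _ _ (Submodule.mem_map_of_mem (hV j (𝒢.one ζ)))
  · rw [finrank_span_eq_card hζ, Fintype.card_fin]
    have h1 : Module.finrank ℂ ((a.generated s ζ).comap (Ψ ζ)) ≤
        Module.finrank ℂ (a.generated s ζ) := by
      have : FiniteDimensional ℂ (a.generated s ζ) := by
        unfold TwistorAction.generated
        have := hfin ζ
        infer_instance
      exact LinearMap.finrank_le_finrank_of_injective
        (f := (Ψ ζ).restrict (p := (a.generated s ζ).comap (Ψ ζ)) (q := a.generated s ζ) fun x hx => hx)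
        fun x y hxy => Subtype.ext (hΨ.injective ζ (congrArg Subtype.val hxy))
    have h2 : Module.finrank ℂ (a.generated s ζ) ≤ Module.finrank ℂ (𝒢.lie ζ) := by
      have := hfin ζ
      exact Submodule.finrank_map_le _ _
    have h3 := 𝒢.finrank_vert (𝒢.one ζ)
    have h4 := 𝒢.finrank_vert (𝒢.one p)
    have h5 : Module.finrank ℂ (𝒢.lie ζ) = Module.finrank ℂ (𝒢.lie p) := by
      change Module.finrank ℂ (𝒢.vert (𝒢.one ζ)) = Module.finrank ℂ (𝒢.vert (𝒢.one p))
      omega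
    exact (h1.trans h2).trans h5.le

lemma IsTwistorSubgroup.generated_restrict (hι : IsTwistorSubgroup ℋ 𝒢 ι) (a : TwistorAction 𝒢 S)
    (hps : ∀ ζ, S.proj (s ζ) = ζ) (ζ : CP1) :
    (a.restrict hι).generated s ζ =
      (lieImage ℋ 𝒢 ι ζ).map (a.infAct ζ (s ζ)).toLinearMap := by
  ext v
  constructor
  · rintro ⟨X, hX, rfl⟩
    exact ⟨_, ⟨X, hX, rfl⟩, (hι.infAct_restrict a (hps ζ) hX).symm⟩
  · rintro ⟨_, ⟨X, hX, rfl⟩, rfl⟩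
    exact ⟨X, hX, hι.infAct_restrict a (hps ζ) hX⟩

/-- The infinitesimal action identifies `Lie(𝒢) / Lie(ℋ)` with the quotient of the generated
subbundles. -/
lemma IsTwistorSubgroup.isFrameO1_generated [FiniteDimensional ℂ EG]
    (hι : IsTwistorSubgroup ℋ 𝒢 ι) (ha : a.LocallyFree) (hs : ContMDiff 𝓘(ℂ) 𝓘(ℂ, E) ω s)
    (hps : ∀ ζ, S.proj (s ζ) = ζ) {κ : Type*} [Fintype κ]
    {e : κ → ∀ ζ, TangentSpace 𝓘(ℂ, EG) (𝒢.one ζ)}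
    (he : IsFrameO1 𝒢.one 𝒢.lie (lieImage ℋ 𝒢 ι) e) :
    IsFrameO1 s (a.generated s) ((a.restrict hι).generated s)
      fun i ζ => a.infAct ζ (s ζ) (e i ζ) := by
  have hsum : ∀ ζ (x : κ → ℂ), ∑ i, x i • a.infAct ζ (s ζ) (e i ζ) =
      a.infAct ζ (s ζ) (∑ i, x i • e i ζ) := fun ζ x => by simp only [map_sum, map_smul]
  refine ⟨fun i p => ?_, fun i ζ => Submodule.mem_map_of_mem (he.mem i ζ), fun ζ x hx => ?_,
    fun ζ v hv => ?_⟩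
  · obtain ⟨σ, hσ, hσp, hσe⟩ := he.holomorphic i p
    refine ⟨_, fun ζ => Submodule.mem_map_of_mem (hσ ζ), a.holAlongAt_infAct hs hps hσ hσp, ?_⟩
    filter_upwards [hσe] with ζ hζ
    rw [hι.generated_restrict a hps]
    refine ⟨_, hζ, ?_⟩
    simp
  · rw [hι.generated_restrict a hps, hsum] at hx
    obtain ⟨w, hw, hwx⟩ := hx
    refine he.indep ζ x ?_
    have hwl : w ∈ 𝒢.lie ζ := by
      obtain ⟨X, hX, rfl⟩ := hw
      exact hι.lieIncl_mem hX
    have h1 : (∑ i, x i • e i ζ) - w = 0 := by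
      refine ha.eq_zero_of_infAct_eq_zero (hps ζ) (Submodule.sub_mem _ (Submodule.sum_mem _
        fun i _ => Submodule.smul_mem _ _ (he.mem i ζ)) hwl) ?_
      rw [map_sub, sub_eq_zero]
      exact hwx.symm
    rw [sub_eq_zero.1 h1]
    exact hw
  · obtain ⟨w, hw, rfl⟩ := hv
    obtain ⟨x, hx⟩ := he.span ζ w hw
    refine ⟨x, ?_⟩
    rw [hι.generated_restrict a hps, hsum]
    exact ⟨_, hx, map_sub _ _ _⟩

end

section

variable {E : Type*} [NormedAddCommGroup E] [NormedSpace ℂ E]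
  {Z : Type*} [TopologicalSpace Z] [ChartedSpace E Z] [IsManifold 𝓘(ℂ, E) ω Z]
  {T : TwistorSpace E Z} {s : CP1 → Z} {m : ℕ}
  {Ψ : ∀ ζ, (Fin m → ℂ) →ₗ[ℂ] TangentSpace 𝓘(ℂ, E) (s ζ)}

/-- The twisted symplectic form along the section `s`, in terms of a frame of the normal bundle. -/
def formAlong (T : TwistorSpace E Z) (Ψ : ∀ ζ, (Fin m → ℂ) →ₗ[ℂ] TangentSpace 𝓘(ℂ, E) (s ζ))
    (ζ : CP1) : (Fin m → ℂ) →L[ℂ] (Fin m → ℂ) →L[ℂ] ℂ :=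
  LinearMap.toContinuousLinearMap
    (LinearMap.toContinuousLinearMap.toLinearMap ∘ₗ (T.form (s ζ)).compl₁₂ (Ψ ζ) (Ψ ζ))

lemma formAlong_apply (ζ : CP1) (x y : Fin m → ℂ) :
    formAlong T Ψ ζ x y = T.form (s ζ) (Ψ ζ x) (Ψ ζ y) := rfl

lemma holAt_bilin {Ω : CP1 → (Fin m → ℂ) →L[ℂ] (Fin m → ℂ) →L[ℂ] ℂ} {p : CP1}
    (h : ∀ i j, HolAt (fun ζ => Ω ζ (Pi.single i 1) (Pi.single j 1)) p) : HolAt Ω p := by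
  let D : Fin m → Fin m → (Fin m → ℂ) →L[ℂ] (Fin m → ℂ) →L[ℂ] ℂ := fun i j =>
    (ContinuousLinearMap.proj (R := ℂ) (φ := fun _ : Fin m => ℂ) i).smulRight
      (ContinuousLinearMap.proj (R := ℂ) (φ := fun _ : Fin m => ℂ) j)
  have h1 : HolAt (fun ζ => ∑ i, ∑ j, Ω ζ (Pi.single i 1) (Pi.single j 1) • D i j) p :=
    HolAt.sum fun i _ => HolAt.sum fun j _ => (h i j).smul (HolAt.const _)
  refine h1.congr (Filter.Eventually.of_forall fun ζ => ?_)
  refine ContinuousLinearMap.ext fun x => ContinuousLinearMap.ext fun y => ?_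
  have hx : ∀ x : Fin m → ℂ, x = ∑ i, x i • (Pi.single i 1 : Fin m → ℂ) := fun x => by
    funext j
    simp [Finset.sum_apply, Pi.single_apply]
  conv_lhs => rw [hx x, hx y]
  simp only [map_sum, map_smul, _root_.sum_apply, _root_.smul_apply,
    smul_eq_mul, D, ContinuousLinearMap.smulRight_apply, ContinuousLinearMap.proj_apply]
  rw [Finset.sum_comm]
  refine Finset.sum_congr rfl fun i _ => ?_
  rw [Finset.mul_sum]
  exact Finset.sum_congr rfl fun j _ => by ring

/-- The form is holomorphic along a section: since the normal bundle is a sum of copies of `𝒪(1)`,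
the twists cancel. -/
lemma IsNormalFrame.holAt_formAlong [FiniteDimensional ℂ E] (hΨ : IsNormalFrame T.toRealSpace s Ψ)
    (hs : ContMDiff 𝓘(ℂ) 𝓘(ℂ, E) ω s) (hps : ∀ ζ, T.proj (s ζ) = ζ) (p : CP1) :
    HolAt (formAlong T Ψ) p := by
  have : FiniteDimensional ℂ (TangentSpace 𝓘(ℂ, E) (s p)) := inferInstanceAs (FiniteDimensional ℂ E)
  -- the form is holomorphic on local vertical vector fields, so its matrix is computed by expressing
  -- the constant sections of the trivial bundle in terms of those
  let b := Module.finBasis ℂ (T.vert (s p))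
  choose U V hUo hpU hV hVp hVU using fun j => exists_vertical_extension T.toRealSpace (b j).2
  choose f hf using fun j => hΨ.exists_eq fun ζ => hV j (s ζ)
  have hfO : ∀ j, HolAtO1 (f j) p := fun j => (hΨ.holAlongAt_iff (f j) p).1 (by
    simp only [hf]
    exact ((hVU j).contMDiffAt ((hUo j).mem_nhds (hpU j))).comp p hs.contMDiffAt)
  let v : Fin (Module.finrank ℂ (T.vert (s p))) → CP1 → Fin m → ℂ := fun j ζ => twist p ζ • f j ζ
  have hli : LinearIndependent ℂ fun j => v j p := by
    refine LinearIndependent.of_comp (Ψ p) ?_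
    have h1 := b.linearIndependent.map' (T.vert (s p)).subtype (Submodule.ker_subtype _)
    have h2 : (Ψ p ∘ fun j => v j p) = (T.vert (s p)).subtype ∘ b := by
      funext j
      simp only [Function.comp, v, twist_self, one_smul, hf, hVp, Submodule.subtype_apply]
    rw [h2]
    exact h1
  have hpair : ∀ i j, HolAt (fun ζ => formAlong T Ψ ζ (v i ζ) (v j ζ)) p := by
    intro i j
    have h1 := T.form_holomorphic (U i ∩ U j) (V i) (V j) ((hUo i).inter (hUo j)) (hV i) (hV j)
      ((hVU i).mono Set.inter_subset_left) ((hVU j).mono Set.inter_subset_right)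
    have h2 := h1.holAt_comp ((hUo i).inter (hUo j)) T.contMDiff_proj.continuous
      (hs.contMDiffAt (x := p)) hps ⟨hpU i, hpU j⟩
    refine h2.congr (Filter.Eventually.of_forall fun ζ => ?_)
    rw [formAlong_apply]
    simp only [v, map_smul, LinearMap.smul_apply, smul_eq_mul, hf]
    ring
  have hspan : ∀ᶠ ζ in 𝓝 p, ∀ w : Fin m → ℂ,
      ∃ x : Fin (Module.finrank ℂ (T.vert (s p))) → ℂ, w = ∑ j, x j • v j ζ := by
    have hcard : m = Module.finrank ℂ (T.vert (s p)) := by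
      rw [← hΨ.range_eq p, LinearMap.finrank_range_of_inj (hΨ.injective p), Module.finrank_fin_fun]
    filter_upwards [eventually_linearIndependent hfO hli] with ζ hζ w
    have h1 := hζ.span_eq_top_of_card_eq_finrank' (by
      rw [Fintype.card_fin, Module.finrank_fin_fun, ← hcard])
    obtain ⟨x, hx⟩ := (Submodule.mem_span_range_iff_exists_fun ℂ).1 (h1 ▸ Submodule.mem_top (x := w))
    exact ⟨x, hx.symm⟩
  choose c hc hcc using fun i : Fin m =>
    exists_holAt_coeff hfO hli (HolAt.const (p := p) (Pi.single i 1 : Fin m → ℂ))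
  refine holAt_bilin fun i j => ?_
  have h1 : HolAt (fun ζ => ∑ k, ∑ l, (c i k ζ * c j l ζ) * formAlong T Ψ ζ (v k ζ) (v l ζ)) p :=
    HolAt.sum fun k _ => HolAt.sum fun l _ => ((hc i k).mul (hc j l)).mul (hpair k l)
  refine h1.congr ?_
  filter_upwards [hspan, hcc i, hcc j] with ζ h2 h3 h4
  obtain ⟨x, hx⟩ := h2 (Pi.single i 1)
  obtain ⟨y, hy⟩ := h2 (Pi.single j 1)
  rw [hx, hy]
  simp only [← h3 x hx, ← h4 y hy, map_sum, map_smul, _root_.sum_apply,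
    _root_.smul_apply, smul_eq_mul]
  rw [Finset.sum_comm]
  refine Finset.sum_congr rfl fun k _ => ?_
  rw [Finset.mul_sum]
  exact Finset.sum_congr rfl fun l _ => by ring

lemma IsNormalFrame.formAlong_nondegenerate (hΨ : IsNormalFrame T.toRealSpace s Ψ) (ζ : CP1)
    (v : Fin m → ℂ) (h : ∀ w, formAlong T Ψ ζ v w = 0) : v = 0 := by
  have hmem : ∀ v, Ψ ζ v ∈ T.vert (s ζ) := fun v => hΨ.range_eq ζ ▸ LinearMap.mem_range_self _ v
  refine hΨ.injective ζ ?_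
  rw [map_zero]
  refine T.form_nondegenerate _ _ (hmem v) fun w hw => ?_
  obtain ⟨w, rfl⟩ := LinearMap.mem_range.1 ((hΨ.range_eq ζ).symm ▸ hw)
  exact h w

lemma IsNormalFrame.comap_perp (hΨ : IsNormalFrame T.toRealSpace s Ψ) {ζ : CP1}
    {A : Submodule ℂ (TangentSpace 𝓘(ℂ, E) (s ζ))} (hA : A ≤ T.vert (s ζ)) :
    (T.perp A).comap (Ψ ζ) = orth (formAlong T Ψ ζ) (A.comap (Ψ ζ)) := by
  ext y
  rw [mem_orth]
  constructor
  · exact fun h w hw => h.2 _ hw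
  · refine fun h => ⟨hΨ.range_eq ζ ▸ LinearMap.mem_range_self _ y, fun w hw => ?_⟩
    obtain ⟨w, rfl⟩ := LinearMap.mem_range.1 ((hΨ.range_eq ζ).symm ▸ hA hw)
    exact h w hw

lemma TwistorSpace.perp_anti {z : Z} {A B : Submodule ℂ (TangentSpace 𝓘(ℂ, E) z)} (h : A ≤ B) :
    T.perp B ≤ T.perp A := fun _ hv => ⟨hv.1, fun w hw => hv.2 w (h hw)⟩

end

end TwistorQuotient

end

open TwistorQuotient in
theorem mainTheorem2
    {E : Type*} [NormedAddCommGroup E] [NormedSpace ℂ E] [FiniteDimensional ℂ E]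
    {Z : Type*} [TopologicalSpace Z] [ChartedSpace E Z] [IsManifold 𝓘(ℂ, E) ω Z] [T2Space Z]
    {EG : Type*} [NormedAddCommGroup EG] [NormedSpace ℂ EG] [FiniteDimensional ℂ EG]
    {G : Type*} [TopologicalSpace G] [ChartedSpace EG G] [IsManifold 𝓘(ℂ, EG) ω G] [T2Space G]
    {EH : Type*} [NormedAddCommGroup EH] [NormedSpace ℂ EH] [FiniteDimensional ℂ EH]
    {H : Type*} [TopologicalSpace H] [ChartedSpace EH H] [IsManifold 𝓘(ℂ, EH) ω H] [T2Space H]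
    (T : TwistorSpace E Z) (𝒢 : TwistorGroup EG G) (ℋ : TwistorGroup EH H)
    (ι : H → G) (hι : IsTwistorSubgroup ℋ 𝒢 ι)
    (hquot : IsSumOfO 1 𝒢.one 𝒢.lie (lieImage ℋ 𝒢 ι))
    (a : TwistorAction 𝒢 T.toRealSpace) (hfree : a.LocallyFree) (hsymp : a.IsSymplectic)
    (μ : MomentMapData 𝒢 T.toRealSpace) (hμ : a.IsMomentMap μ)
    (s : CP1 → Z) (hs : a.IsAdmissible s) (hinv : IsInvariantAlong μ s) :
    (a.restrict hι).IsAdmissible s ∧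
    ∀ ζ, (a.restrict hι).generated s ζ ≤ T.perp ((a.restrict hι).generated s ζ) := by
  have hs' := hs.twistorSection.holomorphic
  have hps := hs.twistorSection.proj_section
  obtain ⟨m, Ψ, hΨ⟩ := hs.twistorSection.exists_normalFrame
  have hb : (a.restrict hι).LocallyFree := hι.locallyFree hfree
  have hvertL := a.generated_le_vert (s := s) hps
  have hvertP := (a.restrict hι).generated_le_vert (s := s) hps
  have hPL : ∀ ζ, (a.restrict hι).generated s ζ ≤ a.generated s ζ := by
    intro ζ
    rw [hι.generated_restrict a hps]
    refine Submodule.map_mono ?_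
    rintro _ ⟨X, hX, rfl⟩
    exact hι.lieIncl_mem hX
  have hLL : ∀ ζ, a.generated s ζ ≤ T.perp (a.generated s ζ) := by
    intro ζ v hv
    refine ⟨hvertL ζ hv, ?_⟩
    obtain ⟨Y, hY, rfl⟩ := hv
    rintro _ ⟨X, hX, rfl⟩
    -- `ζ` and `p (s ζ)` are equal, but index different types
    have key : ∀ ξ, T.proj (s ζ) = ξ → ξ = ζ → ∀ X' ∈ 𝒢.lie ξ, ∀ Y' ∈ 𝒢.lie ξ,
        T.form (s ζ) (a.infAct ξ (s ζ) X') (a.infAct ξ (s ζ) Y') = 0 := by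
      rintro ξ rfl hξ X' hX' Y' hY'
      refine hμ.form_infAct_eq_zero (fun g hg W hW => ?_) hX' hY'
      have h1 := hinv g W hW
      rw [hg, hξ] at h1
      exact h1
    exact key ζ (hps ζ) rfl X hX Y hY
  have hPP : ∀ ζ, (a.restrict hι).generated s ζ ≤ T.perp ((a.restrict hι).generated s ζ) :=
    fun ζ => ((hPL ζ).trans (hLL ζ)).trans (T.perp_anti (hPL ζ))
  refine ⟨⟨hb, ⟨hsymp.restrict hι, _, hμ.restrict hι⟩, hs.twistorSection, ?_⟩, hPP⟩
  -- frames of `L / P` and of `L^⊥ / L`, as families of subspaces of the trivial bundle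
  obtain ⟨r, e, he⟩ := hquot.exists_frame
  obtain ⟨f, hf⟩ := (hι.isFrameO1_generated hfree hs' hps he).exists_isQuotFrame hΨ hvertL
  obtain ⟨r', e', he'⟩ := hs.isSumOfO.exists_frame
  obtain ⟨f', hf'⟩ := he'.exists_isQuotFrame hΨ fun ζ v hv => hv.1
  have hP := hb.isSubbundle_generated hs' hps hΨ
  simp only [fun ζ => hΨ.comap_perp (hvertL ζ)] at hf'
  obtain ⟨g, hg⟩ := exists_quotFrame_orth (hΨ.holAt_formAlong hs' hps) hΨ.formAlong_nondegenerate hP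
    (hfree.isSubbundle_generated hs' hps hΨ) (fun ζ => Submodule.comap_mono (hPL ζ))
    (fun ζ => by rw [← hΨ.comap_perp (hvertL ζ)]; exact Submodule.comap_mono (hLL ζ)) hf hf'
  simp only [← fun ζ => hΨ.comap_perp (hvertP ζ)] at hg
  exact hg.isSumOfO hΨ (fun ζ v hv => hv.1) hP
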